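/- Let $\theta>0$. Consider a real-valued stochastic process $(Z_t)_{t\ge 0}$ on a probability space that is a Markov process (with respect to its own filtration), is $\{0,1,2,\dots\}$-valued for $t\neq 1$, and is made of three pieces: (i) $(Z_t)_{0\le t<1}$ is the non-homogeneous linear pure birth process with immigration, started at $Z_0=0$ a.s., with birth rates $\lambda_n(t)=\dfrac{n+1/\theta^2}{1-t}$; that is, its transition probabilities $p_{jk}(s,t)=\Pr(Z_t=k\mid Z_s=j)$ vanish for $k<j$ and solve Kolmogorov's forward equations $\partial_t p_{jk}(s,t)=\lambda_{k-1}(t)p_{j,k-1}(s,t)-\lambda_k(t)p_{jk}(s,t)$ (the first term being absent for $k=0$), $p_{jk}(s,s)=\delta_{jk}$; (ii) $Z_1=\lim_{t\uparrow 1}(1-t)Z_t$ almost surely; (iii) $(Z_t)_{t>1}$ is the pure death process with death rates $\mu_n(t)=\dfrac{n}{t-1}$ (its transition probabilities vanish for $k>j$ and solve $\partial_t p_{jk}(s,t)=\mu_{k+1}(t)p_{j,k+1}(s,t)-\mu_k(t)p_{jk}(s,t)$, $p_{jk}(s,s)=\delta_{jk}$), with the entrance law: for $t>1$ the conditional law of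 $Z_t$ given $Z_1$ is Poisson with parameter $Z_1/(t-1)$. Such a process exists. For every such process $(Z_t)$, define $$X_t=\begin{cases}\theta(1-t)Z_t-\frac{t}{\theta}, & 0\le t<1,\\ \theta Z_1-\frac1\theta, & t=1,\\ \theta(t-1)Z_t-\frac1\theta, & t>1.\end{cases}$$ Then $(X_t)_{t\ge0}$ is a bi-Poisson process with parameters $\eta=\theta$, $\theta$ and $q=1$; that is, $(X_t)$ is a square-integrable Markov process such that, for all $s,t\ge 0$, $$E(X_t)=0,\qquad E(X_tX_s)=\min\{t,s\},$$ and, for all $0\le s<t<u$, with $\mathcal F_{s,u}=\sigma\{X_r:\ 0\le r\le s\ \text{or}\ r>u\}$, almost surely $$E(X_t\mid\mathcal F_{s,u})=\frac{u-t}{u-s}X_s+\frac{t-s}{u-s}X_u,$$ $$\operatorname{Var}(X_t\mid\mathcal F_{s,u})=\frac{(u-t)(t-s)}{u-s}\left(1+\theta\,\frac{uX_s-sX_u}{u-s}+\theta\,\frac{X_u-X_s}{u-s}\right).$$ -/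

import Mathlib

open MeasureTheory ProbabilityTheory Filter Topology Set

namespace BiPoisson

/-- The σ-algebra `σ(Y r : r ∈ S)` generated by the real random variables `Y r` with `r ∈ S`. -/
abbrev sigmaOn {Ω : Type*} (Y : ℝ → Ω → ℝ) (S : Set ℝ) : MeasurableSpace Ω :=
  ⨆ r ∈ S, MeasurableSpace.comap (Y r) inferInstance

/-- `(Y t)` with `t ∈ I` is a Markov process with respect to its own filtration: for `s ≤ t` in `I`,
the conditional law of `Y t` given `σ(Y r : r ∈ I, r ≤ s)` is the conditional law given `Y s`. -/
def IsMarkovOn {Ω : Type*} [MeasurableSpace Ω] (P : Measure Ω) (I : Set ℝ)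
    (Y : ℝ → Ω → ℝ) : Prop :=
  ∀ s ∈ I, ∀ t ∈ I, s ≤ t → ∀ A : Set ℝ, MeasurableSet A →
    P⟦Y t ⁻¹' A | sigmaOn Y (I ∩ Iic s)⟧ =ᵐ[P] P⟦Y t ⁻¹' A | sigmaOn Y {s}⟧

/-- `p s t j k` (for `s ≤ t` in `I`) are the transition probabilities from state `j` at time `s` to
state `k` at time `t` of a non-homogeneous pure birth process with birth rates `rate n t`: there are
no downward transitions, and Kolmogorov's forward equations hold with `p s s j k = δ_{jk}`.
(These conditions determine `p`.) -/
structure IsPureBirthTransition (rate : ℕ → ℝ → ℝ) (I : Set ℝ)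
    (p : ℝ → ℝ → ℕ → ℕ → ℝ) : Prop where
  initial : ∀ s ∈ I, ∀ j k : ℕ, p s s j k = if j = k then 1 else 0
  no_down : ∀ s ∈ I, ∀ t ∈ I, s ≤ t → ∀ j k : ℕ, k < j → p s t j k = 0
  forward_zero : ∀ s ∈ I, ∀ t ∈ I, s ≤ t → ∀ j : ℕ,
    HasDerivWithinAt (fun v => p s v j 0) (-(rate 0 t * p s t j 0)) (Ici s) t
  forward_succ : ∀ s ∈ I, ∀ t ∈ I, s ≤ t → ∀ j k : ℕ,
    HasDerivWithinAt (fun v => p s v j (k + 1))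
      (rate k t * p s t j k - rate (k + 1) t * p s t j (k + 1)) (Ici s) t

/-- `p s t j k` (for `s ≤ t` in `I`) are the transition probabilities from state `j` at time `s` to
state `k` at time `t` of a non-homogeneous pure death process with death rates `rate n t`: there are
no upward transitions, and Kolmogorov's forward equations hold with `p s s j k = δ_{jk}`.
(These conditions determine `p`.) -/
structure IsPureDeathTransition (rate : ℕ → ℝ → ℝ) (I : Set ℝ)
    (p : ℝ → ℝ → ℕ → ℕ → ℝ) : Prop where
  initial : ∀ s ∈ I, ∀ j k : ℕ, p s s j k = if j = k then 1 else 0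
  no_up : ∀ s ∈ I, ∀ t ∈ I, s ≤ t → ∀ j k : ℕ, j < k → p s t j k = 0
  forward : ∀ s ∈ I, ∀ t ∈ I, s ≤ t → ∀ j k : ℕ,
    HasDerivWithinAt (fun v => p s v j k)
      (rate (k + 1) t * p s t j (k + 1) - rate k t * p s t j k) (Ici s) t

/-- `(Y t)`, `t ∈ I`, is a (Markov) process with values in `{0, 1, 2, …}` and transition
probabilities `p`: `P(Y t = k | Y r, r ∈ I, r ≤ s) = p s t (Y s) k` almost surely. -/
def HasTransitions {Ω : Type*} [MeasurableSpace Ω] (P : Measure Ω) (I : Set ℝ)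
    (p : ℝ → ℝ → ℕ → ℕ → ℝ) (Y : ℝ → Ω → ℝ) : Prop :=
  (∀ t ∈ I, ∀ ω, ∃ n : ℕ, Y t ω = n) ∧
  ∀ s ∈ I, ∀ t ∈ I, s ≤ t → ∀ k : ℕ,
    P⟦Y t ⁻¹' {(k : ℝ)} | sigmaOn Y (I ∩ Iic s)⟧ =ᵐ[P] fun ω => p s t ⌊Y s ω⌋₊ k

/-- `(Y t)`, `t ∈ I`, is a pure birth process with birth rates `rate n t`. -/
def IsPureBirth {Ω : Type*} [MeasurableSpace Ω] (P : Measure Ω) (I : Set ℝ)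
    (rate : ℕ → ℝ → ℝ) (Y : ℝ → Ω → ℝ) : Prop :=
  ∃ p, IsPureBirthTransition rate I p ∧ HasTransitions P I p Y

/-- `(Y t)`, `t ∈ I`, is a pure death process with death rates `rate n t`. -/
def IsPureDeath {Ω : Type*} [MeasurableSpace Ω] (P : Measure Ω) (I : Set ℝ)
    (rate : ℕ → ℝ → ℝ) (Y : ℝ → Ω → ℝ) : Prop :=
  ∃ p, IsPureDeathTransition rate I p ∧ HasTransitions P I p Y

/-- The Markov process `(Z t)`, `t ≥ 0`, joined from three pieces: a linear pure birth process with
immigration on `[0,1)` started at `0`, its normalised limit at time `1`, and a linear pure death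
process on `(1,∞)` entering by the Poisson law with parameter `Z 1 / (t - 1)`. -/
structure IsJoinedProcess {Ω : Type*} [MeasurableSpace Ω] (P : Measure Ω) (θ : ℝ)
    (Z : ℝ → Ω → ℝ) : Prop where
  measurable : ∀ t, 0 ≤ t → Measurable (Z t)
  markov : IsMarkovOn P (Ici 0) Z
  start : ∀ᵐ ω ∂P, Z 0 ω = 0
  birth : IsPureBirth P (Ico 0 1) (fun n t => (n + 1 / θ ^ 2) / (1 - t)) Z
  limit : ∀ᵐ ω ∂P, Tendsto (fun t => (1 - t) * Z t ω) (𝓝[<] 1) (𝓝 (Z 1 ω))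
  entrance : ∀ t, 1 < t → ∀ k : ℕ,
    P⟦Z t ⁻¹' {(k : ℝ)} | sigmaOn Z {1}⟧ =ᵐ[P]
      fun ω => Real.exp (-(Z 1 ω / (t - 1))) * (Z 1 ω / (t - 1)) ^ k / (k.factorial : ℝ)
  death : IsPureDeath P (Ioi 1) (fun n t => n / (t - 1)) Z

/-- The time-dependent affine transformation of `Z` into `X`. -/
noncomputable def affineTransform {Ω : Type*} (θ : ℝ) (Z : ℝ → Ω → ℝ) : ℝ → Ω → ℝ :=
  fun t ω =>
    if t < 1 then θ * (1 - t) * Z t ω - t / θ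
    else if t = 1 then θ * Z 1 ω - 1 / θ
    else θ * (t - 1) * Z t ω - 1 / θ

/-- `(X t)`, `t ≥ 0`, is a bi-Poisson process with parameters `(η, θ, q)`: a square-integrable
Markov process with mean zero, covariance `min s t`, and with conditional mean and conditional
variance given `σ(X r : 0 ≤ r ≤ s or r > u)` of the quadratic harness form. -/
structure IsBiPoisson {Ω : Type*} [MeasurableSpace Ω] (P : Measure Ω) (η θ q : ℝ)
    (X : ℝ → Ω → ℝ) : Prop where
  measurable : ∀ t, 0 ≤ t → Measurable (X t)
  memLp : ∀ t, 0 ≤ t → MemLp (X t) 2 P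
  markov : IsMarkovOn P (Ici 0) X
  mean : ∀ t, 0 ≤ t → ∫ ω, X t ω ∂P = 0
  cov : ∀ s t, 0 ≤ s → 0 ≤ t → ∫ ω, X t ω * X s ω ∂P = min t s
  condMean : ∀ s t u, 0 ≤ s → s < t → t < u →
    P[X t | sigmaOn X (Icc 0 s ∪ Ioi u)] =ᵐ[P]
      fun ω => (u - t) / (u - s) * X s ω + (t - s) / (u - s) * X u ω
  condVariance : ∀ s t u, 0 ≤ s → s < t → t < u →
    Var[X t; P | sigmaOn X (Icc 0 s ∪ Ioi u)] =ᵐ[P]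
      fun ω => (u - t) * (t - s) / (u - q * s) *
        (1 + η * ((u * X s ω - s * X u ω) / (u - s)) + θ * ((X u ω - X s ω) / (u - s))
          - (1 - q) * ((u * X s ω - s * X u ω) * (X u ω - X s ω) / (u - s) ^ 2))

end BiPoisson

/-!
A process as in the statement is a mixed Poisson process seen through a time change. Take a random
variable `Λ` with the gamma law of shape `1 / θ ^ 2` and, independently of it, two independent
Poisson processes `N`, `N'` of rate one, and set `Z_t = N (Λ t / (1 - t))` for `t < 1`, `Z_1 = Λ`
and `Z_t = N' (Λ / (t - 1))` for `t > 1`. Given `Λ` the two halves are independent, the first one is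
a Poisson count that increases with `t`, the second one a Poisson count that decreases with `t`.

*Existence.* Averaging over the gamma posterior of `Λ`, the first half gets negative binomial
transition probabilities; the second half is a binomial thinning. These solve the two systems of
forward equations, the law of large numbers gives the limit at time `1`, and the Markov property is
checked on cylinder sets (`isJoinedProcess_modelZ`). The Poisson process itself is built by throwing
a Poisson number of uniform points into each interval `(k, k + 1]`.

*Uniqueness.* The forward equations are triangular, hence have one solution
(`IsPureBirthTransition.unique`, `IsPureDeathTransition.unique`). Together with the initial value,
the limit at time `1` and the entrance law they determine all joint laws at two times, and by the
Markov property at three times (`IsJoinedProcess.map_triple_eq`). So the moment identities below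
need only be verified in the model.

*Harness identities.* For `s < t < u` the three values are affine functions of `Λ` and of Poisson
counts with means proportional to `Λ`. According to the position of `1` relative to `s`, `t`, `u`,
the conditional law of the middle value given the outer ones is a binomial, a shifted Poisson, a
gamma or a shifted negative binomial law; its mean and variance follow from the shift identity
`E[N f(N)] = c E[f(N + 1)]` of the Poisson law and from the corresponding identity for the gamma
law. This gives `model_harness`: the deviation of `X_t` from the interpolation between `X_s` and
`X_u`, and its square minus the claimed variance, are orthogonal to bounded functions of `X_s` and
`X_u`.

*Conclusion.* For a Markov process, orthogonality to products `g (X_s) * k (X_u)` implies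
orthogonality to everything in `σ(X_r : r ≤ s or r ≥ u)`
(`IsMarkovOn.condExp_two_sided_eq_zero`). The σ-algebra of the statement involves only times
`r > u`; but `E (X_r - X_u) ^ 2 = r - u`, so `X_u` is an almost sure limit of some `X_r` with
`r ↓ u` (`aestronglyMeasurable_sigmaOn_Ioi`), and the interpolation and the claimed variance are
measurable with respect to this σ-algebra up to null sets.
-/

namespace BiPoisson

/-! ### Generated σ-algebras and the Markov property -/

section Sigma

variable {Ω : Type*} {Y : ℝ → Ω → ℝ}

lemma sigmaOn_le [mΩ : MeasurableSpace Ω] {S : Set ℝ} (hY : ∀ t ∈ S, Measurable (Y t)) :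
    sigmaOn Y S ≤ mΩ :=
  iSup₂_le fun t ht => (hY t ht).comap_le

lemma sigmaOn_mono {S T : Set ℝ} (h : S ⊆ T) : sigmaOn Y S ≤ sigmaOn Y T :=
  biSup_mono h

lemma measurable_sigmaOn {S : Set ℝ} {t : ℝ} (ht : t ∈ S) : Measurable[sigmaOn Y S] (Y t) :=
  Measurable.mono (comap_measurable (Y t)) (le_iSup₂ (f := fun r (_ : r ∈ S) =>
    MeasurableSpace.comap (Y r) inferInstance) t ht) le_rfl

lemma sigmaOn_singleton (s : ℝ) : sigmaOn Y {s} = MeasurableSpace.comap (Y s) inferInstance := by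
  simp [sigmaOn]

lemma sigmaOn_union (S T : Set ℝ) : sigmaOn Y (S ∪ T) = sigmaOn Y S ⊔ sigmaOn Y T :=
  iSup_union

/-- Two finite measures that agree on the finite-dimensional cylinder events of `(Y r)`, `r ∈ S`,
agree on the σ-algebra generated by these variables. -/
lemma measure_eq_of_cylinder [mΩ : MeasurableSpace Ω] {S : Set ℝ}
    (hY : ∀ t ∈ S, Measurable (Y t)) {μ ν : Measure Ω} [IsFiniteMeasure μ]
    (h : ∀ (F : Finset ℝ) (A : ℝ → Set ℝ), (F : Set ℝ) ⊆ S → (∀ r, MeasurableSet (A r)) →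
      μ (⋂ r ∈ F, Y r ⁻¹' A r) = ν (⋂ r ∈ F, Y r ⁻¹' A r))
    {E : Set Ω} (hE : MeasurableSet[sigmaOn Y S] E) : μ E = ν E := by
  refine ext_on_measurableSpace_of_generate_finite mΩ _ ?_ (sigmaOn_le hY)
    (generateFrom_piiUnionInter_measurableSet
      (fun r => MeasurableSpace.comap (Y r) inferInstance) S).symm
    (isPiSystem_piiUnionInter _ (fun r => @MeasurableSpace.isPiSystem_measurableSet Ω
      (MeasurableSpace.comap (Y r) inferInstance)) S) ?_ hE
  · rintro _ ⟨F, hF, f, hf, rfl⟩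
    have hf' : ∀ r, ∃ A : Set ℝ, MeasurableSet A ∧ (r ∈ F → Y r ⁻¹' A = f r) := by
      intro r
      by_cases hr : r ∈ F
      · obtain ⟨A, hA, hAe⟩ := hf r hr
        exact ⟨A, hA, fun _ => hAe⟩
      · exact ⟨∅, MeasurableSet.empty, fun h => absurd h hr⟩
    choose A hA hAe using hf'
    have : (⋂ r ∈ F, f r) = ⋂ r ∈ F, Y r ⁻¹' A r :=
      iInter₂_congr fun r hr => (hAe r hr).symm
    rw [this]
    exact h F A hF hA
  · simpa using h ∅ (fun _ => ∅) (by simp) (fun _ => MeasurableSet.empty)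

end Sigma

section CondExp

variable {Ω : Type*} {m m₁ m₂ mΩ : MeasurableSpace Ω} {P : Measure Ω} [IsProbabilityMeasure P]

variable (m) in
lemma condExp_indicator_mem_Icc {C : Set Ω} (hC : MeasurableSet C) :
    ∀ᵐ ω ∂P, 0 ≤ (P⟦C | m⟧) ω ∧ (P⟦C | m⟧) ω ≤ 1 := by
  have hint : Integrable (C.indicator (fun _ => (1 : ℝ))) P :=
    (integrable_const 1).indicator hC
  have h0 : 0 ≤ᵐ[P] P⟦C | m⟧ :=
    condExp_nonneg (Eventually.of_forall fun ω => indicator_nonneg (fun _ _ => zero_le_one) ω)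
  by_cases hm : m ≤ mΩ
  · have h1 : P⟦C | m⟧ ≤ᵐ[P] P[fun _ => (1 : ℝ) | m] :=
      condExp_mono hint (integrable_const 1)
        (Eventually.of_forall fun ω => indicator_le_self' (fun _ _ => zero_le_one) ω)
    rw [condExp_const hm] at h1
    filter_upwards [h0, h1] with ω a b using ⟨a, b⟩
  · simp [condExp_of_not_le hm]

/-- Conditional expectation is self-adjoint. -/
lemma integral_condExp_mul_comm (hm : m₁ ≤ mΩ) {u f : Ω → ℝ} (hu : AEStronglyMeasurable u P)
    {K : ℝ} (hK : ∀ᵐ ω ∂P, |u ω| ≤ K) (hf : Integrable f P) :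
    ∫ ω, u ω * (P[f | m₁]) ω ∂P = ∫ ω, (P[u | m₁]) ω * f ω ∂P := by
  have hui : Integrable u P := Integrable.of_bound hu K hK
  have hK' : ∀ᵐ ω ∂P, ‖(P[u | m₁]) ω‖ ≤ K := by
    have := ae_bdd_abs_condExp_of_ae_bdd_abs (m := m₁) (μ := P) hK
    simpa [Real.norm_eq_abs] using this
  have h1 : Integrable (fun ω => u ω * (P[f | m₁]) ω) P :=
    integrable_condExp.bdd_mul hu hK
  have h2 : Integrable (fun ω => (P[u | m₁]) ω * f ω) P :=
    hf.bdd_mul integrable_condExp.aestronglyMeasurable hK'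
  calc ∫ ω, u ω * (P[f | m₁]) ω ∂P
      = ∫ ω, (P[fun ω => u ω * (P[f | m₁]) ω | m₁]) ω ∂P := (integral_condExp hm).symm
    _ = ∫ ω, (P[u | m₁]) ω * (P[f | m₁]) ω ∂P :=
        integral_congr_ae (condExp_mul_of_stronglyMeasurable_right stronglyMeasurable_condExp h1 hui)
    _ = ∫ ω, (P[fun ω => (P[u | m₁]) ω * f ω | m₁]) ω ∂P :=
        integral_congr_ae
          (condExp_mul_of_stronglyMeasurable_left stronglyMeasurable_condExp h2 hf).symm
    _ = _ := integral_condExp hm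

/-- The measure whose density is the conditional probability of `C` given `m`. -/
noncomputable def condDensity {Ω : Type*} (m : MeasurableSpace Ω) {mΩ : MeasurableSpace Ω}
    (P : Measure Ω) (C : Set Ω) : Measure Ω :=
  P.withDensity fun ω => ENNReal.ofReal ((P⟦C | m⟧) ω)

variable (m) in
lemma integral_condDensity {C : Set Ω} (hC : MeasurableSet C)
    (f : Ω → ℝ) :
    ∫ ω, f ω ∂(condDensity m P C) = ∫ ω, (P⟦C | m⟧) ω * f ω ∂P := by
  rw [condDensity, integral_withDensity_eq_integral_toReal_smul₀]
  · refine integral_congr_ae ?_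
    filter_upwards [condExp_indicator_mem_Icc (P := P) m hC] with ω h
    simp [ENNReal.toReal_ofReal h.1]
  · exact integrable_condExp.aestronglyMeasurable.aemeasurable.ennreal_ofReal
  · simp

instance isFiniteMeasure_condDensity (C : Set Ω) :
    IsFiniteMeasure (condDensity m P C) :=
  isFiniteMeasure_withDensity_ofReal integrable_condExp.2

/-- The integral of a conditional expectation over `C` is the integral of the function itself against
the conditional probability of `C`. -/
lemma setIntegral_condExp_eq_integral_condDensity (h₁ : m₁ ≤ mΩ)
    {C : Set Ω} (hC : MeasurableSet C) {f : Ω → ℝ} (hf : Integrable f P) :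
    ∫ ω in C, (P[f | m₁]) ω ∂P = ∫ ω, f ω ∂(condDensity m₁ P C) := by
  rw [integral_condDensity _ hC, ← integral_condExp_mul_comm (K := 1) h₁ _ _ hf,
    ← integral_indicator hC]
  · refine integral_congr_ae (Eventually.of_forall fun ω => ?_)
    by_cases h : ω ∈ C <;> simp [h]
  · exact ((integrable_const 1).indicator hC).aestronglyMeasurable
  · refine Eventually.of_forall fun ω => ?_
    by_cases h : ω ∈ C <;> simp [h]

/-- Conditioning `f` on the larger σ-algebra `m₂` or on `m₁` gives the same result if and only if
`f` does not distinguish between the event `C` and its conditional probability, `C ∈ m₂`. -/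
lemma condExp_eq_condExp_iff (h₁₂ : m₁ ≤ m₂) (h₂ : m₂ ≤ mΩ) {f : Ω → ℝ} (hf : Integrable f P) :
    P[f | m₂] =ᵐ[P] P[f | m₁] ↔
      ∀ C, MeasurableSet[m₂] C → ∫ ω in C, f ω ∂P = ∫ ω, f ω ∂(condDensity m₁ P C) := by
  constructor
  · intro h C hC
    rw [← setIntegral_condExp_eq_integral_condDensity (h₁₂.trans h₂) (h₂ C hC) hf,
      ← setIntegral_condExp h₂ hf hC]
    exact integral_congr_ae (ae_restrict_of_ae h)
  · intro h
    refine (ae_eq_condExp_of_forall_setIntegral_eq h₂ hf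
      (fun _ _ _ => integrable_condExp.integrableOn) (fun C hC _ => ?_)
      (stronglyMeasurable_condExp.mono h₁₂).aestronglyMeasurable).symm
    rw [setIntegral_condExp_eq_integral_condDensity (h₁₂.trans h₂) (h₂ C hC) hf, h C hC]

/-- If the conditional expectation given `m₂` of a function is `m₁`-measurable, it is the
conditional expectation given `m₁`. -/
lemma condExp_eq_of_condExp_eq (h₁₂ : m₁ ≤ m₂) (h₂ : m₂ ≤ mΩ) {f g : Ω → ℝ}
    (hg : AEStronglyMeasurable[m₁] g P) (h : P[f | m₂] =ᵐ[P] g) : P[f | m₁] =ᵐ[P] g := by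
  have hgi : Integrable g P := integrable_condExp.congr h
  calc P[f | m₁] =ᵐ[P] P[P[f | m₂] | m₁] := (condExp_condExp_of_le h₁₂ h₂).symm
    _ =ᵐ[P] P[g | m₁] := condExp_congr_ae h
    _ =ᵐ[P] g := condExp_of_aestronglyMeasurable' (h₁₂.trans h₂) hg hgi

end CondExp

section Markov

variable {Ω : Type*} [mΩ : MeasurableSpace Ω] {P : Measure Ω} [IsProbabilityMeasure P]
  {Y : ℝ → Ω → ℝ}

lemma sigmaOn_Ici_inter_le (hY : ∀ t, 0 ≤ t → Measurable (Y t)) {S : Set ℝ}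
    (hS : S ⊆ Ici 0) : sigmaOn Y S ≤ mΩ :=
  sigmaOn_le fun t ht => hY t (hS ht)

/-- The Markov property for bounded functions of the process at one later time. -/
lemma IsMarkovOn.condExp_comp (hM : IsMarkovOn P (Ici 0) Y)
    (hY : ∀ t, 0 ≤ t → Measurable (Y t)) {s t : ℝ} (hs : 0 ≤ s) (hst : s ≤ t)
    {φ : ℝ → ℝ} (hφ : Measurable φ) {K : ℝ} (hK : ∀ x, |φ x| ≤ K) :
    P[fun ω => φ (Y t ω) | sigmaOn Y (Ici 0 ∩ Iic s)] =ᵐ[P]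
      P[fun ω => φ (Y t ω) | sigmaOn Y {s}] := by
  have ht : 0 ≤ t := hs.trans hst
  have h₂ : sigmaOn Y (Ici 0 ∩ Iic s) ≤ mΩ := sigmaOn_Ici_inter_le hY inter_subset_left
  have h₁₂ : sigmaOn Y {s} ≤ sigmaOn Y (Ici 0 ∩ Iic s) := sigmaOn_mono (by simpa using hs)
  have hint : Integrable (fun ω => φ (Y t ω)) P :=
    Integrable.of_bound (hφ.comp (hY t ht)).aestronglyMeasurable K
      (Eventually.of_forall fun ω => hK _)
  refine (condExp_eq_condExp_iff h₁₂ h₂ hint).2 fun C hC => ?_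
  have hmap : (P.restrict C).map (Y t) = (condDensity (sigmaOn Y {s}) P C).map (Y t) := by
    ext A hA
    have hA' : MeasurableSet (Y t ⁻¹' A) := hY t ht hA
    have := (condExp_eq_condExp_iff h₁₂ h₂ ((integrable_const (1 : ℝ)).indicator hA')).1
      (hM s hs t ht hst A hA) C hC
    rw [integral_indicator hA', integral_indicator hA'] at this
    rw [Measure.map_apply (hY t ht) hA, Measure.map_apply (hY t ht) hA]
    simpa [Measure.real, ENNReal.toReal_eq_toReal_iff'] using this
  rw [← integral_map (hY t ht).aemeasurable hφ.aestronglyMeasurable, hmap,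
    integral_map (hY t ht).aemeasurable hφ.aestronglyMeasurable]

/-- A conditional probability given `Y s` is a function of `Y s` with values in `[0, 1]`. -/
lemma exists_condExp_eq_comp (s : ℝ)
    {C : Set Ω} (hC : MeasurableSet C) :
    ∃ h : ℝ → ℝ, Measurable h ∧ (∀ x, |h x| ≤ 1) ∧
      P⟦C | sigmaOn Y {s}⟧ =ᵐ[P] fun ω => h (Y s ω) := by
  have hm : StronglyMeasurable[sigmaOn Y {s}] (P⟦C | sigmaOn Y {s}⟧) := stronglyMeasurable_condExp
  rw [sigmaOn_singleton] at hm
  obtain ⟨h, hh, he⟩ := hm.measurable.exists_eq_measurable_comp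
  refine ⟨fun x => max 0 (min (h x) 1), by fun_prop, fun x => ?_, ?_⟩
  · rw [abs_of_nonneg (le_max_left _ _)]
    simp
  · filter_upwards [condExp_indicator_mem_Icc (P := P) (sigmaOn Y {s}) hC] with ω hω
    rw [sigmaOn_singleton] at hω ⊢
    rw [he] at hω ⊢
    simp only [Function.comp_apply] at hω ⊢
    rw [min_eq_left hω.2, max_eq_right hω.1]

/-- The Markov property for events determined by the process at finitely many later times. -/
lemma IsMarkovOn.condExp_cylinder (hM : IsMarkovOn P (Ici 0) Y)
    (hY : ∀ t, 0 ≤ t → Measurable (Y t)) (F : Finset ℝ) (A : ℝ → Set ℝ)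
    (hA : ∀ r, MeasurableSet (A r)) : ∀ s, 0 ≤ s → (∀ r ∈ F, s ≤ r) →
    P⟦⋂ r ∈ F, Y r ⁻¹' A r | sigmaOn Y (Ici 0 ∩ Iic s)⟧ =ᵐ[P]
      P⟦⋂ r ∈ F, Y r ⁻¹' A r | sigmaOn Y {s}⟧ := by
  induction F using Finset.induction_on_min with
  | empty =>
    intro s hs _
    have h₂ : sigmaOn Y (Ici 0 ∩ Iic s) ≤ mΩ := sigmaOn_Ici_inter_le hY inter_subset_left
    have h₁₂ : sigmaOn Y {s} ≤ sigmaOn Y (Ici 0 ∩ Iic s) := sigmaOn_mono (by simpa using hs)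
    simp [condExp_const h₂, condExp_const (h₁₂.trans h₂)]
  | insert a F' hmin ih =>
    intro s hs hsF
    have hsa : s ≤ a := hsF a (Finset.mem_insert_self _ _)
    have ha : 0 ≤ a := hs.trans hsa
    have hsetF : MeasurableSet (⋂ r ∈ F', Y r ⁻¹' A r) := by
      refine Finset.measurableSet_biInter _ fun r hr => hY r ?_ (hA r)
      exact ha.trans (hmin r hr).le
    obtain ⟨h, hh, hb, he⟩ := exists_condExp_eq_comp (P := P) (Y := Y) a hsetF
    have h₂ : sigmaOn Y (Ici 0 ∩ Iic s) ≤ mΩ := sigmaOn_Ici_inter_le hY inter_subset_left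
    have h₁₂ : sigmaOn Y {s} ≤ sigmaOn Y (Ici 0 ∩ Iic s) := sigmaOn_mono (by simpa using hs)
    have h₂a : sigmaOn Y (Ici 0 ∩ Iic a) ≤ mΩ := sigmaOn_Ici_inter_le hY inter_subset_left
    have h₂₃ : sigmaOn Y (Ici 0 ∩ Iic s) ≤ sigmaOn Y (Ici 0 ∩ Iic a) :=
      sigmaOn_mono (inter_subset_inter_right _ (Iic_subset_Iic.2 hsa))
    set φ : ℝ → ℝ := fun x => (A a).indicator (fun _ => 1) x * h x
    have hφ : Measurable φ := (measurable_const.indicator (hA a)).mul hh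
    have hφb : ∀ x, |φ x| ≤ 1 := fun x => by
      by_cases hx : x ∈ A a <;> simp [φ, hx, hb x]
    have hprod : (⋂ r ∈ insert a F', Y r ⁻¹' A r).indicator (fun _ => (1 : ℝ)) =
        (fun ω => (Y a ⁻¹' A a).indicator (fun _ => (1 : ℝ)) ω) *
          (⋂ r ∈ F', Y r ⁻¹' A r).indicator (fun _ => (1 : ℝ)) := by
      funext ω
      rw [Finset.set_biInter_insert, Pi.mul_apply, ← inter_indicator_mul]
      simp
    have hstep : P⟦⋂ r ∈ insert a F', Y r ⁻¹' A r | sigmaOn Y (Ici 0 ∩ Iic a)⟧ =ᵐ[P]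
        fun ω => φ (Y a ω) := by
      rw [hprod]
      have hAm : MeasurableSet[sigmaOn Y (Ici 0 ∩ Iic a)] (Y a ⁻¹' A a) :=
        measurable_sigmaOn (Y := Y) (S := Ici 0 ∩ Iic a) ⟨ha, mem_Iic.2 le_rfl⟩ (hA a)
      have hi : Integrable ((⋂ r ∈ F', Y r ⁻¹' A r).indicator (fun _ => (1 : ℝ))) P :=
        (integrable_const 1).indicator hsetF
      refine (condExp_mul_of_stronglyMeasurable_left
        (stronglyMeasurable_const.indicator hAm) ?_ hi).trans ?_
      · rw [← hprod]
        refine (integrable_const 1).indicator (Finset.measurableSet_biInter _ fun r hr =>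
          hY r (hs.trans (hsF r hr)) (hA r))
      · filter_upwards [ih a ha (fun r hr => (hmin r hr).le), he] with ω h1 h2
        rw [Pi.mul_apply, h1, h2]
        by_cases hx : Y a ω ∈ A a <;> simp [φ, hx]
    have hs2 : P⟦⋂ r ∈ insert a F', Y r ⁻¹' A r | sigmaOn Y (Ici 0 ∩ Iic s)⟧ =ᵐ[P]
        P[fun ω => φ (Y a ω) | sigmaOn Y (Ici 0 ∩ Iic s)] :=
      (condExp_condExp_of_le h₂₃ h₂a).symm.trans (condExp_congr_ae hstep)
    have hs1 : P⟦⋂ r ∈ insert a F', Y r ⁻¹' A r | sigmaOn Y {s}⟧ =ᵐ[P]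
        P[fun ω => φ (Y a ω) | sigmaOn Y {s}] :=
      (condExp_condExp_of_le (h₁₂.trans h₂₃) h₂a).symm.trans (condExp_congr_ae hstep)
    exact hs2.trans ((hM.condExp_comp hY hs hsa hφ hφb).trans hs1.symm)

/-- Past events and their conditional probabilities given the present agree on the future. -/
lemma IsMarkovOn.restrict_eq_condDensity (hM : IsMarkovOn P (Ici 0) Y)
    (hY : ∀ t, 0 ≤ t → Measurable (Y t)) {s : ℝ} (hs : 0 ≤ s) {C G : Set Ω}
    (hC : MeasurableSet[sigmaOn Y (Icc 0 s)] C) (hG : MeasurableSet[sigmaOn Y (Ici s)] G) :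
    P.restrict C G = condDensity (sigmaOn Y {s}) P C G := by
  have hI : Ici 0 ∩ Iic s = Icc 0 s := Ici_inter_Iic
  have h₂ : sigmaOn Y (Ici 0 ∩ Iic s) ≤ mΩ := sigmaOn_Ici_inter_le hY inter_subset_left
  have h₁₂ : sigmaOn Y {s} ≤ sigmaOn Y (Ici 0 ∩ Iic s) := sigmaOn_mono (by simpa using hs)
  refine measure_eq_of_cylinder (S := Ici s) (fun t ht => hY t (hs.trans ht)) ?_ hG
  intro F A hF hA
  have hset : MeasurableSet (⋂ r ∈ F, Y r ⁻¹' A r) :=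
    Finset.measurableSet_biInter _ fun r hr => hY r (hs.trans (hF hr)) (hA r)
  have := (condExp_eq_condExp_iff h₁₂ h₂ ((integrable_const (1 : ℝ)).indicator hset)).1
    (hM.condExp_cylinder hY F A hA s hs (fun r hr => hF hr)) C (hI ▸ hC)
  rw [integral_indicator hset, integral_indicator hset] at this
  simpa [Measure.real, ENNReal.toReal_eq_toReal_iff'] using this

/-- The reversed Markov property: a past event is conditioned on the future through the present. -/
lemma IsMarkovOn.condExp_past (hM : IsMarkovOn P (Ici 0) Y)
    (hY : ∀ t, 0 ≤ t → Measurable (Y t)) {s : ℝ} (hs : 0 ≤ s) {C : Set Ω}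
    (hC : MeasurableSet[sigmaOn Y (Icc 0 s)] C) :
    P⟦C | sigmaOn Y (Ici s)⟧ =ᵐ[P] P⟦C | sigmaOn Y {s}⟧ := by
  have h₂ : sigmaOn Y (Ici s) ≤ mΩ := sigmaOn_Ici_inter_le hY (Ici_subset_Ici.2 hs)
  have hC' : MeasurableSet C := sigmaOn_Ici_inter_le hY Icc_subset_Ici_self C hC
  refine (ae_eq_condExp_of_forall_setIntegral_eq h₂ ((integrable_const 1).indicator hC')
      (fun _ _ _ => integrable_condExp.integrableOn) (fun G hG _ => ?_)
      (stronglyMeasurable_condExp.mono (sigmaOn_mono (by simp))).aestronglyMeasurable).symm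
  have hG' := h₂ G hG
  have h1 := hM.restrict_eq_condDensity hY hs hC hG
  have h2 := integral_condDensity (P := P) (sigmaOn Y {s}) hC' (G.indicator fun _ => 1)
  rw [integral_indicator hG'] at h2
  have h3 : ∫ ω, (P⟦C | sigmaOn Y {s}⟧) ω * G.indicator (fun _ => 1) ω ∂P =
      ∫ ω in G, (P⟦C | sigmaOn Y {s}⟧) ω ∂P := by
    rw [← integral_indicator hG']
    refine integral_congr_ae (Eventually.of_forall fun ω => ?_)
    by_cases h : ω ∈ G <;> simp [h]
  rw [← h3, ← h2, integral_indicator hC', Measure.restrict_restrict hC']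
  simp only [integral_const, smul_eq_mul, mul_one, measureReal_restrict_apply_univ]
  rw [Measure.restrict_apply hG'] at h1
  simp [Measure.real, ← h1, inter_comm]

/-- The Markov property for future events. -/
lemma IsMarkovOn.condExp_future (hM : IsMarkovOn P (Ici 0) Y)
    (hY : ∀ t, 0 ≤ t → Measurable (Y t)) {s : ℝ} (hs : 0 ≤ s) {G : Set Ω}
    (hG : MeasurableSet[sigmaOn Y (Ici s)] G) :
    P⟦G | sigmaOn Y (Icc 0 s)⟧ =ᵐ[P] P⟦G | sigmaOn Y {s}⟧ := by
  have h₂ : sigmaOn Y (Icc 0 s) ≤ mΩ := sigmaOn_Ici_inter_le hY Icc_subset_Ici_self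
  have hG' : MeasurableSet G := sigmaOn_Ici_inter_le hY (Ici_subset_Ici.2 hs) G hG
  refine (condExp_eq_condExp_iff (sigmaOn_mono (by simpa using hs)) h₂
    ((integrable_const (1 : ℝ)).indicator hG')).2 fun C hC => ?_
  have := hM.restrict_eq_condDensity hY hs hC hG
  rw [integral_indicator hG', integral_indicator hG']
  simp [Measure.real, this]

end Markov

/-! ### Conditioning on the past and the future -/

/-- A function whose integral vanishes on the intersections `C ∩ G`, `C ∈ m₁`, `G ∈ m₂`, has vanishing
integral over every event of the σ-algebra generated by `m₁` and `m₂`. -/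
lemma setIntegral_eq_zero_of_sup {Ω : Type*} [mΩ : MeasurableSpace Ω] {P : Measure Ω}
    {m₁ m₂ : MeasurableSpace Ω} (h₁ : m₁ ≤ mΩ) (h₂ : m₂ ≤ mΩ)
    {f : Ω → ℝ} (hf : Integrable f P)
    (h : ∀ C G, MeasurableSet[m₁] C → MeasurableSet[m₂] G → ∫ ω in C ∩ G, f ω ∂P = 0)
    {E : Set Ω} (hE : MeasurableSet[m₁ ⊔ m₂] E) : ∫ ω in E, f ω ∂P = 0 := by
  have hle : m₁ ⊔ m₂ ≤ mΩ := sup_le h₁ h₂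
  have huniv : ∫ ω, f ω ∂P = 0 := by
    simpa using h univ univ MeasurableSet.univ MeasurableSet.univ
  induction E, hE using MeasurableSpace.induction_on_inter
    (m := m₁ ⊔ m₂) (s := image2 (· ∩ ·) {C | MeasurableSet[m₁] C} {G | MeasurableSet[m₂] G})
    (by
      refine le_antisymm (sup_le ?_ ?_) (MeasurableSpace.generateFrom_le ?_)
      · exact fun C hC => MeasurableSpace.measurableSet_generateFrom
          ⟨C, hC, univ, MeasurableSet.univ, by simp⟩
      · exact fun G hG => MeasurableSpace.measurableSet_generateFrom
          ⟨univ, MeasurableSet.univ, G, hG, by simp⟩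
      · rintro _ ⟨C, hC, G, hG, rfl⟩
        exact MeasurableSet.inter (le_sup_left (a := m₁) (b := m₂) C hC)
          (le_sup_right (a := m₁) (b := m₂) G hG))
    (by
      rintro _ ⟨C, hC, G, hG, rfl⟩ _ ⟨C', hC', G', hG', rfl⟩ _
      refine ⟨C ∩ C', MeasurableSet.inter hC hC', G ∩ G', MeasurableSet.inter hG hG', ?_⟩
      exact (inter_inter_inter_comm C G C' G').symm) with
  | empty => simp
  | basic E hE =>
    obtain ⟨C, hC, G, hG, rfl⟩ := hE
    exact h C G hC hG
  | compl E hE ih =>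
    have := integral_add_compl (hle E hE) hf
    rw [ih, huniv, zero_add] at this
    exact this
  | iUnion E hd hE ih =>
    rw [integral_iUnion (fun i => hle _ (hE i)) hd hf.integrableOn]
    simp [ih]

section TwoSided

variable {Ω : Type*} [mΩ : MeasurableSpace Ω] {P : Measure Ω} [IsProbabilityMeasure P]
  {Y : ℝ → Ω → ℝ}

/-- For a Markov process, a function of the values at times `s`, `t`, `u` that is orthogonal to the
bounded functions of the values at `s` and `u` has conditional expectation zero given the whole past
of `s` and the whole future of `u`. -/
lemma IsMarkovOn.condExp_two_sided_eq_zero (hM : IsMarkovOn P (Ici 0) Y)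
    (hY : ∀ t, 0 ≤ t → Measurable (Y t)) {s t u : ℝ} (hs : 0 ≤ s) (hst : s ≤ t) (htu : t ≤ u)
    {ψ : ℝ → ℝ → ℝ → ℝ} (hψ : Measurable fun x : ℝ × ℝ × ℝ => ψ x.1 x.2.1 x.2.2)
    (hint : Integrable (fun ω => ψ (Y s ω) (Y t ω) (Y u ω)) P)
    (h : ∀ g k : ℝ → ℝ, Measurable g → Measurable k → (∀ x, |g x| ≤ 1) → (∀ x, |k x| ≤ 1) →
      ∫ ω, ψ (Y s ω) (Y t ω) (Y u ω) * (g (Y s ω) * k (Y u ω)) ∂P = 0) :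
    P[fun ω => ψ (Y s ω) (Y t ω) (Y u ω) | sigmaOn Y (Icc 0 s ∪ Ici u)] =ᵐ[P] 0 := by
  have hsu := hst.trans htu
  have hu : 0 ≤ u := hs.trans hsu
  have hle1 : sigmaOn Y (Icc 0 s) ≤ mΩ := sigmaOn_Ici_inter_le hY Icc_subset_Ici_self
  have hle1' : sigmaOn Y (Icc 0 u) ≤ mΩ := sigmaOn_Ici_inter_le hY Icc_subset_Ici_self
  have hle2 : sigmaOn Y (Ici u) ≤ mΩ := sigmaOn_Ici_inter_le hY (Ici_subset_Ici.2 hu)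
  have hle3 : sigmaOn Y (Ici s) ≤ mΩ := sigmaOn_Ici_inter_le hY (Ici_subset_Ici.2 hs)
  have hle : sigmaOn Y (Icc 0 s ∪ Ici u) ≤ mΩ := by
    rw [sigmaOn_union]; exact sup_le hle1 hle2
  set D : Ω → ℝ := fun ω => ψ (Y s ω) (Y t ω) (Y u ω) with hD
  have hDm : ∀ S : Set ℝ, s ∈ S → t ∈ S → u ∈ S → Measurable[sigmaOn Y S] D := by
    intro S h1 h2 h3
    exact hψ.comp ((measurable_sigmaOn h1).prodMk
      ((measurable_sigmaOn h2).prodMk (measurable_sigmaOn h3)))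
  refine (ae_eq_condExp_of_forall_setIntegral_eq hle hint
    (fun _ _ _ => integrableOn_zero) (fun E hE _ => ?_) aestronglyMeasurable_zero).symm
  rw [sigmaOn_union] at hE
  simp only [integral_zero]
  refine (setIntegral_eq_zero_of_sup hle1 hle2 hint ?_ hE).symm
  intro C G hC hG
  have hC' := hle1 C hC
  have hG' := hle2 G hG
  obtain ⟨g, hg, hgb, hge⟩ := exists_condExp_eq_comp (P := P) (Y := Y) s hC'
  obtain ⟨k, hk, hkb, hke⟩ := exists_condExp_eq_comp (P := P) (Y := Y) u hG'
  have hbC : ∀ ω, ‖C.indicator (fun _ => (1 : ℝ)) ω‖ ≤ 1 := fun ω => by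
    by_cases h : ω ∈ C <;> simp [h]
  have hbG : ∀ ω, ‖G.indicator (fun _ => (1 : ℝ)) ω‖ ≤ 1 := fun ω => by
    by_cases h : ω ∈ G <;> simp [h]
  have hmC : AEStronglyMeasurable (C.indicator (fun _ => (1 : ℝ))) P :=
    ((integrable_const 1).indicator hC').aestronglyMeasurable
  have hmG : AEStronglyMeasurable (G.indicator (fun _ => (1 : ℝ))) P :=
    ((integrable_const 1).indicator hG').aestronglyMeasurable
  -- the future event is replaced by its conditional probability given the process up to `u`
  have hDC : Integrable (fun ω => C.indicator (fun _ => (1 : ℝ)) ω * D ω) P :=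
    hint.bdd_mul hmC (Eventually.of_forall hbC)
  have hDCm : StronglyMeasurable[sigmaOn Y (Icc 0 u)]
      (fun ω => C.indicator (fun _ => (1 : ℝ)) ω * D ω) := by
    refine StronglyMeasurable.mul ?_ (hDm (Icc 0 u) ⟨hs, hsu⟩ ⟨hs.trans hst, htu⟩
      ⟨hu, le_rfl⟩).stronglyMeasurable
    exact stronglyMeasurable_const.indicator (sigmaOn_mono (Icc_subset_Icc_right hsu) C hC)
  have step1 : ∫ ω in C ∩ G, D ω ∂P =
      ∫ ω, G.indicator (fun _ => (1 : ℝ)) ω * (C.indicator (fun _ => (1 : ℝ)) ω * D ω) ∂P := by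
    rw [← integral_indicator (hC'.inter hG')]
    refine integral_congr_ae (Eventually.of_forall fun ω => ?_)
    by_cases h1 : ω ∈ C <;> by_cases h2 : ω ∈ G <;> simp [h1, h2]
  have step2 : ∫ ω, G.indicator (fun _ => (1 : ℝ)) ω * (C.indicator (fun _ => (1 : ℝ)) ω * D ω) ∂P
      = ∫ ω, k (Y u ω) * (C.indicator (fun _ => (1 : ℝ)) ω * D ω) ∂P := by
    have e := integral_condExp_mul_comm (P := P) hle1' hmG (K := 1) (Eventually.of_forall hbG) hDC
    rw [condExp_of_stronglyMeasurable hle1' hDCm hDC] at e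
    rw [e]
    refine integral_congr_ae ?_
    filter_upwards [hM.condExp_future hY hu hG, hke] with ω h1 h2
    rw [h1, h2]
  -- the past event is replaced by its conditional probability given the process from `s` on
  have hDk : Integrable (fun ω => k (Y u ω) * D ω) P :=
    hint.bdd_mul (hk.comp (hY u hu)).aestronglyMeasurable (Eventually.of_forall fun ω => hkb _)
  have hDkm : StronglyMeasurable[sigmaOn Y (Ici s)] (fun ω => k (Y u ω) * D ω) :=
    (hk.comp (measurable_sigmaOn (Y := Y) (S := Ici s) hsu)).stronglyMeasurable.mul
      (hDm (Ici s) (mem_Ici.2 le_rfl) hst hsu).stronglyMeasurable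
  have step3 : ∫ ω, C.indicator (fun _ => (1 : ℝ)) ω * (k (Y u ω) * D ω) ∂P
      = ∫ ω, g (Y s ω) * (k (Y u ω) * D ω) ∂P := by
    have e := integral_condExp_mul_comm (P := P) hle3 hmC (K := 1) (Eventually.of_forall hbC) hDk
    rw [condExp_of_stronglyMeasurable hle3 hDkm hDk] at e
    rw [e]
    refine integral_congr_ae ?_
    filter_upwards [hM.condExp_past hY hs hC, hge] with ω h1 h2
    rw [h1, h2]
  rw [step1, step2, ← h g k hg hk hgb hkb]
  calc _ = ∫ ω, C.indicator (fun _ => (1 : ℝ)) ω * (k (Y u ω) * D ω) ∂P := by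
        congr 1; funext ω; ring
    _ = _ := step3
    _ = _ := by congr 1; funext ω; simp only [hD]; ring

end TwoSided

/-! ### Construction of a Poisson process -/

/-- `N` is a Poisson process of rate `1` on the probability space `(Ω, P)`, with nondecreasing
paths. The parameter runs through `ℝ`, and the process is only of interest on `[0, ∞)`. -/
structure IsPoissonProcess {Ω : Type*} [MeasurableSpace Ω] (P : Measure Ω) (N : ℝ → Ω → ℕ) :
    Prop where
  measurable_uncurry : Measurable fun p : ℝ × Ω => N p.1 p.2
  mono : ∀ ω, Monotone fun t => N t ω
  zero : ∀ ω, N 0 ω = 0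
  indep : ∀ a b, 0 ≤ a → a ≤ b →
    IndepFun (fun ω (t : Iic a) => N t ω) (fun ω => N b ω - N a ω) P
  law : ∀ a b, 0 ≤ a → a ≤ b →
    P.map (fun ω => N b ω - N a ω) = poissonMeasure (b - a).toNNReal

section Cells

lemma integral_prod_range_infinitePi {α : Type*} [MeasurableSpace α] (ν : ℕ → Measure α)
    [∀ i, IsProbabilityMeasure (ν i)] (f : ℕ → α → ℂ) (hf : ∀ i, Measurable (f i)) (n : ℕ) :
    ∫ ω, ∏ i ∈ Finset.range n, f i (ω i) ∂(Measure.infinitePi ν) =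
      ∏ i ∈ Finset.range n, ∫ x, f i x ∂(ν i) := by
  have h1 : iIndepFun (fun i (ω : ℕ → α) => f i (ω i)) (Measure.infinitePi ν) :=
    iIndepFun_infinitePi (fun i => hf i)
  have h2 := h1.precomp (g := fun i : Fin n => (i : ℕ)) Fin.val_injective
  have h3 := h2.integral_fun_prod_eq_prod_integral
    (fun i => ((hf i).comp (measurable_pi_apply _)).aestronglyMeasurable)
  simp only [Finset.prod_range]
  refine Eq.trans (by rfl) (h3.trans (Finset.prod_congr rfl fun i _ => ?_))
  rw [← Measure.infinitePi_map_eval ν i, integral_map (measurable_pi_apply _).aemeasurable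
    (hf i).aestronglyMeasurable]

/-- The uniform distribution on `(0, 1]`. -/
noncomputable def unif : Measure ℝ := volume.restrict (Ioc 0 1)

instance : IsProbabilityMeasure unif := ⟨by simp [unif]⟩

/-- The points of a Poisson process in an interval of unit length: a number of points with the
Poisson distribution of parameter `1`, and a sequence of uniform positions, of which only the first
ones up to that number matter. -/
noncomputable def cellMeasure : Measure (ℕ × (ℕ → ℝ)) :=
  (poissonMeasure 1).prod (Measure.infinitePi fun _ => unif)

instance : IsProbabilityMeasure cellMeasure := by
  unfold cellMeasure; infer_instance

lemma measurable_prod_cell {f : ℝ → ℂ} (hf : Measurable f) :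
    Measurable fun c : ℕ × (ℕ → ℝ) => ∏ i ∈ Finset.range c.1, f (c.2 i) := by
  refine measurable_from_prod_countable_right fun n => ?_
  change Measurable fun y : ℕ → ℝ => ∏ i ∈ Finset.range n, f (y i)
  exact Finset.measurable_fun_prod _ fun i _ => hf.comp (measurable_pi_apply i)

/-- The exponential formula for one cell. -/
lemma integral_prod_cell {f : ℝ → ℂ} (hf : Measurable f) (hb : ∀ x, ‖f x‖ ≤ 1) :
    ∫ c, ∏ i ∈ Finset.range c.1, f (c.2 i) ∂cellMeasure =
      Complex.exp (∫ x, (f x - 1) ∂unif) := by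
  have hfi : Integrable f unif :=
    Integrable.of_bound hf.aestronglyMeasurable 1 (Eventually.of_forall hb)
  have hint : Integrable (fun c : ℕ × (ℕ → ℝ) => ∏ i ∈ Finset.range c.1, f (c.2 i))
      cellMeasure := by
    refine Integrable.of_bound (measurable_prod_cell hf).aestronglyMeasurable 1
      (Eventually.of_forall fun c => ?_)
    rw [norm_prod]
    exact Finset.prod_le_one (fun _ _ => norm_nonneg _) fun _ _ => hb _
  rw [cellMeasure, integral_prod _ hint]
  have h1 : ∀ n : ℕ, ∫ y, ∏ i ∈ Finset.range n, f (y i) ∂(Measure.infinitePi fun _ : ℕ => unif)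
      = (∫ x, f x ∂unif) ^ n := fun n => by
    rw [integral_prod_range_infinitePi (fun _ => unif) (fun _ => f) (fun _ => hf)]
    simp
  simp only [h1]
  rw [integral_poissonMeasure, integral_sub hfi (integrable_const _)]
  set z := ∫ x, f x ∂unif
  have h2 : ∀ n : ℕ, (Real.exp (-((1 : NNReal) : ℝ)) * ((1 : NNReal) : ℝ) ^ n / (n.factorial : ℝ)) •
      z ^ n = Complex.exp (-1) * (z ^ n / (n.factorial : ℂ)) := fun n => by
    rw [Complex.real_smul]
    push_cast
    simp
    ring
  simp only [h2, integral_const]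
  rw [tsum_mul_left, (NormedSpace.expSeries_div_hasSum_exp z).tsum_eq, ← Complex.exp_eq_exp_ℂ,
    ← Complex.exp_add]
  simp [sub_eq_neg_add]

/-- The distribution of the points in countably many independent cells. -/
noncomputable def pointMeasure : Measure (ℕ → ℕ × (ℕ → ℝ)) :=
  Measure.infinitePi fun _ => cellMeasure

instance : IsProbabilityMeasure pointMeasure := by
  unfold pointMeasure; infer_instance

/-- The sum of `φ k x` over the points `k + x` in the first `m` cells. -/
def pointSum (m : ℕ) (φ : ℕ → ℝ → ℝ) (ω : ℕ → ℕ × (ℕ → ℝ)) : ℝ :=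
  ∑ k ∈ Finset.range m, ∑ i ∈ Finset.range (ω k).1, φ k ((ω k).2 i)

/-- The exponential formula for the points in the first `m` cells. -/
lemma integral_exp_pointSum (m : ℕ) {φ : ℕ → ℝ → ℝ} (hφ : ∀ k, Measurable (φ k)) :
    ∫ ω, Complex.exp (pointSum m φ ω * Complex.I) ∂pointMeasure =
      Complex.exp (∑ k ∈ Finset.range m, ∫ x, (Complex.exp (φ k x * Complex.I) - 1) ∂unif) := by
  have hm : ∀ k, Measurable fun x => Complex.exp (φ k x * Complex.I) := fun k => by fun_prop
  have h1 : ∀ ω, Complex.exp (pointSum m φ ω * Complex.I) =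
      ∏ k ∈ Finset.range m, ∏ i ∈ Finset.range (ω k).1,
        Complex.exp (φ k ((ω k).2 i) * Complex.I) := fun ω => by
    rw [pointSum]
    push_cast
    rw [Finset.sum_mul, Complex.exp_sum]
    refine Finset.prod_congr rfl fun k _ => ?_
    rw [Finset.sum_mul, Complex.exp_sum]
  simp only [h1]
  rw [pointMeasure, integral_prod_range_infinitePi (fun _ => cellMeasure)
    (fun k (c : ℕ × (ℕ → ℝ)) => ∏ i ∈ Finset.range c.1, Complex.exp (φ k (c.2 i) * Complex.I))
    (fun k => measurable_prod_cell (hm k)), Complex.exp_sum]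
  refine Finset.prod_congr rfl fun k _ => ?_
  rw [integral_prod_cell (hm k) (fun x => (Complex.norm_exp_ofReal_mul_I _).le)]

/-- The number of points in `(0, t]`. -/
noncomputable def countPoints (t : ℝ) (ω : ℕ → ℕ × (ℕ → ℝ)) : ℕ :=
  ∑ k ∈ Finset.range ⌈t⌉₊, ∑ i ∈ Finset.range (ω k).1, if k + (ω k).2 i ≤ t then 1 else 0

/-- The indicator of the points of the cell `k` that lie in `(0, t]`. -/
noncomputable def cellInd (t : ℝ) (k : ℕ) (x : ℝ) : ℝ := if k < t ∧ k + x ≤ t then 1 else 0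

lemma measurable_cellInd (t : ℝ) (k : ℕ) : Measurable (cellInd t k) := by
  refine Measurable.ite ?_ measurable_const measurable_const
  by_cases h : (k : ℝ) < t
  · simpa [h] using measurableSet_le (by fun_prop : Measurable fun x : ℝ => (k : ℝ) + x)
      measurable_const
  · simp [h]

lemma countPoints_eq_pointSum {t : ℝ} {m : ℕ} (hm : t ≤ m) (ω : ℕ → ℕ × (ℕ → ℝ)) :
    (countPoints t ω : ℝ) = pointSum m (cellInd t) ω := by
  rw [countPoints, pointSum]
  push_cast
  have hsub : Finset.range ⌈t⌉₊ ⊆ Finset.range m :=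
    Finset.range_subset_range.2 (Nat.ceil_le.2 hm)
  rw [← Finset.sum_subset hsub]
  · refine Finset.sum_congr rfl fun k hk => Finset.sum_congr rfl fun i _ => ?_
    have : (k : ℝ) < t := Nat.lt_ceil.1 (Finset.mem_range.1 hk)
    simp [cellInd, this]
  · intro k _ hk
    have : ¬ (k : ℝ) < t := fun h => hk (Finset.mem_range.2 (Nat.lt_ceil.2 h))
    simp [cellInd, this]

lemma pointSum_add (m : ℕ) (φ ψ : ℕ → ℝ → ℝ) (ω : ℕ → ℕ × (ℕ → ℝ)) :
    pointSum m (fun k x => φ k x + ψ k x) ω = pointSum m φ ω + pointSum m ψ ω := by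
  simp [pointSum, Finset.sum_add_distrib]

lemma pointSum_const_mul (m : ℕ) (c : ℝ) (φ : ℕ → ℝ → ℝ) (ω : ℕ → ℕ × (ℕ → ℝ)) :
    pointSum m (fun k x => c * φ k x) ω = c * pointSum m φ ω := by
  simp [pointSum, Finset.mul_sum]

lemma pointSum_sum {ι : Type*} [Fintype ι] (m : ℕ) (φ : ι → ℕ → ℝ → ℝ)
    (ω : ℕ → ℕ × (ℕ → ℝ)) :
    pointSum m (fun k x => ∑ j, φ j k x) ω = ∑ j, pointSum m (φ j) ω := by
  simp only [pointSum]
  rw [Finset.sum_comm]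
  refine Finset.sum_congr rfl fun k _ => ?_
  rw [Finset.sum_comm]

lemma measurable_countPoints : Measurable fun p : ℝ × (ℕ → ℕ × (ℕ → ℝ)) => countPoints p.1 p.2 := by
  have h : Measurable fun p : ℕ × (ℝ × (ℕ → ℕ × (ℕ → ℝ))) =>
      ∑ k ∈ Finset.range p.1, ∑ i ∈ Finset.range (p.2.2 k).1,
        if k + (p.2.2 k).2 i ≤ p.2.1 then 1 else 0 := by
    refine measurable_from_prod_countable_right fun n => ?_
    change Measurable fun q : ℝ × (ℕ → ℕ × (ℕ → ℝ)) => ∑ k ∈ Finset.range n,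
      ∑ i ∈ Finset.range (q.2 k).1, if k + (q.2 k).2 i ≤ q.1 then 1 else 0
    refine Finset.measurable_fun_sum _ fun k _ => ?_
    have h2 : Measurable fun q : ℕ × (ℝ × (ℕ → ℕ × (ℕ → ℝ))) =>
        ∑ i ∈ Finset.range q.1, if k + (q.2.2 k).2 i ≤ q.2.1 then 1 else 0 := by
      refine measurable_from_prod_countable_right fun n => ?_
      change Measurable fun q : ℝ × (ℕ → ℕ × (ℕ → ℝ)) =>
        ∑ i ∈ Finset.range n, if k + (q.2 k).2 i ≤ q.1 then 1 else 0
      refine Finset.measurable_fun_sum _ fun i _ => ?_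
      exact Measurable.ite (measurableSet_le (by fun_prop) (by fun_prop)) measurable_const
        measurable_const
    exact h2.comp (g := _) (f := fun p : ℝ × (ℕ → ℕ × (ℕ → ℝ)) => ((p.2 k).1, p)) (by fun_prop)
  exact h.comp (f := fun p : ℝ × (ℕ → ℕ × (ℕ → ℝ)) => (⌈p.1⌉₊, p))
    ((Nat.measurable_ceil.comp measurable_fst).prodMk measurable_id)

lemma countPoints_mono (ω : ℕ → ℕ × (ℕ → ℝ)) : Monotone fun t => countPoints t ω := by
  intro s t hst
  obtain ⟨m, hm⟩ := exists_nat_ge t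
  have : (countPoints s ω : ℝ) ≤ countPoints t ω := by
    rw [countPoints_eq_pointSum (hst.trans hm), countPoints_eq_pointSum hm]
    refine Finset.sum_le_sum fun k _ => Finset.sum_le_sum fun i _ => ?_
    unfold cellInd
    split_ifs with h1 h2 <;> simp_all
    exact absurd (h1.2.trans hst) (not_le.2 (h2 (h1.1.trans_le hst)))
  exact_mod_cast this

/-- The mean number of points in `(0, t]` is `t`. -/
lemma sum_integral_cellInd {t : ℝ} (ht : 0 ≤ t) {m : ℕ} (hm : t ≤ m) :
    ∑ k ∈ Finset.range m, ∫ x, cellInd t k x ∂unif = t := by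
  have h1 : ∀ k : ℕ, ∫ x, cellInd t k x ∂unif =
      ∫ x in ((k : ℕ) : ℝ)..((k + 1 : ℕ) : ℝ), (Iic t).indicator (fun _ => (1 : ℝ)) x := fun k => by
    have : ∫ x, cellInd t k x ∂unif =
        ∫ x in (0 : ℝ)..1, (Iic t).indicator (fun _ => (1 : ℝ)) (k + x) := by
      rw [intervalIntegral.integral_of_le zero_le_one, unif]
      refine setIntegral_congr_fun measurableSet_Ioc fun x hx => ?_
      have : k + x ≤ t → (k : ℝ) < t := fun h => by linarith [hx.1]
      by_cases h : k + x ≤ t <;> simp [cellInd, h, this]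
    rw [this, intervalIntegral.integral_comp_add_left]
    simp
  simp only [h1]
  rw [intervalIntegral.sum_integral_adjacent_intervals (a := fun k : ℕ => (k : ℝ))]
  · rw [Nat.cast_zero, intervalIntegral.integral_of_le (Nat.cast_nonneg m),
      setIntegral_indicator measurableSet_Iic, Ioc_inter_Iic, min_eq_right hm]
    simp [ht]
  · intro k _
    have h : ∀ a b : ℝ, IntegrableOn ((Iic t).indicator fun _ => (1 : ℝ)) (Ioc a b) volume := by
      intro a b
      have h1 : Integrable (fun _ : ℝ => (1 : ℝ)) (volume.restrict (Ioc a b)) :=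
        integrable_const _
      exact h1.indicator measurableSet_Iic
    exact ⟨h _ _, h _ _⟩

end Cells

lemma isPoissonProcess_countPoints : IsPoissonProcess pointMeasure countPoints := by
  have hmeas : ∀ t, Measurable (countPoints t) := fun t =>
    Measurable.of_uncurry_left (f := countPoints) measurable_countPoints
  -- the exponential formula for a multiple of an increment
  have hincr : ∀ a b c : ℝ, 0 ≤ a → a ≤ b → ∀ m : ℕ, b ≤ m →
      ∑ k ∈ Finset.range m, ∫ x, (Complex.exp ((c * (cellInd b k x + (-1) * cellInd a k x) : ℝ) *
        Complex.I) - 1) ∂unif = (b - a) * (Complex.exp (c * Complex.I) - 1) := by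
    intro a b c ha hab m hm
    have h1 : ∀ k x, Complex.exp ((c * (cellInd b k x + (-1) * cellInd a k x) : ℝ) *
        Complex.I) - 1 = ((cellInd b k x - cellInd a k x : ℝ) : ℂ) *
          (Complex.exp (c * Complex.I) - 1) := by
      intro k x
      have : (k : ℝ) < a ∧ k + x ≤ a → (k : ℝ) < b ∧ k + x ≤ b :=
        fun h => ⟨h.1.trans_le hab, h.2.trans hab⟩
      unfold cellInd
      split_ifs <;> simp_all
    have hi : ∀ t k, Integrable (cellInd t k) unif := fun t k =>
      Integrable.of_bound (measurable_cellInd t k).aestronglyMeasurable 1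
        (Eventually.of_forall fun x => by unfold cellInd; split_ifs <;> simp)
    simp only [h1]
    simp only [integral_mul_const, integral_complex_ofReal]
    rw [← Finset.sum_mul, ← Complex.ofReal_sum]
    congr 1
    have : ∀ k, ∫ x, (cellInd b k x - cellInd a k x) ∂unif =
      ∫ x, cellInd b k x ∂unif - ∫ x, cellInd a k x ∂unif := fun k => integral_sub (hi b k) (hi a k)
    simp only [this]
    rw [Finset.sum_sub_distrib, sum_integral_cellInd (ha.trans hab) hm,
      sum_integral_cellInd ha (hab.trans hm)]
    push_cast; rfl
  have hsub : ∀ a b : ℝ, a ≤ b → ∀ m : ℕ, b ≤ m → ∀ ω, ((countPoints b ω - countPoints a ω : ℕ) : ℝ) =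
      pointSum m (fun k x => cellInd b k x + (-1) * cellInd a k x) ω := by
    intro a b hab m hm ω
    rw [Nat.cast_sub (countPoints_mono ω hab), pointSum_add, pointSum_const_mul,
      ← countPoints_eq_pointSum hm, ← countPoints_eq_pointSum (hab.trans hm)]
    ring
  refine ⟨measurable_countPoints, countPoints_mono, fun ω => by simp [countPoints], ?_, ?_⟩
  · intro a b ha hab
    have hX : Measurable fun ω (t : Iic a) => (countPoints t ω : ℝ) :=
      measurable_pi_lambda _ fun t => measurable_from_nat.comp (hmeas t)
    have hY : Measurable fun ω => ((countPoints b ω - countPoints a ω : ℕ) : ℝ) :=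
      measurable_from_nat.comp ((hmeas b).sub (hmeas a))
    have key : IndepFun (fun ω (t : Iic a) => (countPoints t ω : ℝ))
        (fun ω => ((countPoints b ω - countPoints a ω : ℕ) : ℝ)) pointMeasure := by
      refine IndepFun.process_indepFun (fun t => measurable_from_nat.comp (hmeas t)) hY fun I => ?_
      have hXI : Measurable fun ω (t : I) => (countPoints t ω : ℝ) :=
        measurable_pi_lambda _ fun t => measurable_from_nat.comp (hmeas t)
      rw [indepFun_iff_charFunDual_prod hXI.aemeasurable hY.aemeasurable]
      intro L
      obtain ⟨m, hm⟩ := exists_nat_ge b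
      set c : I → ℝ := fun j => L (Pi.single j 1, 0) with hc
      set d : ℝ := L (0, 1) with hd
      set φ : ℕ → ℝ → ℝ := fun k x => ∑ j : I, c j * cellInd j k x with hφ
      set ψ : ℕ → ℝ → ℝ := fun k x => d * (cellInd b k x + (-1) * cellInd a k x) with hψ
      have hφm : ∀ k, Measurable (φ k) := fun k =>
        Finset.measurable_sum _ fun j _ => (measurable_cellInd _ k).const_mul _
      have hψm : ∀ k, Measurable (ψ k) := fun k =>
        ((measurable_cellInd b k).add ((measurable_cellInd a k).const_mul _)).const_mul _
      have hL1 : ∀ ω, L.comp (.inl ℝ (I → ℝ) ℝ) (fun t : I => (countPoints t ω : ℝ)) =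
          pointSum m φ ω := by
        intro ω
        rw [hφ, pointSum_sum, ← ContinuousLinearMap.sum_comp_single]
        refine Finset.sum_congr rfl fun j _ => ?_
        rw [pointSum_const_mul, ← countPoints_eq_pointSum ((mem_Iic.1 j.1.2).trans (hab.trans hm))]
        have : (Pi.single j (countPoints j ω : ℝ) : I → ℝ) = (countPoints j ω : ℝ) • Pi.single j 1 := by
          rw [← Pi.single_smul]; simp
        simp only [ContinuousLinearMap.comp_apply, ContinuousLinearMap.single_apply, this, map_smul]
        simp [hc, mul_comm]
      have hL2 : ∀ ω, L.comp (.inr ℝ (I → ℝ) ℝ) ((countPoints b ω - countPoints a ω : ℕ) : ℝ) =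
          pointSum m ψ ω := by
        intro ω
        rw [hψ, pointSum_const_mul, ← hsub a b hab m hm]
        have : ((countPoints b ω - countPoints a ω : ℕ) : ℝ) =
          ((countPoints b ω - countPoints a ω : ℕ) : ℝ) • (1 : ℝ) := by simp
        rw [this, map_smul]
        simp [hd, mul_comm]
      have hL : ∀ ω, L (fun t : I => (countPoints t ω : ℝ),
          ((countPoints b ω - countPoints a ω : ℕ) : ℝ)) =
          pointSum m (fun k x => φ k x + ψ k x) ω := by
        intro ω
        rw [← L.comp_inl_add_comp_inr, hL1, hL2, pointSum_add]
      rw [charFunDual_apply, charFunDual_apply, charFunDual_apply,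
        integral_map (hXI.prodMk hY).aemeasurable (by fun_prop),
        integral_map hXI.aemeasurable (by fun_prop), integral_map hY.aemeasurable (by fun_prop)]
      simp only [hL, hL1, hL2]
      rw [integral_exp_pointSum m hφm, integral_exp_pointSum m hψm,
        integral_exp_pointSum m (φ := fun k x => φ k x + ψ k x) (fun k => (hφm k).add (hψm k)), ← Complex.exp_add,
        ← Finset.sum_add_distrib]
      congr 1
      refine Finset.sum_congr rfl fun k _ => ?_
      have hi : ∀ f : ℝ → ℝ, Measurable f →
          Integrable (fun x => Complex.exp (f x * Complex.I) - 1) unif := fun f hf =>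
        (Integrable.of_bound (by fun_prop : Measurable fun x =>
          Complex.exp (f x * Complex.I)).aestronglyMeasurable 1
          (Eventually.of_forall fun x => (Complex.norm_exp_ofReal_mul_I _).le)).sub
          (integrable_const _)
      rw [← integral_add (hi _ (hφm k)) (hi _ (hψm k))]
      congr 1
      funext x
      -- points beyond `a` do not contribute to `φ`, points up to `a` do not contribute to `ψ`
      by_cases hx : (k : ℝ) < a ∧ k + x ≤ a
      · have : ψ k x = 0 := by
          simp [hψ, cellInd, hx, hx.1.trans_le hab, hx.2.trans hab]
        simp [this]
      · have : φ k x = 0 := by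
          rw [hφ]
          refine Finset.sum_eq_zero fun j _ => ?_
          have : ¬ ((k : ℝ) < j ∧ k + x ≤ j) := fun h =>
            hx ⟨h.1.trans_le j.1.2, h.2.trans j.1.2⟩
          simp [cellInd, this]
        simp [this]
    have := key.comp (φ := fun (x : Iic a → ℝ) t => ⌊x t⌋₊) (ψ := fun y : ℝ => ⌊y⌋₊)
      (measurable_pi_lambda _ fun t => Nat.measurable_floor.comp (measurable_pi_apply t))
      Nat.measurable_floor
    simpa [Function.comp_def] using this
  · intro a b ha hab
    have hY : Measurable fun ω => ((countPoints b ω - countPoints a ω : ℕ) : ℝ) :=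
      measurable_from_nat.comp ((hmeas b).sub (hmeas a))
    have hcast : pointMeasure.map (fun ω => ((countPoints b ω - countPoints a ω : ℕ) : ℝ)) =
        (poissonMeasure (b - a).toNNReal).map (Nat.cast : ℕ → ℝ) := by
      have : IsProbabilityMeasure (pointMeasure.map
        (fun ω => ((countPoints b ω - countPoints a ω : ℕ) : ℝ))) :=
        Measure.isProbabilityMeasure_map hY.aemeasurable
      refine Measure.ext_of_charFun ?_
      funext c
      obtain ⟨m, hm⟩ := exists_nat_ge b
      rw [charFun_map_cast_poissonMeasure, charFun_apply_real,
        integral_map hY.aemeasurable (by fun_prop)]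
      have : ∀ ω, (c : ℂ) * (((countPoints b ω - countPoints a ω : ℕ) : ℝ) : ℂ) =
          (pointSum m (fun k x => c * (cellInd b k x + (-1) * cellInd a k x)) ω : ℝ) := by
        intro ω
        rw [pointSum_const_mul, ← hsub a b hab m hm]
        push_cast; rfl
      simp only [this]
      rw [integral_exp_pointSum, hincr a b c ha hab m hm,
        Real.coe_toNNReal _ (sub_nonneg.2 hab)]
      · push_cast; rfl
      · exact fun k =>
          ((measurable_cellInd b k).add ((measurable_cellInd a k).const_mul _)).const_mul _
    have h2 := congrArg (fun μ : Measure ℝ => μ.map fun x : ℝ => ⌊x⌋₊) hcast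
    rw [Measure.map_map Nat.measurable_floor hY, Measure.map_map Nat.measurable_floor
      measurable_from_nat] at h2
    have e1 : (fun x : ℝ => ⌊x⌋₊) ∘ (Nat.cast : ℕ → ℝ) = id := by funext n; simp
    rw [e1, Measure.map_id] at h2
    rw [← h2]
    congr 1
    funext ω
    simp only [Function.comp_apply, Nat.floor_natCast]

/-! ### The Poisson distribution and the law of large numbers -/

lemma poissonMeasure_toNNReal_singleton {c : ℝ} (hc : 0 ≤ c) (n : ℕ) :
    poissonMeasure c.toNNReal {n} = ENNReal.ofReal (Real.exp (-c) * c ^ n / (n.factorial : ℝ)) := by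
  rw [poissonMeasure_singleton, Real.coe_toNNReal c hc]

/-- The Poisson distribution of parameter `c`, weighted by the identity, is `c` times its shift. -/
lemma withDensity_poissonMeasure (c : NNReal) :
    (poissonMeasure c).withDensity (fun n => (n : ENNReal)) =
      (c : ENNReal) • (poissonMeasure c).map (· + 1) := by
  refine Measure.ext_of_singleton fun n => ?_
  rw [withDensity_apply _ (measurableSet_singleton n), Measure.smul_apply,
    Measure.map_apply measurable_from_nat (measurableSet_singleton n)]
  simp only [Measure.restrict_singleton, lintegral_smul_measure, lintegral_dirac, smul_eq_mul]
  cases n with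
  | zero =>
    have : (fun x : ℕ => x + 1) ⁻¹' {0} = ∅ := by ext; simp
    simp [this]
  | succ k =>
    have : (fun x : ℕ => x + 1) ⁻¹' {k + 1} = {k} := by ext; simp
    rw [this, poissonMeasure_singleton, poissonMeasure_singleton]
    have h1 : ((k + 1 : ℕ) : ENNReal) = ENNReal.ofReal (k + 1) := by
      rw [← Nat.cast_succ, ENNReal.ofReal_natCast]
    have h2 : (c : ENNReal) = ENNReal.ofReal c := by simp
    rw [h1, h2, ← ENNReal.ofReal_mul (by positivity), ← ENNReal.ofReal_mul (by positivity)]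
    congr 1
    rw [Nat.factorial_succ]
    push_cast
    field_simp
    ring

lemma integral_natCast_mul_poissonMeasure (c : NNReal) (f : ℕ → ℝ) :
    ∫ n : ℕ, (n : ℝ) * f n ∂(poissonMeasure c) = c * ∫ n, f (n + 1) ∂(poissonMeasure c) := by
  have h := congrArg (fun μ : Measure ℕ => ∫ n, f n ∂μ) (withDensity_poissonMeasure c)
  rw [integral_withDensity_eq_integral_toReal_smul measurable_from_nat (by simp),
    integral_smul_measure, integral_map measurable_from_nat.aemeasurable (by fun_prop)] at h
  simpa using h

lemma integrable_natCast_mul_poissonMeasure (c : NNReal) {f : ℕ → ℝ}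
    (hf : Integrable (fun n : ℕ => f (n + 1)) (poissonMeasure c)) :
    Integrable (fun n : ℕ => (n : ℝ) * f n) (poissonMeasure c) := by
  have h1 : Integrable f ((c : ENNReal) • (poissonMeasure c).map (· + 1)) :=
    Integrable.smul_measure ((integrable_map_measure (by fun_prop)
      measurable_from_nat.aemeasurable).2 hf) (by simp)
  rw [← withDensity_poissonMeasure, integrable_withDensity_iff_integrable_smul'
    measurable_from_nat (by simp)] at h1
  simpa using h1

lemma integrable_natCast_poissonMeasure (c : NNReal) :
    Integrable (fun n : ℕ => (n : ℝ)) (poissonMeasure c) := by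
  simpa using integrable_natCast_mul_poissonMeasure c (f := fun _ => 1) (integrable_const 1)

lemma integral_natCast_poissonMeasure (c : NNReal) :
    ∫ n : ℕ, (n : ℝ) ∂(poissonMeasure c) = c := by
  simpa using integral_natCast_mul_poissonMeasure c (fun _ => 1)

lemma IsPoissonProcess.measurable {Ω : Type*} [MeasurableSpace Ω] {P : Measure Ω}
    {N : ℝ → Ω → ℕ} (hN : IsPoissonProcess P N) (t : ℝ) : Measurable (N t) :=
  Measurable.of_uncurry_left (f := N) hN.measurable_uncurry

lemma IsPoissonProcess.measurable_increment {Ω : Type*} [MeasurableSpace Ω] {P : Measure Ω}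
    {N : ℝ → Ω → ℕ} (hN : IsPoissonProcess P N) (a b : ℝ) :
    Measurable fun ω => N b ω - N a ω :=
  (hN.measurable b).sub (hN.measurable a)

lemma IsPoissonProcess.isProbabilityMeasure {Ω : Type*} [MeasurableSpace Ω] {P : Measure Ω}
    {N : ℝ → Ω → ℕ} (hN : IsPoissonProcess P N) : IsProbabilityMeasure P := by
  have h : IsProbabilityMeasure (P.map fun ω => N 0 ω - N 0 ω) := by
    rw [hN.law 0 0 le_rfl le_rfl]; infer_instance
  exact Measure.isProbabilityMeasure_of_map (fun ω => N 0 ω - N 0 ω)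

section PoissonProcess

variable {Ω : Type*} [MeasurableSpace Ω] {P : Measure Ω}
  {N : ℝ → Ω → ℕ}

/-- The increments over disjoint intervals of length one obey the law of large numbers. -/
lemma IsPoissonProcess.tendsto_nat (hN : IsPoissonProcess P N) :
    ∀ᵐ ω ∂P, Tendsto (fun n : ℕ => (N n ω : ℝ) / n) atTop (𝓝 1) := by
  have := hN.isProbabilityMeasure
  set X : ℕ → Ω → ℝ := fun k ω => ((N ((k + 1 : ℕ) : ℝ) ω - N (k : ℝ) ω : ℕ) : ℝ) with hX
  have hXm : ∀ k, Measurable (X k) := fun k =>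
    measurable_from_nat.comp (hN.measurable_increment _ _)
  have hle : ∀ k : ℕ, (k : ℝ) ≤ ((k + 1 : ℕ) : ℝ) := fun k => by push_cast; linarith
  have hlaw : ∀ k, P.map (X k) = (poissonMeasure 1).map (Nat.cast : ℕ → ℝ) := by
    intro k
    have := hN.law k ((k + 1 : ℕ) : ℝ) (Nat.cast_nonneg k) (hle k)
    have e : (((k + 1 : ℕ) : ℝ) - k).toNNReal = 1 := by push_cast; simp
    rw [e] at this
    rw [← this, Measure.map_map measurable_from_nat (hN.measurable_increment _ _)]
    rfl
  have hint : Integrable (X 0) P := by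
    have : Integrable (id : ℝ → ℝ) (P.map (X 0)) := by
      rw [hlaw, integrable_map_measure (by fun_prop) (by fun_prop)]
      exact integrable_natCast_poissonMeasure 1
    exact (integrable_map_measure (by fun_prop) (hXm 0).aemeasurable).1 this
  have hmean : ∫ ω, X 0 ω ∂P = 1 := by
    have : ∫ x, x ∂(P.map (X 0)) = 1 := by
      rw [hlaw, integral_map (by fun_prop) (by fun_prop), integral_natCast_poissonMeasure]
      simp
    rwa [integral_map (hXm 0).aemeasurable (by fun_prop)] at this
  have hlt : ∀ i j : ℕ, i < j → IndepFun (X i) (X j) P := by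
    intro i j hij
    have h := hN.indep j ((j + 1 : ℕ) : ℝ) (Nat.cast_nonneg j) (hle j)
    have hi1 : ((i + 1 : ℕ) : ℝ) ≤ j := by exact_mod_cast hij
    exact h.comp (φ := fun f : Iic (j : ℝ) → ℕ =>
        ((f ⟨((i + 1 : ℕ) : ℝ), hi1⟩ - f ⟨(i : ℝ), (hle i).trans hi1⟩ : ℕ) : ℝ))
      (ψ := fun n : ℕ => (n : ℝ))
      (measurable_from_nat.comp ((measurable_pi_apply _).sub (measurable_pi_apply _)))
      measurable_from_nat
  have hslln := strong_law_ae_real X hint (fun i j hij => by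
    rcases lt_or_gt_of_ne hij with h | h
    · exact hlt i j h
    · exact (hlt j i h).symm) (fun k =>
      ⟨(hXm k).aemeasurable, (hXm 0).aemeasurable, (hlaw k).trans (hlaw 0).symm⟩)
  filter_upwards [hslln] with ω hω
  rw [hmean] at hω
  refine hω.congr fun n => ?_
  congr 1
  have : ∀ k : ℕ, X k ω = (N ((k + 1 : ℕ) : ℝ) ω : ℝ) - N (k : ℝ) ω := fun k => by
    simp only [hX]
    rw [Nat.cast_sub (hN.mono ω (hle k))]
  simp only [this]
  rw [Finset.sum_range_sub (fun k : ℕ => (N (k : ℝ) ω : ℝ))]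
  simp [hN.zero]

/-- The law of large numbers in continuous time: by monotonicity, the integer times suffice. -/
lemma IsPoissonProcess.tendsto_div (hN : IsPoissonProcess P N) :
    ∀ᵐ ω ∂P, Tendsto (fun t : ℝ => (N t ω : ℝ) / t) atTop (𝓝 1) := by
  filter_upwards [hN.tendsto_nat] with ω hω
  have h1 : Tendsto (fun t : ℝ => (N (⌊t⌋₊ : ℝ) ω : ℝ) / ⌊t⌋₊ * (⌊t⌋₊ / t)) atTop (𝓝 1) := by
    simpa using (hω.comp tendsto_nat_floor_atTop).mul (tendsto_nat_floor_div_atTop (R := ℝ))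
  have h2 : Tendsto (fun t : ℝ => (N (⌈t⌉₊ : ℝ) ω : ℝ) / ⌈t⌉₊ * (⌈t⌉₊ / t)) atTop (𝓝 1) := by
    simpa using (hω.comp tendsto_nat_ceil_atTop).mul (tendsto_nat_ceil_div_atTop (R := ℝ))
  refine tendsto_of_tendsto_of_tendsto_of_le_of_le' h1 h2 ?_ ?_
  · filter_upwards [eventually_ge_atTop 1] with t ht
    have hf : (⌊t⌋₊ : ℝ) ≠ 0 := by
      have := (Nat.floor_pos.2 ht).ne'
      exact_mod_cast this
    rw [div_mul_div_cancel₀ hf]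
    have : (N (⌊t⌋₊ : ℝ) ω : ℝ) ≤ N t ω := by
      exact_mod_cast hN.mono ω (Nat.floor_le (zero_le_one.trans ht))
    gcongr
  · filter_upwards [eventually_ge_atTop 1] with t ht
    have hf : (⌈t⌉₊ : ℝ) ≠ 0 := by
      have := (Nat.ceil_pos.2 (zero_lt_one.trans_le ht)).ne'
      exact_mod_cast this
    rw [div_mul_div_cancel₀ hf]
    have : (N t ω : ℝ) ≤ N (⌈t⌉₊ : ℝ) ω := by
      exact_mod_cast hN.mono ω (Nat.le_ceil t)
    gcongr

/-! ### Finite-dimensional distributions of the Poisson process -/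

/-- An event determined by the process at times in a finite subset of `(-∞, a]` is independent of
the increment over `[a, b]`. -/
lemma IsPoissonProcess.measure_inter_increment (hN : IsPoissonProcess P N) {a b : ℝ} (ha : 0 ≤ a)
    (hab : a ≤ b) {ι : Type*} (F : Finset ι) (f : ι → ℝ) (hf : ∀ r ∈ F, f r ≤ a)
    (B : ι → Set ℕ) (D : Set ℕ) :
    P ((⋂ r ∈ F, N (f r) ⁻¹' B r) ∩ {ω | N b ω - N a ω ∈ D}) =
      P (⋂ r ∈ F, N (f r) ⁻¹' B r) * poissonMeasure (b - a).toNNReal D := by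
  classical
  have hE : (⋂ r ∈ F, N (f r) ⁻¹' B r) = (fun ω (t : Iic a) => N t ω) ⁻¹'
      (⋂ r ∈ F.attach, {g | g ⟨f r.1, mem_Iic.2 (hf r.1 r.2)⟩ ∈ B r.1}) := by
    ext ω
    simp
  have hm : MeasurableSet (⋂ r ∈ F.attach,
      {g : Iic a → ℕ | g ⟨f r.1, mem_Iic.2 (hf r.1 r.2)⟩ ∈ B r.1}) :=
    Finset.measurableSet_biInter _ fun r _ =>
      measurable_pi_apply (X := fun _ : Iic a => ℕ) _ (MeasurableSet.of_discrete (s := B r.1))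
  rw [hE, ← hN.law a b ha hab, Measure.map_apply (hN.measurable_increment a b)
    MeasurableSet.of_discrete]
  exact (hN.indep a b ha hab).measure_inter_preimage_eq_mul _ _ hm MeasurableSet.of_discrete

lemma IsPoissonProcess.measure_eq (hN : IsPoissonProcess P N) {b : ℝ} (hb : 0 ≤ b) (D : Set ℕ) :
    P (N b ⁻¹' D) = poissonMeasure b.toNNReal D := by
  have hP := hN.isProbabilityMeasure
  have := hN.measure_inter_increment le_rfl hb (∅ : Finset ℕ) (fun _ => 0) (by simp)
    (fun _ => ∅) D
  simp only [hN.zero] at this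
  simpa [preimage] using this

/-- The value at time `b` is obtained from the value at time `a` by summing over all values of the
increment. -/
lemma IsPoissonProcess.measure_step (hN : IsPoissonProcess P N) {a b : ℝ} (ha : 0 ≤ a)
    (hab : a ≤ b) {ι : Type*} (F : Finset ι) (f : ι → ℝ) (hf : ∀ r ∈ F, f r ≤ a)
    (B : ι → Set ℕ) (D : Set ℕ) [DecidablePred (· ∈ D)] (n : ℕ) :
    P (N b ⁻¹' {n} ∩ (N a ⁻¹' D ∩ ⋂ r ∈ F, N (f r) ⁻¹' B r)) =
      ∑ m ∈ Finset.range (n + 1) with m ∈ D,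
        P (N a ⁻¹' {m} ∩ ⋂ r ∈ F, N (f r) ⁻¹' B r) * poissonMeasure (b - a).toNNReal {n - m} := by
  classical
  set E := ⋂ r ∈ F, N (f r) ⁻¹' B r with hE
  have hEm : MeasurableSet E :=
    Finset.measurableSet_biInter _ fun r _ => hN.measurable _ MeasurableSet.of_discrete
  have hdecomp : N b ⁻¹' {n} ∩ (N a ⁻¹' D ∩ E) =
      ⋃ m ∈ (Finset.range (n + 1)).filter (· ∈ D),
        (N a ⁻¹' {m} ∩ E) ∩ {ω | N b ω - N a ω ∈ ({n - m} : Set ℕ)} := by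
    ext ω
    have := hN.mono ω hab
    simp only [mem_inter_iff, mem_preimage, mem_singleton_iff, mem_iUnion, Finset.mem_filter,
      Finset.mem_range, mem_ofPred_eq, exists_prop]
    simp only at this
    constructor
    · rintro ⟨h1, h2, h3⟩
      exact ⟨N a ω, ⟨by omega, h2⟩, ⟨rfl, h3⟩, by omega⟩
    · rintro ⟨m, ⟨h1, h2⟩, ⟨h3, h4⟩, h5⟩
      exact ⟨by omega, h3 ▸ h2, h4⟩
  rw [hdecomp, measure_biUnion_finset]
  · refine Finset.sum_congr rfl fun m _ => ?_
    have h := hN.measure_inter_increment ha hab (insert none (F.image some))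
      (fun o : Option ι => o.elim a f) ?_ (fun o => o.elim {m} B) {n - m}
    · simpa [Finset.set_biInter_insert, Finset.set_biInter_finset_image, ← hE] using h
    · intro o ho
      rcases Finset.mem_insert.1 ho with rfl | ho
      · exact le_rfl
      · obtain ⟨r, hr, rfl⟩ := Finset.mem_image.1 ho
        exact hf r hr
  · intro m _ m' _ hmm
    refine Set.disjoint_left.2 fun ω h1 h2 => hmm ?_
    exact h1.1.1.symm.trans h2.1.1
  · intro m _
    exact ((hN.measurable a (measurableSet_singleton m)).inter hEm).inter
      (hN.measurable_increment a b MeasurableSet.of_discrete)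

/-- The recursion behind `IsPoissonProcess.measure_scaled`: an increment of `n - m` points over a time
of length `b - a` turns the likelihood for `m` points on `[0, a]` into that for `n` points on
`[0, b]`, up to a factor that does not depend on the rate `x`. -/
lemma ofReal_mul_poissonMeasure {x a b : ℝ} (hx : 0 < x) (hab : a ≤ b) {m n : ℕ}
    (hmn : m ≤ n) :
    ENNReal.ofReal (x ^ m * Real.exp (-(x * a))) * poissonMeasure (x * b - x * a).toNNReal {n - m} =
      ENNReal.ofReal (x ^ n * Real.exp (-(x * b))) *
        (ENNReal.ofReal (Real.exp (b - a)) * poissonMeasure (b - a).toNNReal {n - m}) := by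
  have h0 : 0 ≤ b - a := sub_nonneg.2 hab
  rw [← mul_sub, poissonMeasure_toNNReal_singleton (mul_nonneg hx.le h0),
    poissonMeasure_toNNReal_singleton h0, ← ENNReal.ofReal_mul (by positivity),
    ← ENNReal.ofReal_mul (by positivity), ← ENNReal.ofReal_mul (by positivity)]
  congr 1
  obtain ⟨k, rfl⟩ := Nat.exists_eq_add_of_le hmn
  rw [Nat.add_sub_cancel_left, mul_pow, pow_add]
  have e1 : Real.exp (-(x * b)) = Real.exp (-(x * a)) * Real.exp (-(x * (b - a))) := by
    rw [← Real.exp_add]; congr 1; ring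
  have e2 : Real.exp (b - a) * Real.exp (-(b - a)) = 1 := by
    rw [← Real.exp_add]; simp
  rw [e1]
  linear_combination (-(x ^ m * Real.exp (-(x * a)) * Real.exp (-(x * (b - a))) * x ^ k *
    (b - a) ^ k / (k.factorial : ℝ))) * e2

/-- The likelihood of the rate: with the time scaled by `x`, the probability of an event on `[0, T]`
with `n` points is proportional to `x ^ n * exp (-x T)`, the factor depending only on the event. -/
lemma IsPoissonProcess.measure_scaled (hN : IsPoissonProcess P N) {ι : Type*} {x : ℝ} (hx : 0 < x)
    (f : ι → ℝ) (B : ι → Set ℕ) (F : Finset ι) : ∀ (T : ℝ) (n : ℕ), 0 ≤ T →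
    (∀ r ∈ F, 0 ≤ f r ∧ f r ≤ T) →
      P (N (x * T) ⁻¹' {n} ∩ ⋂ r ∈ F, N (x * f r) ⁻¹' B r) =
        ENNReal.ofReal (x ^ n * Real.exp (-(x * T))) *
          (ENNReal.ofReal (Real.exp T) * P (N T ⁻¹' {n} ∩ ⋂ r ∈ F, N (f r) ⁻¹' B r)) := by
  classical
  induction F using Finset.induction_on_max_value f with
  | empty =>
    intro T n hT _
    have h := ofReal_mul_poissonMeasure (m := 0) (n := n) hx hT (Nat.zero_le n)
    simp only [mul_zero, sub_zero, pow_zero, neg_zero, Real.exp_zero, mul_one,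
      ENNReal.ofReal_one, one_mul, Nat.sub_zero] at h
    simp only [Finset.notMem_empty, iInter_of_empty, iInter_univ, inter_univ]
    rw [hN.measure_eq (by positivity), hN.measure_eq hT, h]
  | insert a F' _ hmax ih =>
    intro T n hT hF
    have ha := hF a (Finset.mem_insert_self _ _)
    have hF' : ∀ r ∈ F', 0 ≤ f r ∧ f r ≤ f a := fun r hr =>
      ⟨(hF r (Finset.mem_insert_of_mem hr)).1, hmax r hr⟩
    rw [Finset.set_biInter_insert, Finset.set_biInter_insert,
      hN.measure_step (mul_nonneg hx.le ha.1) (mul_le_mul_of_nonneg_left ha.2 hx.le) F'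
        (fun r => x * f r) (fun r hr => mul_le_mul_of_nonneg_left (hF' r hr).2 hx.le),
      hN.measure_step ha.1 ha.2 F' f (fun r hr => (hF' r hr).2), Finset.mul_sum, Finset.mul_sum]
    refine Finset.sum_congr rfl fun m hm => ?_
    have hmn : m ≤ n := by
      have := Finset.mem_range.1 (Finset.mem_filter.1 hm).1
      omega
    rw [ih (f a) m ha.1 hF', mul_right_comm, ofReal_mul_poissonMeasure hx ha.2 hmn]
    have e : ENNReal.ofReal (Real.exp T) =
        ENNReal.ofReal (Real.exp (T - f a)) * ENNReal.ofReal (Real.exp (f a)) := by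
      rw [← ENNReal.ofReal_mul (Real.exp_pos _).le, ← Real.exp_add]
      simp
    rw [e]
    ring

/-- Thinning: given the process from time `b` on, the value at an earlier time `a` is binomially
distributed. -/
lemma IsPoissonProcess.measure_thinning (hN : IsPoissonProcess P N) {ι : Type*} {a b : ℝ}
    (ha : 0 ≤ a) (hab : a ≤ b) (hb : 0 < b) (k n : ℕ)
    (f : ι → ℝ) (B : ι → Set ℕ) (F : Finset ι) : ∀ (T : ℝ) (l : ℕ), b ≤ T →
    (∀ r ∈ F, b ≤ f r ∧ f r ≤ T) →
      P (N T ⁻¹' {l} ∩ (⋂ r ∈ F, N (f r) ⁻¹' B r) ∩ (N b ⁻¹' {n} ∩ N a ⁻¹' {k})) =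
        ENNReal.ofReal (n.choose k * (a / b) ^ k * (1 - a / b) ^ (n - k)) *
          P (N T ⁻¹' {l} ∩ (⋂ r ∈ F, N (f r) ⁻¹' B r) ∩ N b ⁻¹' {n}) := by
  classical
  -- an intersection with prescribed values at `a` and `b` is a cylinder set over `Option (Option ι)`
  have hcyl : ∀ (F' : Finset ι) (c d : ℝ) (A' B' : Set ℕ),
      (⋂ r ∈ insert none (insert (some none) ((F'.image some).image some)),
        N (Option.elim r c fun o : Option ι => o.elim d f) ⁻¹'
          (Option.elim r A' fun o : Option ι => o.elim B' B)) =
      (⋂ r ∈ F', N (f r) ⁻¹' B r) ∩ (N d ⁻¹' B' ∩ N c ⁻¹' A') := by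
    intro F' c d A' B'
    simp only [Finset.set_biInter_insert, Finset.set_biInter_finset_image, Option.elim]
    rw [← inter_assoc, inter_comm, inter_comm (N d ⁻¹' B')]
  have hbnd : ∀ (F' : Finset ι) (c d T : ℝ), c ≤ T → d ≤ T → (∀ r ∈ F', f r ≤ T) →
      ∀ r ∈ insert none (insert (some none) ((F'.image some).image some)),
        (Option.elim r c fun o : Option ι => o.elim d f) ≤ T := by
    intro F' c d T hc hd hF' r hr
    simp only [Finset.mem_insert, Finset.mem_image] at hr
    rcases hr with rfl | rfl | ⟨_, ⟨r, hr, rfl⟩, rfl⟩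
    · exact hc
    · exact hd
    · exact hF' r hr
  induction F using Finset.induction_on_max_value f with
  | empty =>
    intro T l hT _
    have h1 := hN.measure_step (hb.le) hT (ι := ℕ) {0} (fun _ => a) (by simpa using hab)
      (fun _ => {k}) {n} l
    have h2 := hN.measure_step (hb.le) hT (ι := ℕ) ∅ (fun _ => a) (by simp)
      (fun _ => {k}) {n} l
    have h3 := hN.measure_step ha hab (ι := ℕ) ∅ (fun _ => a) (by simp) (fun _ => ∅) {k} n
    simp only [Finset.mem_singleton, iInter_iInter_eq_left, Finset.notMem_empty, iInter_of_empty,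
      iInter_univ, inter_univ, mem_singleton_iff] at h1 h2 h3 ⊢
    rw [h1, h2, Finset.mul_sum]
    refine Finset.sum_congr rfl fun m hm => ?_
    obtain ⟨-, rfl⟩ := Finset.mem_filter.1 hm
    rw [h3, ← mul_assoc]
    congr 1
    by_cases hk : k ≤ m
    · have : (Finset.range (m + 1)).filter (· = k) = {k} := by
        ext j; simp only [Finset.mem_filter, Finset.mem_range, Finset.mem_singleton]; omega
      rw [this, Finset.sum_singleton, hN.measure_eq ha, hN.measure_eq hb.le,
        poissonMeasure_toNNReal_singleton ha, poissonMeasure_toNNReal_singleton hb.le,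
        poissonMeasure_toNNReal_singleton (sub_nonneg.2 hab)]
      have hq : 0 ≤ 1 - a / b := sub_nonneg.2 ((div_le_one hb).2 hab)
      rw [← ENNReal.ofReal_mul (by positivity), ← ENNReal.ofReal_mul (by positivity)]
      congr 1
      obtain ⟨j, rfl⟩ := Nat.exists_eq_add_of_le hk
      rw [Nat.add_sub_cancel_left, Nat.choose_symm_add, Nat.add_choose, Nat.cast_div
        (Nat.factorial_mul_factorial_dvd_factorial_add k j) (by positivity)]
      have e1 : Real.exp (-b) = Real.exp (-a) * Real.exp (-(b - a)) := by
        rw [← Real.exp_add]; congr 1; ring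
      have e2 : 1 - a / b = (b - a) / b := by field_simp
      rw [e1, e2, div_pow, div_pow, pow_add]
      push_cast
      field_simp
    · have : (Finset.range (m + 1)).filter (· = k) = ∅ := by
        ext j
        simp only [Finset.mem_filter, Finset.mem_range, Finset.notMem_empty, iff_false]
        omega
      rw [this, Nat.choose_eq_zero_of_lt (not_le.1 hk)]
      simp
  | insert c F' _ hmax ih =>
    intro T l hT hF
    have hc := hF c (Finset.mem_insert_self _ _)
    have hF' : ∀ r ∈ F', b ≤ f r ∧ f r ≤ f c := fun r hr =>
      ⟨(hF r (Finset.mem_insert_of_mem hr)).1, hmax r hr⟩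
    have h1 := hN.measure_step (hb.le.trans hc.1) hc.2 _ _ (hbnd F' a b (f c) (hab.trans hc.1) hc.1
      (fun r hr => (hF' r hr).2)) (fun r => Option.elim r {k} fun o : Option ι => o.elim {n} B)
      (B c) l
    have h2 := hN.measure_step (hb.le.trans hc.1) hc.2 _ _ (hbnd F' b b (f c) hc.1 hc.1
      (fun r hr => (hF' r hr).2)) (fun r => Option.elim r {n} fun o : Option ι => o.elim {n} B)
      (B c) l
    simp only [hcyl, inter_self] at h1 h2
    rw [Finset.set_biInter_insert]
    simp only [inter_assoc] at h1 h2 ih ⊢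
    rw [h1, h2, Finset.mul_sum]
    refine Finset.sum_congr rfl fun m _ => ?_
    rw [ih (f c) m hc.1 hF', mul_assoc]

end PoissonProcess

/-! ### Conditional probabilities given a discrete present -/

section CondProb

variable {Ω : Type*} {m mΩ : MeasurableSpace Ω} {P : Measure Ω} [IsProbabilityMeasure P]

/-- A characterization of conditional probabilities through integrals in `[0, ∞]`. -/
lemma condExp_indicator_eq_toReal (hm : m ≤ mΩ) {E : Set Ω} (hE : MeasurableSet E)
    {g : Ω → ENNReal} (hg : Measurable[m] g)
    (h : ∀ S, MeasurableSet[m] S → ∫⁻ ω in S, g ω ∂P = P (S ∩ E)) :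
    P⟦E | m⟧ =ᵐ[P] fun ω => (g ω).toReal := by
  have hg' : Measurable g := hg.mono hm le_rfl
  have hfin : ∫⁻ ω, g ω ∂P ≠ ⊤ := by
    have := h univ MeasurableSet.univ
    rw [Measure.restrict_univ] at this
    rw [this]
    exact measure_ne_top _ _
  have hlt : ∀ᵐ ω ∂P, g ω < ⊤ := ae_lt_top hg' hfin
  refine (ae_eq_condExp_of_forall_setIntegral_eq hm ((integrable_const 1).indicator hE)
    (fun _ _ _ => (integrable_toReal_of_lintegral_ne_top hg'.aemeasurable hfin).integrableOn)
    (fun S hS _ => ?_) hg.ennreal_toReal.stronglyMeasurable.aestronglyMeasurable).symm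
  rw [integral_toReal hg'.aemeasurable (ae_restrict_of_ae hlt), h S hS, integral_indicator hE,
    Measure.restrict_restrict hE, inter_comm]
  simp [Measure.real]

/-- If, on every cylinder event of the past, the conditional probability of `E` given that the
integer-valued variable `Y s` equals `n` is `κ n`, then `κ (Y s)` is the conditional probability of
`E` given the past. -/
lemma condExp_indicator_of_cylinder {Y : ℝ → Ω → ℝ} {S : Set ℝ}
    (hY : ∀ t ∈ S, Measurable (Y t)) {s : ℝ} (hs : s ∈ S) (hnat : ∀ ω, ∃ n : ℕ, Y s ω = n)
    {E : Set Ω} (hE : MeasurableSet E) (κ : ℕ → ENNReal)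
    (h : ∀ (n : ℕ) (F : Finset ℝ) (A : ℝ → Set ℝ), (F : Set ℝ) ⊆ S → (∀ r, MeasurableSet (A r)) →
      P ((⋂ r ∈ F, Y r ⁻¹' A r) ∩ (Y s ⁻¹' {(n : ℝ)} ∩ E)) =
        κ n * P ((⋂ r ∈ F, Y r ⁻¹' A r) ∩ Y s ⁻¹' {(n : ℝ)})) :
    P⟦E | sigmaOn Y S⟧ =ᵐ[P] fun ω => (κ ⌊Y s ω⌋₊).toReal := by
  have hle := sigmaOn_le hY
  have hYs : Measurable (Y s) := hY s hs
  have hfl : Measurable fun ω => ⌊Y s ω⌋₊ := Nat.measurable_floor.comp hYs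
  have hlev : ∀ n : ℕ, (fun ω => ⌊Y s ω⌋₊) ⁻¹' {n} = Y s ⁻¹' {(n : ℝ)} := by
    intro n
    ext ω
    obtain ⟨k, hk⟩ := hnat ω
    simp [hk]
  refine condExp_indicator_eq_toReal hle hE
    (measurable_from_nat.comp (Nat.measurable_floor.comp (measurable_sigmaOn hs))) fun T hT => ?_
  have hT' := hle T hT
  have hlevel : ∀ n : ℕ, P (T ∩ (Y s ⁻¹' {(n : ℝ)} ∩ E)) = κ n * P (T ∩ Y s ⁻¹' {(n : ℝ)}) := by
    intro n
    have hms : MeasurableSet (Y s ⁻¹' {(n : ℝ)}) := hYs (measurableSet_singleton _)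
    have := measure_eq_of_cylinder hY (μ := P.restrict (Y s ⁻¹' {(n : ℝ)} ∩ E))
      (ν := κ n • P.restrict (Y s ⁻¹' {(n : ℝ)})) (fun F A hF hA => by
        have hc : MeasurableSet (⋂ r ∈ F, Y r ⁻¹' A r) :=
          Finset.measurableSet_biInter _ fun r hr => hY r (hF hr) (hA r)
        rw [Measure.smul_apply, Measure.restrict_apply hc, Measure.restrict_apply hc]
        exact h n F A hF hA) hT
    rwa [Measure.smul_apply, Measure.restrict_apply hT', Measure.restrict_apply hT'] at this
  calc ∫⁻ ω in T, κ ⌊Y s ω⌋₊ ∂P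
      = ∫⁻ n, κ n ∂((P.restrict T).map fun ω => ⌊Y s ω⌋₊) :=
        (lintegral_map measurable_from_nat hfl).symm
    _ = ∑' n, κ n * P (T ∩ Y s ⁻¹' {(n : ℝ)}) := by
        rw [lintegral_countable']
        refine tsum_congr fun n => ?_
        rw [Measure.map_apply hfl (measurableSet_singleton n), hlev,
          Measure.restrict_apply (hYs (measurableSet_singleton _)), inter_comm]
    _ = ∑' n : ℕ, P (T ∩ E ∩ Y s ⁻¹' {(n : ℝ)}) := by
        refine tsum_congr fun n => ?_
        rw [← hlevel, inter_assoc, inter_comm E]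
    _ = P (T ∩ E) := by
        rw [← measure_iUnion]
        · rw [← inter_iUnion]
          congr 1
          refine inter_eq_left.2 fun ω _ => ?_
          obtain ⟨k, hk⟩ := hnat ω
          exact mem_iUnion.2 ⟨k, hk⟩
        · intro i j hij
          refine Set.disjoint_left.2 fun ω h1 h2 => hij ?_
          have e1 : Y s ω = i := h1.2
          have e2 : Y s ω = j := h2.2
          exact_mod_cast e1.symm.trans e2
        · exact fun n => (hT'.inter hE).inter (hYs (measurableSet_singleton _))

end CondProb

/-! ### The mixed Poisson model of the joined process -/

section Gamma

lemma measurable_gammaPDF (a b : ℝ) : Measurable (gammaPDF a b) :=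
  (measurable_gammaPDFReal a b).ennreal_ofReal

lemma ae_pos_gammaMeasure (a b : ℝ) : ∀ᵐ x ∂(gammaMeasure a b), 0 < x := by
  rw [gammaMeasure, ae_withDensity_iff (measurable_gammaPDF a b)]
  have h0 : ∀ᵐ x : ℝ, x ≠ 0 := by simp [ae_iff]
  filter_upwards [h0] with x hx h
  by_contra hneg
  exact h (gammaPDF_of_neg (lt_of_le_of_ne (not_lt.1 hneg) hx))

/-- The moments of the exponentially tilted gamma distribution. -/
lemma lintegral_pow_mul_exp_gammaMeasure {r c : ℝ} (hr : 0 < r) (hc : 0 ≤ c) (n : ℕ) :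
    ∫⁻ x, ENNReal.ofReal (x ^ n * Real.exp (-(x * c))) ∂(gammaMeasure r 1) =
      ENNReal.ofReal (Real.Gamma (r + n) / (Real.Gamma r * (1 + c) ^ (r + n))) := by
  have hrn : 0 < r + n := by positivity
  have hc1 : 0 < 1 + c := by linarith
  have hG := Real.Gamma_pos_of_pos hr
  have hGn := Real.Gamma_pos_of_pos hrn
  rw [gammaMeasure, lintegral_withDensity_eq_lintegral_mul _
    (measurable_gammaPDF r 1) (by fun_prop)]
  have h0 : ∀ᵐ x : ℝ, x ≠ 0 := by simp [ae_iff]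
  have : ∀ᵐ x : ℝ, (gammaPDF r 1 * fun x => ENNReal.ofReal (x ^ n * Real.exp (-(x * c)))) x =
      ENNReal.ofReal (Real.Gamma (r + n) / (Real.Gamma r * (1 + c) ^ (r + n))) *
        gammaPDF (r + n) (1 + c) x := by
    filter_upwards [h0] with x hx
    rcases lt_or_gt_of_ne hx with h | h
    · simp [gammaPDF_of_neg h]
    · rw [Pi.mul_apply, gammaPDF_of_nonneg h.le, gammaPDF_of_nonneg h.le,
        ← ENNReal.ofReal_mul (by positivity), ← ENNReal.ofReal_mul (by positivity)]
      congr 1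
      have e1 : x ^ (r + n - 1) = x ^ (r - 1) * x ^ n := by
        rw [← Real.rpow_natCast, ← Real.rpow_add h]; congr 1; ring
      have e2 : Real.exp (-((1 + c) * x)) = Real.exp (-(1 * x)) * Real.exp (-(x * c)) := by
        rw [← Real.exp_add]; congr 1; ring
      rw [e1, e2, Real.one_rpow]
      have : (1 + c) ^ (r + n) ≠ 0 := (Real.rpow_pos_of_pos hc1 _).ne'
      field_simp
  rw [lintegral_congr_ae this, lintegral_const_mul _ (measurable_gammaPDF _ _),
    lintegral_gammaPDF_eq_one hrn hc1, mul_one]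

end Gamma

section Model

/-- The mixed Poisson model: given the gamma variable `x`, the process is a Poisson process of rate
`x` in the time scale `t / (1 - t)` before time `1`, and an independent Poisson process of rate `x`
in the reversed time scale `1 / (t - 1)` after time `1`; at time `1` it equals `x`. -/
noncomputable def modelZ {Ω : Type*} (N : ℝ → Ω → ℕ) (t : ℝ) (p : ℝ × Ω × Ω) : ℝ :=
  if t < 1 then (N (p.1 * (t / (1 - t))) p.2.1 : ℝ)
  else if t = 1 then p.1 else (N (p.1 * (1 / (t - 1))) p.2.2 : ℝ)

lemma modelZ_of_lt {Ω : Type*} {N : ℝ → Ω → ℕ} {t : ℝ} (ht : t < 1) (p : ℝ × Ω × Ω) :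
    modelZ N t p = N (p.1 * (t / (1 - t))) p.2.1 := by simp [modelZ, ht]

lemma modelZ_one {Ω : Type*} {N : ℝ → Ω → ℕ} (p : ℝ × Ω × Ω) : modelZ N 1 p = p.1 := by
  simp [modelZ]

lemma modelZ_of_gt {Ω : Type*} {N : ℝ → Ω → ℕ} {t : ℝ} (ht : 1 < t) (p : ℝ × Ω × Ω) :
    modelZ N t p = N (p.1 * (1 / (t - 1))) p.2.2 := by simp [modelZ, ht.not_gt, ht.ne']

lemma exists_nat_modelZ {Ω : Type*} {N : ℝ → Ω → ℕ} {t : ℝ} (ht : t ≠ 1)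
    (p : ℝ × Ω × Ω) : ∃ n : ℕ, modelZ N t p = n := by
  rcases lt_or_gt_of_ne ht with h | h
  · exact ⟨_, modelZ_of_lt h p⟩
  · exact ⟨_, modelZ_of_gt h p⟩

lemma section_of_lt {Ω : Type*} {N : ℝ → Ω → ℕ} {t : ℝ} (ht : t < 1) (A : Set ℝ) (x : ℝ) :
    Prod.mk x ⁻¹' (modelZ N t ⁻¹' A) =
      (N (x * (t / (1 - t))) ⁻¹' (Nat.cast ⁻¹' A)) ×ˢ univ := by
  ext w
  simp [modelZ_of_lt ht]

lemma section_of_gt {Ω : Type*} {N : ℝ → Ω → ℕ} {t : ℝ} (ht : 1 < t) (A : Set ℝ) (x : ℝ) :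
    Prod.mk x ⁻¹' (modelZ N t ⁻¹' A) =
      univ ×ˢ (N (x * (1 / (t - 1))) ⁻¹' (Nat.cast ⁻¹' A)) := by
  ext w
  simp [modelZ_of_gt ht]

lemma section_cylinder_of_lt {Ω : Type*} {N : ℝ → Ω → ℕ} {F : Finset ℝ} (hF : ∀ r ∈ F, r < 1)
    (A : ℝ → Set ℝ) (x : ℝ) :
    Prod.mk x ⁻¹' (⋂ r ∈ F, modelZ N r ⁻¹' A r) =
      (⋂ r ∈ F, N (x * (r / (1 - r))) ⁻¹' (Nat.cast ⁻¹' A r)) ×ˢ univ := by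
  ext w
  simp only [mem_preimage, mem_iInter, mem_prod, mem_univ, and_true]
  refine forall₂_congr fun r hr => ?_
  rw [modelZ_of_lt (hF r hr)]

lemma section_cylinder_of_gt {Ω : Type*} {N : ℝ → Ω → ℕ} {F : Finset ℝ} (hF : ∀ r ∈ F, 1 < r)
    (A : ℝ → Set ℝ) (x : ℝ) :
    Prod.mk x ⁻¹' (⋂ r ∈ F, modelZ N r ⁻¹' A r) =
      univ ×ˢ (⋂ r ∈ F, N (x * (1 / (r - 1))) ⁻¹' (Nat.cast ⁻¹' A r)) := by
  ext w
  simp only [mem_preimage, mem_iInter, mem_prod, mem_univ, true_and]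
  refine forall₂_congr fun r hr => ?_
  rw [modelZ_of_gt (hF r hr)]

variable {Ω : Type*} [MeasurableSpace Ω] {P : Measure Ω} {N : ℝ → Ω → ℕ}

/-- A gamma variable and, independently of it, two copies of a probability space. -/
noncomputable def modelMeasure (r : ℝ) (P : Measure Ω) : Measure (ℝ × Ω × Ω) :=
  (gammaMeasure r 1).prod (P.prod P)

lemma IsPoissonProcess.measurable_comp {Ω' : Type*} [MeasurableSpace Ω']
    (hN : IsPoissonProcess P N) {f : Ω' → ℝ}
    {g : Ω' → Ω} (hf : Measurable f) (hg : Measurable g) : Measurable fun ω => N (f ω) (g ω) :=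
  hN.measurable_uncurry.comp (hf.prodMk hg)

lemma measurable_modelZ (hN : IsPoissonProcess P N) (t : ℝ) : Measurable (modelZ N t) := by
  rcases lt_trichotomy t 1 with h | rfl | h
  · simp only [funext (modelZ_of_lt (N := N) h)]
    exact measurable_from_nat.comp (hN.measurable_comp (by fun_prop) (by fun_prop))
  · simp only [funext (modelZ_one (N := N))]
    exact measurable_fst
  · simp only [funext (modelZ_of_gt (N := N) h)]
    exact measurable_from_nat.comp (hN.measurable_comp (by fun_prop) (by fun_prop))

lemma isProbabilityMeasure_modelMeasure [IsProbabilityMeasure P] {r : ℝ} (hr : 0 < r) :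
    IsProbabilityMeasure (modelMeasure r P) := by
  have := isProbabilityMeasure_gammaMeasure hr one_pos
  unfold modelMeasure
  infer_instance

lemma modelMeasure_apply [IsProbabilityMeasure P] (r : ℝ) {S : Set (ℝ × Ω × Ω)}
    (hS : MeasurableSet S) {h : ℝ → ENNReal}
    (hh : ∀ x, 0 < x → (P.prod P) (Prod.mk x ⁻¹' S) = h x) :
    modelMeasure r P S = ∫⁻ x, h x ∂(gammaMeasure r 1) := by
  rw [modelMeasure, Measure.prod_apply hS]
  refine lintegral_congr_ae ?_
  filter_upwards [ae_pos_gammaMeasure r 1] with x hx using hh x hx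

/-- The conditional probability that the model lies in `A` at time `t`, given that it equals `n` at
time `s < 1` and that the gamma variable equals `x`. -/
noncomputable def stepProb (s t : ℝ) (n : ℕ) (A : Set ℝ) (x : ℝ) : ENNReal :=
  if t < 1 then poissonMeasure (x * (t / (1 - t)) - x * (s / (1 - s))).toNNReal
    {m | ((n + m : ℕ) : ℝ) ∈ A}
  else if t = 1 then A.indicator 1 x
  else poissonMeasure (x * (1 / (t - 1))).toNNReal (Nat.cast ⁻¹' A)

lemma div_one_sub_nonneg {t : ℝ} (h0 : 0 ≤ t) (h1 : t < 1) : 0 ≤ t / (1 - t) :=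
  div_nonneg h0 (sub_nonneg.2 h1.le)

lemma div_one_sub_le {s t : ℝ} (hst : s ≤ t) (h1 : t < 1) :
    s / (1 - s) ≤ t / (1 - t) := by
  rw [div_le_div_iff₀ (by linarith) (by linarith)]
  nlinarith

/-- Given the gamma variable, the transition from time `s < 1` is described by `stepProb`, and the
past up to time `s` is described by the likelihood `x ^ n * exp (-x s / (1 - s))`. -/
lemma section_measure_past [IsProbabilityMeasure P] (hN : IsPoissonProcess P N) {s t : ℝ}
    (hs0 : 0 ≤ s) (hs1 : s < 1) (hst : s ≤ t) (n : ℕ) (A' : Set ℝ) {F : Finset ℝ}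
    (hF : (F : Set ℝ) ⊆ Icc 0 s) (A : ℝ → Set ℝ) {x : ℝ} (hx : 0 < x) :
    (P.prod P) (Prod.mk x ⁻¹'
        ((⋂ r ∈ F, modelZ N r ⁻¹' A r) ∩ (modelZ N s ⁻¹' {(n : ℝ)} ∩ modelZ N t ⁻¹' A'))) =
      ENNReal.ofReal (x ^ n * Real.exp (-(x * (s / (1 - s))))) *
        (ENNReal.ofReal (Real.exp (s / (1 - s))) * P (N (s / (1 - s)) ⁻¹' {n} ∩
          ⋂ r ∈ F, N (r / (1 - r)) ⁻¹' (Nat.cast ⁻¹' A r))) * stepProb s t n A' x := by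
  classical
  have hτ := div_one_sub_nonneg hs0 hs1
  have hF1 : ∀ r ∈ F, r < 1 := fun r hr => (hF hr).2.trans_lt hs1
  have hFτ : ∀ r ∈ F, 0 ≤ r / (1 - r) ∧ r / (1 - r) ≤ s / (1 - s) := fun r hr =>
    ⟨div_one_sub_nonneg (hF hr).1 (hF1 r hr), div_one_sub_le (hF hr).2 hs1⟩
  have hcast : (Nat.cast ⁻¹' {(n : ℝ)} : Set ℕ) = {n} := by ext; simp
  rw [← hN.measure_scaled hx (fun r => r / (1 - r)) (fun r => Nat.cast ⁻¹' A r) F _ n hτ hFτ,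
    preimage_inter, preimage_inter, section_cylinder_of_lt hF1, section_of_lt hs1, hcast]
  set E := ⋂ r ∈ F, N (x * (r / (1 - r))) ⁻¹' (Nat.cast ⁻¹' A r)
  rcases lt_trichotomy t 1 with ht | rfl | ht
  · have hE : E ×ˢ univ ∩ ((N (x * (s / (1 - s))) ⁻¹' {n}) ×ˢ univ ∩
        Prod.mk x ⁻¹' (modelZ N t ⁻¹' A')) =
        ((N (x * (s / (1 - s))) ⁻¹' {n} ∩ E) ∩ {ω | N (x * (t / (1 - t))) ω -
          N (x * (s / (1 - s))) ω ∈ {m | ((n + m : ℕ) : ℝ) ∈ A'}}) ×ˢ (univ : Set Ω) := by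
      rw [section_of_lt ht]
      ext w
      have := hN.mono w.1 (mul_le_mul_of_nonneg_left (div_one_sub_le hst ht) hx.le)
      simp only [mem_inter_iff, mem_prod, mem_univ, and_true, mem_preimage, mem_singleton_iff,
        mem_ofPred_eq]
      constructor
      · rintro ⟨h1, h2, h3⟩
        refine ⟨⟨h2, h1⟩, ?_⟩
        rw [← h2, Nat.add_sub_cancel' this]
        exact h3
      · rintro ⟨⟨h2, h1⟩, h3⟩
        rw [← h2, Nat.add_sub_cancel' this] at h3
        exact ⟨h1, h2, h3⟩
    rw [hE, Measure.prod_prod, measure_univ, mul_one, stepProb, if_pos ht]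
    have := hN.measure_inter_increment (mul_nonneg hx.le hτ)
      (mul_le_mul_of_nonneg_left (div_one_sub_le hst ht) hx.le) (insert none (F.image some))
      (fun o : Option ℝ => o.elim (x * (s / (1 - s))) fun r => x * (r / (1 - r)))
      (by
        intro o ho
        rcases Finset.mem_insert.1 ho with rfl | ho
        · exact le_rfl
        · obtain ⟨r, hr, rfl⟩ := Finset.mem_image.1 ho
          exact mul_le_mul_of_nonneg_left (hFτ r hr).2 hx.le)
      (fun o => o.elim {n} fun r => Nat.cast ⁻¹' A r) {m | ((n + m : ℕ) : ℝ) ∈ A'}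
    simpa only [Finset.set_biInter_insert, Finset.set_biInter_finset_image, Option.elim] using this
  · have h1 : Prod.mk x ⁻¹' (modelZ N 1 ⁻¹' A') = if x ∈ A' then univ else (∅ : Set (Ω × Ω)) := by
      ext w
      by_cases h : x ∈ A' <;> simp [modelZ_one, h]
    rw [h1, stepProb, if_neg (lt_irrefl _), if_pos rfl]
    by_cases h : x ∈ A'
    · simp only [h, if_true, inter_univ, indicator_of_mem, Pi.one_apply, mul_one]
      rw [prod_inter_prod, inter_univ, Measure.prod_prod, measure_univ, mul_one, inter_comm]
    · simp [h]
  · rw [section_of_gt ht, stepProb, if_neg ht.not_gt, if_neg ht.ne', prod_inter_prod,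
      prod_inter_prod, inter_univ, univ_inter, univ_inter, Measure.prod_prod, inter_comm E,
      hN.measure_eq (by have := sub_pos.2 ht; positivity)]

/-- The conditional probability that the model lies in `A` at time `t`, given that it equals `n` at
time `s < 1`. -/
noncomputable def pastKernel (r s t : ℝ) (A : Set ℝ) (n : ℕ) : ENNReal :=
  (∫⁻ x, ENNReal.ofReal (x ^ n * Real.exp (-(x * (s / (1 - s))))) * stepProb s t n A x
      ∂(gammaMeasure r 1)) /
    ENNReal.ofReal (Real.Gamma (r + n) / (Real.Gamma r * (1 + s / (1 - s)) ^ (r + n)))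

/-- Before time `1` the conditional law of the model at a later time is a function of its present value:
the likelihood of the gamma variable depends on the past only through that value. -/
lemma model_condExp_past [IsProbabilityMeasure P] (hN : IsPoissonProcess P N) {r : ℝ} (hr : 0 < r)
    {s t : ℝ} (hs0 : 0 ≤ s) (hs1 : s < 1) (hst : s ≤ t) {A : Set ℝ} (hA : MeasurableSet A) :
    (modelMeasure r P)⟦modelZ N t ⁻¹' A | sigmaOn (modelZ N) (Icc 0 s)⟧ =ᵐ[modelMeasure r P]
      fun p => (pastKernel r s t A ⌊modelZ N s p⌋₊).toReal := by
  have hprob := isProbabilityMeasure_modelMeasure (P := P) hr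
  have hm := measurable_modelZ hN
  have hτ := div_one_sub_nonneg hs0 hs1
  refine condExp_indicator_of_cylinder (fun t _ => hm t) (right_mem_Icc.2 hs0)
    (exists_nat_modelZ hs1.ne) (hm t hA) _ fun n F B hF hB => ?_
  have hcyl : MeasurableSet (⋂ r ∈ F, modelZ N r ⁻¹' B r) :=
    Finset.measurableSet_biInter _ fun r _ => hm r (hB r)
  have hms : MeasurableSet (modelZ N s ⁻¹' {(n : ℝ)}) := hm s (measurableSet_singleton _)
  set c := ENNReal.ofReal (Real.exp (s / (1 - s))) * P (N (s / (1 - s)) ⁻¹' {n} ∩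
          ⋂ r ∈ F, N (r / (1 - r)) ⁻¹' (Nat.cast ⁻¹' B r)) with hc
  have hctop : c ≠ ⊤ := ENNReal.mul_ne_top ENNReal.ofReal_ne_top (measure_ne_top _ _)
  have h1 := modelMeasure_apply r (hcyl.inter (hms.inter (hm t hA)))
    (fun x hx => section_measure_past hN hs0 hs1 hst n A hF B hx)
  have h2 := modelMeasure_apply r (hcyl.inter (hms.inter (hm s MeasurableSet.univ)))
    (fun x hx => section_measure_past hN hs0 hs1 le_rfl n univ hF B hx)
  have hone : ∀ x, stepProb s s n univ x = 1 := fun x => by simp [stepProb, hs1]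
  simp only [hone, mul_one, preimage_univ, inter_univ] at h2
  rw [← hc] at h1 h2
  have e1 : ∀ x, ENNReal.ofReal (x ^ n * Real.exp (-(x * (s / (1 - s))))) * c * stepProb s t n A x =
      c * (ENNReal.ofReal (x ^ n * Real.exp (-(x * (s / (1 - s))))) * stepProb s t n A x) :=
    fun x => by ring
  simp only [e1] at h1
  rw [lintegral_const_mul' _ _ hctop] at h1
  rw [lintegral_mul_const' _ _ hctop, lintegral_pow_mul_exp_gammaMeasure hr hτ] at h2
  rw [h1, h2, pastKernel]
  have hpos : 0 < Real.Gamma (r + n) / (Real.Gamma r * (1 + s / (1 - s)) ^ (r + n)) := by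
    have := Real.Gamma_pos_of_pos hr
    have := Real.Gamma_pos_of_pos (show 0 < r + n by positivity)
    positivity
  rw [← mul_assoc, ENNReal.div_mul_cancel (ENNReal.ofReal_pos.2 hpos).ne' ENNReal.ofReal_ne_top,
    mul_comm]

/-- The conditional law after time `1` given the process up to time `1`. -/
lemma model_condExp_one [IsProbabilityMeasure P] (hN : IsPoissonProcess P N) {r : ℝ} (hr : 0 < r)
    {t : ℝ} (ht : 1 < t) {A : Set ℝ} (hA : MeasurableSet A) :
    (modelMeasure r P)⟦modelZ N t ⁻¹' A | sigmaOn (modelZ N) (Icc 0 1)⟧ =ᵐ[modelMeasure r P]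
      fun p => (P (N (modelZ N 1 p * (1 / (t - 1))) ⁻¹' (Nat.cast ⁻¹' A))).toReal := by
  have hprob := isProbabilityMeasure_modelMeasure (P := P) hr
  have := isProbabilityMeasure_gammaMeasure hr one_pos
  have hm := measurable_modelZ hN
  have hg : Measurable fun x : ℝ => P (N (x * (1 / (t - 1))) ⁻¹' (Nat.cast ⁻¹' A)) := by
    have : MeasurableSet {q : ℝ × Ω | (N (q.1 * (1 / (t - 1))) q.2 : ℝ) ∈ A} :=
      (measurable_from_nat (f := (Nat.cast : ℕ → ℝ))).comp
        (hN.measurable_comp (f := fun q : ℝ × Ω => q.1 * (1 / (t - 1))) (by fun_prop)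
          measurable_snd) hA
    exact measurable_measure_prodMk_left this
  have hle : sigmaOn (modelZ N) (Icc 0 1) ≤
      MeasurableSpace.comap (fun p : ℝ × Ω × Ω => (p.1, p.2.1)) inferInstance := by
    refine iSup₂_le fun u hu => ?_
    rcases hu.2.lt_or_eq with h | rfl
    · have : modelZ N u = (fun q : ℝ × Ω => (N (q.1 * (u / (1 - u))) q.2 : ℝ)) ∘
          fun p : ℝ × Ω × Ω => (p.1, p.2.1) := funext fun p => modelZ_of_lt h p
      rw [this, ← MeasurableSpace.comap_comp]
      refine MeasurableSpace.comap_mono (Measurable.comap_le ?_)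
      exact measurable_from_nat.comp (hN.measurable_comp (by fun_prop) measurable_snd)
    · have : modelZ N 1 = (fun q : ℝ × Ω => q.1) ∘
          fun p : ℝ × Ω × Ω => (p.1, p.2.1) := funext fun p => modelZ_one p
      rw [this, ← MeasurableSpace.comap_comp]
      exact MeasurableSpace.comap_mono (Measurable.comap_le measurable_fst)
  refine condExp_indicator_eq_toReal (sigmaOn_le fun t _ => hm t) (hm t hA)
    (hg.comp (measurable_sigmaOn (by simp))) fun S hS => ?_
  obtain ⟨C, hC, rfl⟩ := hle S hS
  have hSm : MeasurableSet ((fun p : ℝ × Ω × Ω => (p.1, p.2.1)) ⁻¹' C) :=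
    (by fun_prop : Measurable fun p : ℝ × Ω × Ω => (p.1, p.2.1)) hC
  have hsec : ∀ x, Prod.mk x ⁻¹' ((fun p : ℝ × Ω × Ω => (p.1, p.2.1)) ⁻¹' C) =
      (Prod.mk x ⁻¹' C) ×ˢ (univ : Set Ω) := fun x => by ext w; simp
  rw [modelMeasure_apply r (hSm.inter (hm t hA)) (h := fun x => P (Prod.mk x ⁻¹' C) *
    P (N (x * (1 / (t - 1))) ⁻¹' (Nat.cast ⁻¹' A)))]
  · simp only [modelZ_one]
    have hgm : Measurable fun p : ℝ × Ω × Ω =>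
        P (N (p.1 * (1 / (t - 1))) ⁻¹' (Nat.cast ⁻¹' A)) := hg.comp measurable_fst
    rw [← lintegral_indicator hSm, modelMeasure, lintegral_prod _
      (hgm.indicator hSm).aemeasurable]
    refine lintegral_congr fun x => ?_
    have : ∀ w, ((fun p : ℝ × Ω × Ω => (p.1, p.2.1)) ⁻¹' C).indicator
        (fun p : ℝ × Ω × Ω => P (N (p.1 * (1 / (t - 1))) ⁻¹' (Nat.cast ⁻¹' A))) (x, w) =
        (Prod.mk x ⁻¹' ((fun p : ℝ × Ω × Ω => (p.1, p.2.1)) ⁻¹' C)).indicator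
          (fun _ => P (N (x * (1 / (t - 1))) ⁻¹' (Nat.cast ⁻¹' A))) w := fun w => rfl
    simp only [this]
    rw [lintegral_indicator_const (measurable_prodMk_left hSm), hsec, Measure.prod_prod,
      measure_univ, mul_one, mul_comm]
  · intro x _
    rw [preimage_inter, hsec, section_of_gt ht, prod_inter_prod, inter_univ, univ_inter,
      Measure.prod_prod]

/-- After time `1` the model performs binomial thinning. -/
lemma model_condExp_future [IsProbabilityMeasure P] (hN : IsPoissonProcess P N) {r : ℝ}
    (hr : 0 < r) {s t : ℝ} (hs : 1 < s) (hst : s ≤ t) {A : Set ℝ} (hA : MeasurableSet A) :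
    (modelMeasure r P)⟦modelZ N t ⁻¹' A | sigmaOn (modelZ N) (Icc 0 s)⟧ =ᵐ[modelMeasure r P]
      fun p => (∑' k : ℕ, A.indicator (fun _ => ENNReal.ofReal ((⌊modelZ N s p⌋₊).choose k *
        ((s - 1) / (t - 1)) ^ k * (1 - (s - 1) / (t - 1)) ^ (⌊modelZ N s p⌋₊ - k)))
          (k : ℝ)).toReal := by
  classical
  have hprob := isProbabilityMeasure_modelMeasure (P := P) hr
  have hm := measurable_modelZ hN
  have ht : 1 < t := hs.trans_le hst
  have hs1 : 0 < s - 1 := sub_pos.2 hs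
  have ht1 : 0 < t - 1 := sub_pos.2 ht
  have hs0 : 0 ≤ s := zero_le_one.trans hs.le
  refine condExp_indicator_of_cylinder (fun t _ => hm t) (right_mem_Icc.2 hs0)
    (exists_nat_modelZ hs.ne') (hm t hA) (fun n => ∑' k : ℕ, A.indicator (fun _ =>
      ENNReal.ofReal (n.choose k * ((s - 1) / (t - 1)) ^ k *
        (1 - (s - 1) / (t - 1)) ^ (n - k))) (k : ℝ)) fun n F B hF hB => ?_
  have hcyl : MeasurableSet (⋂ r ∈ F, modelZ N r ⁻¹' B r) :=
    Finset.measurableSet_biInter _ fun r _ => hm r (hB r)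
  have hms : MeasurableSet (modelZ N s ⁻¹' {(n : ℝ)}) := hm s (measurableSet_singleton _)
  have hmt : ∀ k : ℕ, MeasurableSet (modelZ N t ⁻¹' {(k : ℝ)}) := fun k =>
    hm t (measurableSet_singleton _)
  have hcast : ∀ k : ℕ, (Nat.cast ⁻¹' {(k : ℝ)} : Set ℕ) = {k} := fun k => by ext; simp
  have hratio : ∀ x : ℝ, 0 < x → x * (1 / (t - 1)) / (x * (1 / (s - 1))) = (s - 1) / (t - 1) := by
    intro x hx
    field_simp
  -- one value at time `t`
  have hk : ∀ k : ℕ, modelMeasure r P ((⋂ r ∈ F, modelZ N r ⁻¹' B r) ∩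
      (modelZ N s ⁻¹' {(n : ℝ)} ∩ modelZ N t ⁻¹' {(k : ℝ)})) =
      ENNReal.ofReal (n.choose k * ((s - 1) / (t - 1)) ^ k * (1 - (s - 1) / (t - 1)) ^ (n - k)) *
        modelMeasure r P ((⋂ r ∈ F, modelZ N r ⁻¹' B r) ∩ modelZ N s ⁻¹' {(n : ℝ)}) := by
    intro k
    rw [modelMeasure_apply r (hcyl.inter (hms.inter (hmt k))) (fun x _ => rfl),
      modelMeasure_apply r (hcyl.inter hms) (fun x _ => rfl),
      ← lintegral_const_mul' _ _ ENNReal.ofReal_ne_top]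
    refine lintegral_congr_ae ?_
    filter_upwards [ae_pos_gammaMeasure r 1] with x hx
    -- the part of the cylinder up to time `1` only involves the first two coordinates
    set F₁ := F.filter (· ≤ 1) with hF₁
    set F₂ := F.filter (¬ · ≤ 1) with hF₂
    have hsplit : (⋂ r ∈ F, modelZ N r ⁻¹' B r) =
        (⋂ r ∈ F₁, modelZ N r ⁻¹' B r) ∩ ⋂ r ∈ F₂, modelZ N r ⁻¹' B r := by
      ext p
      simp only [hF₁, hF₂, mem_inter_iff, mem_iInter, Finset.mem_filter]
      exact ⟨fun h => ⟨fun r hr => h r hr.1, fun r hr => h r hr.1⟩, fun h r hr =>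
        (le_or_gt r 1).elim (fun h1 => h.1 r ⟨hr, h1⟩) fun h1 => h.2 r ⟨hr, h1.not_ge⟩⟩
    obtain ⟨C, hC⟩ : ∃ C : Set Ω, Prod.mk x ⁻¹' (⋂ r ∈ F₁, modelZ N r ⁻¹' B r) =
        C ×ˢ (univ : Set Ω) := by
      refine ⟨{ω | ∀ r ∈ F₁, (if r < 1 then (N (x * (r / (1 - r))) ω : ℝ) else x) ∈ B r}, ?_⟩
      ext w
      simp only [mem_preimage, mem_iInter, mem_prod, mem_univ, and_true, mem_ofPred_eq]
      refine forall₂_congr fun r hr => ?_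
      rcases (Finset.mem_filter.1 hr).2.lt_or_eq with h | rfl
      · rw [modelZ_of_lt h, if_pos h]
      · rw [modelZ_one, if_neg (lt_irrefl _)]
    have hF₂1 : ∀ r ∈ F₂, 1 < r := fun r hr => not_le.1 (Finset.mem_filter.1 hr).2
    have hF₂s : ∀ r ∈ F₂, r ≤ s := fun r hr => (hF (Finset.mem_filter.1 hr).1).2
    have hv : ∀ r ∈ insert s F₂, 0 < r - 1 ∧ r ≤ s := by
      intro r hr
      rcases Finset.mem_insert.1 hr with rfl | hr
      · exact ⟨hs1, le_rfl⟩
      · exact ⟨sub_pos.2 (hF₂1 r hr), hF₂s r hr⟩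
    -- all times in question are bounded by the largest value of `1 / (r - 1)`
    obtain ⟨q, hq, hqmax⟩ := (insert s F₂).exists_max_image (fun r => 1 / (r - 1))
      ⟨s, Finset.mem_insert_self _ _⟩
    have hbnd : ∀ r ∈ F₂, x * (1 / (s - 1)) ≤ x * (1 / (r - 1)) ∧
        x * (1 / (r - 1)) ≤ x * (1 / (q - 1)) := by
      intro r hr
      have h1 := hv r (Finset.mem_insert_of_mem hr)
      refine ⟨mul_le_mul_of_nonneg_left ?_ hx.le,
        mul_le_mul_of_nonneg_left (hqmax r (Finset.mem_insert_of_mem hr)) hx.le⟩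
      exact one_div_le_one_div_of_le h1.1 (by linarith [h1.2])
    have hthin : ∀ l : ℕ, _ := fun l => hN.measure_thinning (ι := ℝ) (a := x * (1 / (t - 1)))
      (b := x * (1 / (s - 1))) (by positivity) (mul_le_mul_of_nonneg_left
        (one_div_le_one_div_of_le hs1 (by linarith)) hx.le) (by positivity) k n
      (fun r => x * (1 / (r - 1))) (fun r => Nat.cast ⁻¹' B r) F₂ (x * (1 / (q - 1))) l
      (mul_le_mul_of_nonneg_left (hqmax s (Finset.mem_insert_self _ _)) hx.le) hbnd
    rw [hratio x hx] at hthin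
    have hEm : MeasurableSet (⋂ r ∈ F₂, N (x * (1 / (r - 1))) ⁻¹' (Nat.cast ⁻¹' B r)) :=
      Finset.measurableSet_biInter _ fun r _ => hN.measurable _ MeasurableSet.of_discrete
    set E := ⋂ r ∈ F₂, N (x * (1 / (r - 1))) ⁻¹' (Nat.cast ⁻¹' B r) with hE
    have hsum : ∀ G : Set Ω, MeasurableSet G → P G =
        ∑' l : ℕ, P (N (x * (1 / (q - 1))) ⁻¹' {l} ∩ G) := by
      intro G hG
      rw [← measure_iUnion]
      · congr 1
        ext ω
        simp
      · intro i j hij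
        refine Set.disjoint_left.2 fun ω h1 h2 => hij ?_
        exact h1.1.symm.trans h2.1
      · exact fun l => (hN.measurable _ (measurableSet_singleton l)).inter hG
    have hthin' : P (E ∩ (N (x * (1 / (s - 1))) ⁻¹' {n} ∩ N (x * (1 / (t - 1))) ⁻¹' {k})) =
        ENNReal.ofReal (n.choose k * ((s - 1) / (t - 1)) ^ k *
          (1 - (s - 1) / (t - 1)) ^ (n - k)) * P (E ∩ N (x * (1 / (s - 1))) ⁻¹' {n}) := by
      rw [hsum _ (hEm.inter ((hN.measurable _ (measurableSet_singleton n)).inter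
        (hN.measurable _ (measurableSet_singleton k)))),
        hsum _ (hEm.inter (hN.measurable _ (measurableSet_singleton n))), ← ENNReal.tsum_mul_left]
      refine tsum_congr fun l => ?_
      have := hthin l
      simp only [inter_assoc] at this ⊢
      exact this
    rw [hsplit]
    simp only [preimage_inter]
    rw [hC, section_cylinder_of_gt hF₂1, section_of_gt hs, section_of_gt ht, hcast, hcast, ← hE]
    simp only [prod_inter_prod, univ_inter, inter_univ]
    rw [Measure.prod_prod, Measure.prod_prod, hthin']
    ring
  have hdec : (⋂ r ∈ F, modelZ N r ⁻¹' B r) ∩ (modelZ N s ⁻¹' {(n : ℝ)} ∩ modelZ N t ⁻¹' A) =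
      ⋃ k : ℕ, if (k : ℝ) ∈ A then (⋂ r ∈ F, modelZ N r ⁻¹' B r) ∩
        (modelZ N s ⁻¹' {(n : ℝ)} ∩ modelZ N t ⁻¹' {(k : ℝ)}) else ∅ := by
    ext p
    simp only [mem_iUnion]
    constructor
    · rintro ⟨h1, h2, h3⟩
      obtain ⟨k, hk'⟩ := exists_nat_modelZ (N := N) ht.ne' p
      have hkA : (k : ℝ) ∈ A := hk' ▸ h3
      exact ⟨k, by rw [if_pos hkA]; exact ⟨h1, h2, hk'⟩⟩
    · rintro ⟨k, hk'⟩
      split_ifs at hk' with hkA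
      · refine ⟨hk'.1, hk'.2.1, ?_⟩
        have : modelZ N t p = k := hk'.2.2
        rw [mem_preimage, this]
        exact hkA
      · exact hk'.elim
  rw [hdec, measure_iUnion, ← ENNReal.tsum_mul_right]
  · refine tsum_congr fun k => ?_
    by_cases hkA : (k : ℝ) ∈ A
    · simp only [hkA, if_true, indicator_of_mem, hk k]
    · simp [hkA]
  · intro i j hij
    refine Set.disjoint_left.2 fun p h1 h2 => hij ?_
    simp only at h1 h2
    split_ifs at h1 with hi
    split_ifs at h2 with hj
    · have e1 : modelZ N t p = i := h1.2.2
      have e2 : modelZ N t p = j := h2.2.2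
      exact_mod_cast e1.symm.trans e2
    · exact h2.elim
    · exact h1.elim
  · intro k
    split_ifs
    · exact hcyl.inter (hms.inter (hmt k))
    · exact MeasurableSet.empty

end Model

/-! ### Explicit transition probabilities -/

/-- The negative binomial transition probabilities of the birth process. -/
noncomputable def birthProb (r s t : ℝ) (j k : ℕ) : ℝ :=
  if k < j then 0 else
    Real.Gamma (k + r) / (Real.Gamma (j + r) * ((k - j).factorial : ℝ)) *
      ((1 - t) / (1 - s)) ^ (j + r) * (1 - (1 - t) / (1 - s)) ^ (k - j)

/-- The binomial transition probabilities of the death process. -/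
noncomputable def deathProb (s t : ℝ) (j k : ℕ) : ℝ :=
  j.choose k * ((s - 1) / (t - 1)) ^ k * (1 - (s - 1) / (t - 1)) ^ (j - k)

lemma birthProb_add (r s t : ℝ) (j m : ℕ) : birthProb r s t j (j + m) =
    Real.Gamma (j + m + r) / (Real.Gamma (j + r) * (m.factorial : ℝ)) *
      ((1 - t) / (1 - s)) ^ (j + r) * (1 - (1 - t) / (1 - s)) ^ m := by
  simp [birthProb]

lemma birthProb_of_lt {r s t : ℝ} {j k : ℕ} (h : k < j) : birthProb r s t j k = 0 := by
  simp [birthProb, h]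

lemma hasDerivAt_birthProb_self {r s t : ℝ} (hs : s < 1) (ht : t < 1) (j : ℕ) :
    HasDerivAt (fun v => birthProb r s v j j) (-((j + r) / (1 - t) * birthProb r s t j j)) t := by
  have hs' : (1 : ℝ) - s ≠ 0 := (sub_pos.2 hs).ne'
  have ht' : (1 : ℝ) - t ≠ 0 := (sub_pos.2 ht).ne'
  have hq : 0 < (1 - t) / (1 - s) := div_pos (sub_pos.2 ht) (sub_pos.2 hs)
  have hd : HasDerivAt (fun v => (1 - v) / (1 - s)) (-1 / (1 - s)) t :=
    ((hasDerivAt_id t).const_sub 1).div_const _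
  have h := (hd.rpow_const (p := j + r) (Or.inl hq.ne')).const_mul
    (Real.Gamma (j + 0 + r) / (Real.Gamma (j + r) * ((0 : ℕ).factorial : ℝ)))
  have e : ∀ v, birthProb r s v j j = Real.Gamma (j + 0 + r) /
      (Real.Gamma (j + r) * ((0 : ℕ).factorial : ℝ)) * ((1 - v) / (1 - s)) ^ (j + r) := fun v => by
    have := birthProb_add r s v j 0
    simpa using this
  simp only [e]
  refine h.congr_deriv ?_
  rw [Real.rpow_sub_one hq.ne']
  field_simp

lemma hasDerivAt_birthProb_succ {r s t : ℝ} (hr : 0 < r) (hs : s < 1) (ht : t < 1) (j k : ℕ) :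
    HasDerivAt (fun v => birthProb r s v j (k + 1)) ((k + r) / (1 - t) * birthProb r s t j k -
      ((k + 1 : ℕ) + r) / (1 - t) * birthProb r s t j (k + 1)) t := by
  rcases lt_trichotomy (k + 1) j with h | rfl | h
  · have e : ∀ v, birthProb r s v j (k + 1) = 0 := fun v => birthProb_of_lt h
    simp only [e, birthProb_of_lt ((Nat.lt_succ_self k).trans h), mul_zero, sub_zero]
    exact hasDerivAt_const t 0
  · rw [birthProb_of_lt (Nat.lt_succ_self k), mul_zero, zero_sub]
    exact hasDerivAt_birthProb_self hs ht (k + 1)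
  · obtain ⟨m, rfl⟩ := Nat.exists_eq_add_of_le (Nat.lt_succ_iff.1 h)
    have hs' : (1 : ℝ) - s ≠ 0 := (sub_pos.2 hs).ne'
    have ht' : (1 : ℝ) - t ≠ 0 := (sub_pos.2 ht).ne'
    have hq : 0 < (1 - t) / (1 - s) := div_pos (sub_pos.2 ht) (sub_pos.2 hs)
    have hd : HasDerivAt (fun v => (1 - v) / (1 - s)) (-1 / (1 - s)) t :=
      ((hasDerivAt_id t).const_sub 1).div_const _
    have h := ((hd.rpow_const (p := j + r) (Or.inl hq.ne')).fun_mul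
      ((hd.const_sub 1).fun_pow (m + 1))).const_mul
      (Real.Gamma (j + (m + 1 : ℕ) + r) / (Real.Gamma (j + r) * ((m + 1).factorial : ℝ)))
    have e : ∀ v, birthProb r s v j (j + m + 1) = Real.Gamma (j + (m + 1 : ℕ) + r) /
        (Real.Gamma (j + r) * ((m + 1).factorial : ℝ)) *
        (((1 - v) / (1 - s)) ^ (j + r) * (1 - (1 - v) / (1 - s)) ^ (m + 1)) := fun v => by
      rw [add_assoc, birthProb_add, mul_assoc]
    simp only [e]
    refine h.congr_deriv ?_
    rw [birthProb_add, Real.rpow_sub_one hq.ne']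
    have hg : Real.Gamma (j + (m + 1 : ℕ) + r) = (j + m + r) * Real.Gamma (j + m + r) := by
      rw [← Real.Gamma_add_one (by positivity)]
      congr 1
      push_cast
      ring
    have hG : Real.Gamma (j + r) ≠ 0 := (Real.Gamma_pos_of_pos (by positivity)).ne'
    have hf : ((m + 1).factorial : ℝ) = (m + 1) * m.factorial := by
      rw [Nat.factorial_succ]; push_cast; ring
    have hmf : (m.factorial : ℝ) ≠ 0 := by positivity
    have hm1 : (m : ℝ) + 1 ≠ 0 := by positivity
    rw [hg, hf]
    set q := (1 - t) / (1 - s) with hqdef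
    have hq1 : 1 - t = q * (1 - s) := by rw [hqdef]; field_simp
    have hq' : q ≠ 0 := hq.ne'
    rw [hq1]
    push_cast
    field_simp
    ring

lemma isPureBirthTransition_birthProb {r : ℝ} (hr : 0 < r) :
    IsPureBirthTransition (fun n t => (n + r) / (1 - t)) (Ico 0 1) (birthProb r) where
  initial s hs j k := by
    have h1 : (1 - s) / (1 - s) = 1 := div_self (sub_pos.2 hs.2).ne'
    rcases lt_trichotomy k j with h | rfl | h
    · rw [birthProb_of_lt h, if_neg h.ne']
    · have hG : Real.Gamma (k + r) ≠ 0 := (Real.Gamma_pos_of_pos (by positivity)).ne'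
      simp [birthProb, h1, hG]
    · obtain ⟨m, rfl⟩ := Nat.exists_eq_add_of_le h.le
      have hm : m ≠ 0 := by omega
      rw [birthProb_add, h1, if_neg h.ne]
      simp [hm]
  no_down s _ t _ _ j k h := birthProb_of_lt h
  forward_zero s hs t ht _ j := by
    refine HasDerivAt.hasDerivWithinAt ?_
    rcases Nat.eq_zero_or_pos j with rfl | hj
    · exact hasDerivAt_birthProb_self hs.2 ht.2 0
    · simp only [birthProb_of_lt hj, mul_zero, neg_zero]
      exact hasDerivAt_const _ _
  forward_succ s hs t ht _ j k :=
    (hasDerivAt_birthProb_succ hr hs.2 ht.2 j k).hasDerivWithinAt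

lemma isPureDeathTransition_deathProb :
    IsPureDeathTransition (fun n t => n / (t - 1)) (Ioi 1) deathProb where
  initial s hs j k := by
    have h1 : (s - 1) / (s - 1) = 1 := div_self (sub_pos.2 hs).ne'
    rw [deathProb, h1]
    rcases lt_trichotomy j k with h | rfl | h
    · simp [Nat.choose_eq_zero_of_lt h, h.ne]
    · simp
    · have : j - k ≠ 0 := by omega
      simp [this, h.ne']
  no_up s _ t _ _ j k h := by simp [deathProb, Nat.choose_eq_zero_of_lt h]
  forward s hs t ht _ j k := by
    refine HasDerivAt.hasDerivWithinAt ?_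
    have hs1 : 0 < s - 1 := sub_pos.2 hs
    have ht1 : 0 < t - 1 := sub_pos.2 ht
    have hd : HasDerivAt (fun v => (s - 1) / (v - 1)) (-((s - 1) / (t - 1)) / (t - 1)) t := by
      refine ((hasDerivAt_const t (s - 1)).div ((hasDerivAt_id t).sub_const 1)
        ht1.ne').congr_deriv ?_
      simp only [id]
      field_simp
      ring
    have h := ((hd.fun_pow k).const_mul (j.choose k : ℝ)).fun_mul ((hd.const_sub 1).fun_pow (j - k))
    refine h.congr_deriv ?_
    rcases lt_trichotomy j k with hjk | rfl | hjk
    · simp [deathProb, Nat.choose_eq_zero_of_lt hjk,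
        Nat.choose_eq_zero_of_lt (hjk.trans (Nat.lt_succ_self k))]
    · rcases Nat.eq_zero_or_pos j with rfl | hj
      · simp [deathProb]
      · obtain ⟨i, rfl⟩ : ∃ i, j = i + 1 := ⟨j - 1, by omega⟩
        simp [deathProb]
        field_simp
        rw [pow_succ]
        field_simp
    · obtain ⟨m, rfl⟩ := Nat.exists_eq_add_of_le (Nat.succ_le_of_lt hjk)
      have e1 : k.succ + m - k = m + 1 := by omega
      have e2 : k.succ + m - (k + 1) = m := by omega
      have hc : ((k.succ + m).choose (k + 1) : ℝ) * (k + 1) =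
          (k.succ + m).choose k * (m + 1) := by
        have := Nat.choose_succ_right_eq (k.succ + m) k
        rw [e1] at this
        exact_mod_cast this
      have hk1 : (k : ℝ) + 1 ≠ 0 := by positivity
      have hc' := eq_div_of_mul_eq hk1 hc
      rw [deathProb, deathProb, e1, e2, hc']
      set ρ := (s - 1) / (t - 1)
      rcases Nat.eq_zero_or_pos k with rfl | hk
      · simp
        field_simp
      · obtain ⟨i, rfl⟩ : ∃ i, k = i + 1 := ⟨k - 1, by omega⟩
        simp only [Nat.add_sub_cancel]
        push_cast
        field_simp
        ring

/-! ### The model is a joined process -/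

section Existence

lemma pastKernel_singleton {r s t : ℝ} (hr : 0 < r) (hs0 : 0 ≤ s) (hst : s ≤ t) (ht : t < 1)
    (j k : ℕ) : (pastKernel r s t {(k : ℝ)} j).toReal = birthProb r s t j k := by
  have hs1 : s < 1 := hst.trans_lt ht
  have hτs := div_one_sub_nonneg hs0 hs1
  have hτt := div_one_sub_nonneg (hs0.trans hst) ht
  have hle := div_one_sub_le hst ht
  rcases lt_or_ge k j with h | h
  · have hstep : ∀ x, stepProb s t j {(k : ℝ)} x = 0 := fun x => by
      have : {m : ℕ | ((j + m : ℕ) : ℝ) ∈ ({(k : ℝ)} : Set ℝ)} = ∅ := by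
        ext m
        simp only [mem_singleton_iff, Nat.cast_inj, mem_ofPred_eq, mem_empty_iff_false, iff_false]
        omega
      rw [stepProb, if_pos ht, this, measure_empty]
    simp [pastKernel, hstep, birthProb_of_lt h]
  · obtain ⟨m, rfl⟩ := Nat.exists_eq_add_of_le h
    set δ := t / (1 - t) - s / (1 - s) with hδ
    have hδ0 : 0 ≤ δ := sub_nonneg.2 hle
    have hint : ∀ᵐ x ∂(gammaMeasure r 1), ENNReal.ofReal (x ^ j * Real.exp (-(x * (s / (1 - s))))) *
        stepProb s t j {((j + m : ℕ) : ℝ)} x = ENNReal.ofReal (δ ^ m / m.factorial) *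
          ENNReal.ofReal (x ^ (j + m) * Real.exp (-(x * (t / (1 - t))))) := by
      filter_upwards [ae_pos_gammaMeasure r 1] with x hx
      have : {i : ℕ | ((j + i : ℕ) : ℝ) ∈ ({((j + m : ℕ) : ℝ)} : Set ℝ)} = {m} := by
        ext i
        simp only [mem_singleton_iff, Nat.cast_inj, mem_ofPred_eq]
        omega
      rw [stepProb, if_pos ht, this, ← mul_sub, ← hδ,
        poissonMeasure_toNNReal_singleton (mul_nonneg hx.le hδ0),
        ← ENNReal.ofReal_mul (by positivity), ← ENNReal.ofReal_mul (by positivity)]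
      congr 1
      have e : Real.exp (-(x * (t / (1 - t)))) =
          Real.exp (-(x * (s / (1 - s)))) * Real.exp (-(x * δ)) := by
        rw [← Real.exp_add, hδ]
        congr 1
        ring
      rw [e, mul_pow, pow_add]
      ring
    have h1s : 1 + s / (1 - s) = 1 / (1 - s) := by
      have : (1 : ℝ) - s ≠ 0 := (sub_pos.2 hs1).ne'
      field_simp
      ring
    have h1t : 1 + t / (1 - t) = 1 / (1 - t) := by
      have : (1 : ℝ) - t ≠ 0 := (sub_pos.2 ht).ne'
      field_simp
      ring
    have hs' : 0 < 1 - s := sub_pos.2 hs1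
    have ht' : 0 < 1 - t := sub_pos.2 ht
    have hG := Real.Gamma_pos_of_pos hr
    have hGj : 0 < Real.Gamma (r + j) := Real.Gamma_pos_of_pos (by positivity)
    have hGm : 0 < Real.Gamma (r + (j + m : ℕ)) := Real.Gamma_pos_of_pos (by positivity)
    rw [pastKernel, lintegral_congr_ae hint, lintegral_const_mul _ (by fun_prop),
      lintegral_pow_mul_exp_gammaMeasure hr hτt, birthProb_add, h1s, h1t, ENNReal.toReal_div,
      ENNReal.toReal_mul, ENNReal.toReal_ofReal (by positivity),
      ENNReal.toReal_ofReal (by positivity), ENNReal.toReal_ofReal (by positivity)]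
    have e1 : δ = (1 - (1 - t) / (1 - s)) * (1 - t)⁻¹ := by
      rw [hδ]
      field_simp
      ring
    have e2 : (1 / (1 - t)) ^ (r + ((j + m : ℕ) : ℝ)) = ((1 - t) ^ (r + j))⁻¹ * ((1 - t) ^ m)⁻¹ := by
      rw [one_div, Real.inv_rpow ht'.le, Nat.cast_add, ← add_assoc, Real.rpow_add ht',
        Real.rpow_natCast, mul_inv]
    have e3 : ((1 - t) / (1 - s)) ^ (j + r) = (1 - t) ^ (r + j) * ((1 - s) ^ (r + j))⁻¹ := by
      rw [Real.div_rpow ht'.le hs'.le, div_eq_mul_inv, add_comm (j : ℝ)]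
    have e4 : (j : ℝ) + m + r = r + (j + m : ℕ) := by push_cast; ring
    have hp1 := (Real.rpow_pos_of_pos hs' (r + j)).ne'
    have hp2 := (Real.rpow_pos_of_pos ht' (r + j)).ne'
    rw [e1, e2, e3, e4, one_div, Real.inv_rpow hs'.le, mul_pow, add_comm (j : ℝ) r]
    field_simp
    rw [mul_assoc, ← mul_pow, one_div_mul_cancel ht'.ne', one_pow, mul_one]

variable {Ω : Type*} [MeasurableSpace Ω] {P : Measure Ω} {N : ℝ → Ω → ℕ}

lemma modelMeasure_ae_pos [IsProbabilityMeasure P] {r : ℝ} (hr : 0 < r) :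
    ∀ᵐ p ∂(modelMeasure r P), 0 < p.1 := by
  have := isProbabilityMeasure_gammaMeasure hr one_pos
  exact Measure.quasiMeasurePreserving_fst.ae (ae_pos_gammaMeasure r 1)

lemma modelMeasure_ae_fst_snd [IsProbabilityMeasure P] {r : ℝ} (hr : 0 < r) {p : Ω → Prop}
    (hp : ∀ᵐ ω ∂P, p ω) : ∀ᵐ q ∂(modelMeasure r P), p q.2.1 := by
  have := isProbabilityMeasure_gammaMeasure hr one_pos
  exact Measure.quasiMeasurePreserving_snd.ae (Measure.quasiMeasurePreserving_fst.ae hp)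

lemma tendsto_modelZ_one [IsProbabilityMeasure P] (hN : IsPoissonProcess P N) {r : ℝ}
    (hr : 0 < r) : ∀ᵐ p ∂(modelMeasure r P),
      Tendsto (fun t => (1 - t) * modelZ N t p) (𝓝[<] 1) (𝓝 (modelZ N 1 p)) := by
  filter_upwards [modelMeasure_ae_pos (P := P) hr, modelMeasure_ae_fst_snd hr hN.tendsto_div]
    with p hp hlim
  have h1 : Tendsto (fun t : ℝ => 1 - t) (𝓝[<] 1) (𝓝[>] 0) := by
    refine tendsto_nhdsWithin_iff.2 ⟨?_, ?_⟩
    · exact (Continuous.tendsto' (by fun_prop) 1 0 (by simp)).mono_left nhdsWithin_le_nhds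
    · filter_upwards [self_mem_nhdsWithin] with t ht using sub_pos.2 (mem_Iio.1 ht)
  have h2 : Tendsto (fun t : ℝ => t) (𝓝[<] 1) (𝓝 1) :=
    tendsto_id.mono_left nhdsWithin_le_nhds
  have h3 : Tendsto (fun t : ℝ => p.1 * (t / (1 - t))) (𝓝[<] 1) atTop := by
    simp only [div_eq_mul_inv]
    exact ((h2.pos_mul_atTop one_pos (tendsto_inv_nhdsGT_zero.comp h1))).const_mul_atTop hp
  have h4 : Tendsto (fun t : ℝ => (N (p.1 * (t / (1 - t))) p.2.1 : ℝ) / (p.1 * (t / (1 - t))) *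
      (p.1 * t)) (𝓝[<] 1) (𝓝 (modelZ N 1 p)) := by
    rw [modelZ_one]
    simpa using (hlim.comp h3).mul (h2.const_mul p.1)
  refine h4.congr' ?_
  filter_upwards [Ioo_mem_nhdsLT (zero_lt_one (α := ℝ))] with t ht
  have ht1 : 0 < 1 - t := sub_pos.2 ht.2
  have ht0 := ht.1
  rw [modelZ_of_lt ht.2]
  field_simp

/-- The mixed Poisson model is a joined process. -/
theorem isJoinedProcess_modelZ [IsProbabilityMeasure P] (hN : IsPoissonProcess P N) {θ : ℝ}
    (hθ : 0 < θ) : IsJoinedProcess (modelMeasure (1 / θ ^ 2) P) θ (modelZ N) := by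
  set r := 1 / θ ^ 2 with hrdef
  have hr : 0 < r := by positivity
  have hprob := isProbabilityMeasure_modelMeasure (P := P) hr
  have hm := measurable_modelZ hN
  have hle : ∀ S : Set ℝ, sigmaOn (modelZ N) S ≤ (inferInstance : MeasurableSpace (ℝ × Ω × Ω)) :=
    fun S => sigmaOn_le fun t _ => hm t
  -- a conditional probability that is a function of the present is unchanged on a smaller past
  have hdown : ∀ (s : ℝ) (S S' : Set ℝ) (f : ℝ × Ω × Ω → ℝ) (κ : ℕ → ℝ), s ∈ S' → S' ⊆ S →
      ((modelMeasure r P)[f | sigmaOn (modelZ N) S] =ᵐ[modelMeasure r P]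
        fun p => κ ⌊modelZ N s p⌋₊) →
      (modelMeasure r P)[f | sigmaOn (modelZ N) S'] =ᵐ[modelMeasure r P]
        fun p => κ ⌊modelZ N s p⌋₊ := by
    intro s S S' f κ hs hS h
    have hκ : Measurable[sigmaOn (modelZ N) S'] fun p => κ ⌊modelZ N s p⌋₊ :=
      (measurable_from_nat (f := κ)).comp (Nat.measurable_floor.comp (measurable_sigmaOn hs))
    exact condExp_eq_of_condExp_eq (sigmaOn_mono hS) (hle _)
      hκ.stronglyMeasurable.aestronglyMeasurable h
  have hg : Measurable fun p : ℝ × Ω => (N p.1 p.2 : ℝ) :=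
    measurable_from_nat.comp hN.measurable_uncurry
  -- conditional laws given the past up to time `1` are functions of the value at time `1`
  have hone : ∀ t, 1 < t → ∀ A : Set ℝ, MeasurableSet A →
      (modelMeasure r P)⟦modelZ N t ⁻¹' A | sigmaOn (modelZ N) {1}⟧ =ᵐ[modelMeasure r P]
        fun p => (P (N (modelZ N 1 p * (1 / (t - 1))) ⁻¹' (Nat.cast ⁻¹' A))).toReal := by
    intro t ht A hA
    have hsub : ({1} : Set ℝ) ⊆ Icc 0 1 := by simp
    refine condExp_eq_of_condExp_eq (sigmaOn_mono hsub) (hle _) ?_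
      (model_condExp_one hN hr ht hA)
    refine Measurable.aestronglyMeasurable ?_
    have : MeasurableSet {q : ℝ × Ω | (N (q.1 * (1 / (t - 1))) q.2 : ℝ) ∈ A} :=
      (hg.comp ((measurable_fst.mul_const _).prodMk measurable_snd)) hA
    have hgm : Measurable fun x : ℝ => P (N (x * (1 / (t - 1))) ⁻¹' (Nat.cast ⁻¹' A)) :=
      measurable_measure_prodMk_left this
    have hZ : Measurable[sigmaOn (modelZ N) {1}] (modelZ N 1) :=
      measurable_sigmaOn (mem_singleton 1)
    exact (hgm.comp hZ).ennreal_toReal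
  refine ⟨fun t _ => hm t, ?_, ?_, ?_, tendsto_modelZ_one hN hr, ?_, ?_⟩
  · intro s hs t _ hst A hA
    rw [Ici_inter_Iic]
    have hsub : ({s} : Set ℝ) ⊆ Icc 0 s := by simpa using hs
    rcases lt_trichotomy s 1 with h1 | rfl | h1
    · have h := model_condExp_past hN hr hs h1 hst hA
      exact h.trans (hdown s _ _ _ (fun n => (pastKernel r s t A n).toReal) (mem_singleton s)
        hsub h).symm
    · rcases hst.lt_or_eq with ht | rfl
      · exact (model_condExp_one hN hr ht hA).trans (hone t ht A hA).symm
      · have : ∀ S : Set ℝ, 1 ∈ S →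
            (modelMeasure r P)⟦modelZ N 1 ⁻¹' A | sigmaOn (modelZ N) S⟧ =
              (modelZ N 1 ⁻¹' A).indicator fun _ => 1 := fun S hS =>
          condExp_of_stronglyMeasurable (hle S)
            (stronglyMeasurable_const.indicator (measurable_sigmaOn hS hA))
            ((integrable_const 1).indicator (hm 1 hA))
        rw [this _ (by simp), this _ (by simp)]
    · have h := model_condExp_future hN hr h1 hst hA
      exact h.trans (hdown s _ _ _ (fun n => (∑' k : ℕ, A.indicator (fun _ =>
        ENNReal.ofReal (n.choose k * ((s - 1) / (t - 1)) ^ k *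
          (1 - (s - 1) / (t - 1)) ^ (n - k))) (k : ℝ)).toReal) (mem_singleton s) hsub h).symm
  · refine Eventually.of_forall fun p => ?_
    simp [modelZ_of_lt (zero_lt_one (α := ℝ)), hN.zero]
  · refine ⟨birthProb r, isPureBirthTransition_birthProb hr,
      fun t ht p => exists_nat_modelZ ht.2.ne p, fun s hs t ht hst k => ?_⟩
    have : Ico (0 : ℝ) 1 ∩ Iic s = Icc 0 s := by
      ext v
      simp only [mem_inter_iff, mem_Ico, mem_Iic, mem_Icc]
      exact ⟨fun h => ⟨h.1.1, h.2⟩, fun h => ⟨⟨h.1, h.2.trans_lt hs.2⟩, h.2⟩⟩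
    rw [this]
    refine (model_condExp_past hN hr hs.1 hs.2 hst (measurableSet_singleton _)).trans
      (Eventually.of_forall fun p => ?_)
    exact pastKernel_singleton hr hs.1 hst ht.2 _ k
  · intro t ht k
    filter_upwards [hone t ht _ (measurableSet_singleton _), modelMeasure_ae_pos (P := P) hr]
      with p hp hpos
    have hcast : (Nat.cast ⁻¹' {(k : ℝ)} : Set ℕ) = {k} := by ext; simp
    have hnn : 0 ≤ p.1 * (1 / (t - 1)) := by
      have := sub_pos.2 ht
      positivity
    rw [hp, hcast, modelZ_one, hN.measure_eq hnn, poissonMeasure_toNNReal_singleton hnn,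
      ENNReal.toReal_ofReal (by positivity), mul_one_div]
  · refine ⟨deathProb, isPureDeathTransition_deathProb,
      fun t ht p => exists_nat_modelZ (mem_Ioi.1 ht).ne' p, fun s hs t ht hst k => ?_⟩
    have hs1 : 1 < s := hs
    have hs0 : 0 < s - 1 := sub_pos.2 hs
    have ht0 : 0 < t - 1 := sub_pos.2 ht
    have h := model_condExp_future hN hr hs1 hst (measurableSet_singleton (k : ℝ))
    have hval : ∀ n : ℕ, (∑' i : ℕ, ({(k : ℝ)} : Set ℝ).indicator (fun _ =>
        ENNReal.ofReal (n.choose i * ((s - 1) / (t - 1)) ^ i *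
          (1 - (s - 1) / (t - 1)) ^ (n - i))) (i : ℝ)).toReal = deathProb s t n k := by
      intro n
      have hρ : (s - 1) / (t - 1) ≤ 1 := (div_le_one ht0).2 (by linarith)
      rw [tsum_eq_single k]
      · rw [indicator_of_mem (mem_singleton _), ENNReal.toReal_ofReal]
        · rfl
        · have := sub_nonneg.2 hρ
          positivity
      · intro i hi
        exact indicator_of_notMem (by simpa using hi) _
    simp only [hval] at h
    exact hdown s (Icc 0 s) (Ioi 1 ∩ Iic s) _ (fun n => deathProb s t n k) ⟨hs, mem_Iic.2 le_rfl⟩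
      (fun v hv => ⟨zero_le_one.trans (mem_Ioi.1 hv.1).le, hv.2⟩) h

end Existence

/-! ### Uniqueness of the finite-dimensional laws -/

section Uniqueness

/-- Two solutions of the scalar linear equation `f' = b - c f` with the same initial value agree. -/
lemma eq_of_hasDerivWithinAt_linear {f g b c : ℝ → ℝ} {s t : ℝ} (hc : ContinuousOn c (Icc s t))
    (hf : ∀ v ∈ Icc s t, HasDerivWithinAt f (b v - c v * f v) (Ici s) v)
    (hg : ∀ v ∈ Icc s t, HasDerivWithinAt g (b v - c v * g v) (Ici s) v)
    (h : f s = g s) : ∀ v ∈ Icc s t, f v = g v := by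
  obtain ⟨K, hK⟩ := isCompact_Icc.exists_bound_of_continuousOn hc
  have hd : ∀ v ∈ Icc s t, HasDerivWithinAt (fun v => f v - g v)
      (b v - c v * f v - (b v - c v * g v)) (Ici s) v := fun v hv => (hf v hv).fun_sub (hg v hv)
  have := eq_zero_of_abs_deriv_le_mul_abs_self_of_eq_zero_right (f := fun v => f v - g v)
    (f' := fun v => b v - c v * f v - (b v - c v * g v)) (K := K) (a := s) (b := t)
    (fun v hv => ((hd v hv).continuousWithinAt).mono Icc_subset_Ici_self)
    (fun v hv => (hd v (Ico_subset_Icc_self hv)).mono (Ici_subset_Ici.2 hv.1))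
    (sub_eq_zero.2 h) (fun v hv => by
      have e : b v - c v * f v - (b v - c v * g v) = -(c v * (f v - g v)) := by ring
      rw [e, norm_neg, norm_mul]
      exact mul_le_mul_of_nonneg_right (hK v (Ico_subset_Icc_self hv)) (norm_nonneg _))
  exact fun v hv => sub_eq_zero.1 (this v hv)

/-- The forward equations of a pure birth process are solved by recursion on the target state. -/
lemma IsPureBirthTransition.unique {rate : ℕ → ℝ → ℝ} {I : Set ℝ} [hI : I.OrdConnected]
    {p p' : ℝ → ℝ → ℕ → ℕ → ℝ} (hrate : ∀ n, ContinuousOn (rate n) I)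
    (h : IsPureBirthTransition rate I p) (h' : IsPureBirthTransition rate I p') {s t : ℝ}
    (hs : s ∈ I) (ht : t ∈ I) (hst : s ≤ t) (j k : ℕ) : p s t j k = p' s t j k := by
  have hsub : Icc s t ⊆ I := hI.out hs ht
  suffices ∀ v ∈ Icc s t, p s v j k = p' s v j k from this t (right_mem_Icc.2 hst)
  induction k with
  | zero =>
    refine eq_of_hasDerivWithinAt_linear (b := fun _ => 0) ((hrate 0).mono hsub)
      (fun v hv => ?_) (fun v hv => ?_) (by rw [h.initial s hs, h'.initial s hs])
    · simpa using h.forward_zero s hs v (hsub hv) hv.1 j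
    · simpa using h'.forward_zero s hs v (hsub hv) hv.1 j
  | succ k ih =>
    refine eq_of_hasDerivWithinAt_linear (b := fun v => rate k v * p s v j k)
      ((hrate (k + 1)).mono hsub) (fun v hv => ?_) (fun v hv => ?_)
      (by rw [h.initial s hs, h'.initial s hs])
    · exact h.forward_succ s hs v (hsub hv) hv.1 j k
    · rw [ih v hv]
      exact h'.forward_succ s hs v (hsub hv) hv.1 j k

/-- The forward equations of a pure death process are solved by downward recursion on the target state,
starting above the initial state, where the transition probabilities vanish. -/
lemma IsPureDeathTransition.unique {rate : ℕ → ℝ → ℝ} {I : Set ℝ} [hI : I.OrdConnected]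
    {p p' : ℝ → ℝ → ℕ → ℕ → ℝ} (hrate : ∀ n, ContinuousOn (rate n) I)
    (h : IsPureDeathTransition rate I p) (h' : IsPureDeathTransition rate I p') {s t : ℝ}
    (hs : s ∈ I) (ht : t ∈ I) (hst : s ≤ t) (j k : ℕ) : p s t j k = p' s t j k := by
  have hsub : Icc s t ⊆ I := hI.out hs ht
  suffices ∀ m k : ℕ, j + 1 = k + m ∨ j < k → ∀ v ∈ Icc s t, p s v j k = p' s v j k from by
    rcases le_or_gt k j with hk | hk
    · exact this (j + 1 - k) k (Or.inl (by omega)) t (right_mem_Icc.2 hst)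
    · exact this 0 k (Or.inr hk) t (right_mem_Icc.2 hst)
  intro m
  induction m with
  | zero =>
    intro k hk v hv
    have hjk : j < k := by omega
    rw [h.no_up s hs v (hsub hv) hv.1 j k hjk, h'.no_up s hs v (hsub hv) hv.1 j k hjk]
  | succ m ih =>
    intro k hk
    refine eq_of_hasDerivWithinAt_linear (b := fun v => rate (k + 1) v * p s v j (k + 1))
      ((hrate k).mono hsub) (fun v hv => ?_) (fun v hv => ?_)
      (by rw [h.initial s hs, h'.initial s hs])
    · exact h.forward s hs v (hsub hv) hv.1 j k
    · rw [ih (k + 1) (by omega) v hv]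
      exact h'.forward s hs v (hsub hv) hv.1 j k

lemma measure_inter_preimage_eq_tsum {Ω : Type*} [MeasurableSpace Ω] (P : Measure Ω) {Z W : Ω → ℝ}
    (hZ : Measurable Z) (hW : Measurable W) (hn : ∀ ω, ∃ n : ℕ, W ω = n) {A : Set ℝ} (C : Set ℝ)
    (hA : MeasurableSet A) : P (Z ⁻¹' A ∩ W ⁻¹' C) =
      ∑' k : ℕ, C.indicator (fun _ => P (Z ⁻¹' A ∩ W ⁻¹' {(k : ℝ)})) (k : ℝ) := by
  have e : Z ⁻¹' A ∩ W ⁻¹' C =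
      ⋃ k : ℕ, ⋃ _ : (k : ℝ) ∈ C, Z ⁻¹' A ∩ W ⁻¹' {(k : ℝ)} := by
    ext ω
    simp only [mem_inter_iff, mem_preimage, mem_iUnion, mem_singleton_iff, exists_prop]
    constructor
    · rintro ⟨h1, h2⟩
      obtain ⟨k, hk⟩ := hn ω
      exact ⟨k, hk ▸ h2, h1, hk⟩
    · rintro ⟨k, h1, h2, h3⟩
      exact ⟨h2, h3 ▸ h1⟩
  rw [e, measure_iUnion]
  · refine tsum_congr fun k => ?_
    by_cases hk : (k : ℝ) ∈ C <;> simp [hk]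
  · intro i j hij
    refine Set.disjoint_left.2 fun ω h1 h2 => hij ?_
    simp only [mem_inter_iff, mem_preimage, mem_iUnion, mem_singleton_iff, exists_prop] at h1 h2
    exact_mod_cast h1.2.2.symm.trans h2.2.2
  · exact fun k => MeasurableSet.iUnion fun _ => (hZ hA).inter (hW (measurableSet_singleton _))

variable {Ω Ω' : Type*} [mΩ : MeasurableSpace Ω] [mΩ' : MeasurableSpace Ω'] {P : Measure Ω}
  {P' : Measure Ω'}

lemma map_snd_eq_of_map_pair {Z W : Ω → ℝ} {Z' W' : Ω' → ℝ} (hZ : Measurable Z)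
    (hW : Measurable W) (hZ' : Measurable Z') (hW' : Measurable W')
    (h : P.map (fun ω => (Z ω, W ω)) = P'.map (fun ω => (Z' ω, W' ω))) : P.map W = P'.map W' := by
  have := congrArg (Measure.map Prod.snd) h
  rwa [Measure.map_map measurable_snd (hZ.prodMk hW),
    Measure.map_map measurable_snd (hZ'.prodMk hW')] at this

lemma map_fst_eq_of_map_pair {Z W : Ω → ℝ} {Z' W' : Ω' → ℝ} (hZ : Measurable Z)
    (hW : Measurable W) (hZ' : Measurable Z') (hW' : Measurable W')
    (h : P.map (fun ω => (Z ω, W ω)) = P'.map (fun ω => (Z' ω, W' ω))) : P.map Z = P'.map Z' := by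
  have := congrArg (Measure.map Prod.fst) h
  rwa [Measure.map_map measurable_fst (hZ.prodMk hW),
    Measure.map_map measurable_fst (hZ'.prodMk hW')] at this

lemma map_outer_eq_of_map_triple {U V W : Ω → ℝ} {U' V' W' : Ω' → ℝ} (hU : Measurable U)
    (hV : Measurable V) (hW : Measurable W) (hU' : Measurable U') (hV' : Measurable V')
    (hW' : Measurable W')
    (h : P.map (fun ω => (U ω, V ω, W ω)) = P'.map (fun ω => (U' ω, V' ω, W' ω))) :
    P.map (fun ω => (U ω, W ω)) = P'.map (fun ω => (U' ω, W' ω)) := by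
  have hf : Measurable fun x : ℝ × ℝ × ℝ => (x.1, x.2.2) := by fun_prop
  have := congrArg (Measure.map fun x : ℝ × ℝ × ℝ => (x.1, x.2.2)) h
  rwa [Measure.map_map hf (hU.prodMk (hV.prodMk hW)),
    Measure.map_map hf (hU'.prodMk (hV'.prodMk hW'))] at this

lemma map_pair_self {W : Ω → ℝ} {W' : Ω' → ℝ} (hW : Measurable W) (hW' : Measurable W')
    (h : P.map W = P'.map W') :
    P.map (fun ω => (W ω, W ω)) = P'.map (fun ω => (W' ω, W' ω)) := by
  have hf : Measurable fun x : ℝ => (x, x) := by fun_prop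
  have := congrArg (Measure.map fun x : ℝ => (x, x)) h
  rwa [Measure.map_map hf hW, Measure.map_map hf hW'] at this

variable [IsProbabilityMeasure P] [IsProbabilityMeasure P'] {Y : ℝ → Ω → ℝ} {Y' : ℝ → Ω' → ℝ}

lemma measure_inter_eq_ofReal_setIntegral {s : ℝ} {S : Set ℝ} (hS : sigmaOn Y S ≤ mΩ)
    (hs : s ∈ S) {A : Set ℝ} (hA : MeasurableSet A) {E : Set Ω}
    (hE : MeasurableSet E) {g : ℝ → ℝ} (hg : Measurable g)
    (h : P⟦E | sigmaOn Y S⟧ =ᵐ[P] fun ω => g (Y s ω)) :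
    P (Y s ⁻¹' A ∩ E) = ENNReal.ofReal (∫ x in A, g x ∂(P.map (Y s))) := by
  have hYm : Measurable[sigmaOn Y S] (Y s) := measurable_sigmaOn hs
  have hY : Measurable (Y s) := hYm.mono hS le_rfl
  rw [setIntegral_map hA hg.aestronglyMeasurable hY.aemeasurable,
    ← setIntegral_congr_ae (hY hA) (h.mono fun ω hω _ => hω),
    setIntegral_condExp hS ((integrable_const 1).indicator hE) (hYm hA),
    setIntegral_indicator hE]
  simp

/-- If two processes have the same law at time `s` and the same conditional probabilities of the
events `Y t = k`, `k ∈ ℕ`, given the value at time `s`, then they have the same joint law at times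
`s` and `t`. -/
lemma map_pair_eq_of_condExp {s t : ℝ} {S : Set ℝ} (hS : sigmaOn Y S ≤ mΩ)
    (hS' : sigmaOn Y' S ≤ mΩ') (hs : s ∈ S)
    (ht : Measurable (Y t)) (ht' : Measurable (Y' t)) (hn : ∀ ω, ∃ n : ℕ, Y t ω = n)
    (hn' : ∀ ω, ∃ n : ℕ, Y' t ω = n) (hlaw : P.map (Y s) = P'.map (Y' s)) (g : ℕ → ℝ → ℝ)
    (hg : ∀ k, Measurable (g k))
    (h : ∀ k : ℕ, P⟦Y t ⁻¹' {(k : ℝ)} | sigmaOn Y S⟧ =ᵐ[P] fun ω => g k (Y s ω))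
    (h' : ∀ k : ℕ, P'⟦Y' t ⁻¹' {(k : ℝ)} | sigmaOn Y' S⟧ =ᵐ[P'] fun ω => g k (Y' s ω)) :
    P.map (fun ω => (Y s ω, Y t ω)) = P'.map (fun ω => (Y' s ω, Y' t ω)) := by
  have hY : Measurable (Y s) := (measurable_sigmaOn hs).mono hS le_rfl
  have hY' : Measurable (Y' s) := (measurable_sigmaOn hs).mono hS' le_rfl
  have : IsProbabilityMeasure (P.map fun ω => (Y s ω, Y t ω)) :=
    Measure.isProbabilityMeasure_map (hY.prodMk ht).aemeasurable
  refine Measure.ext_prod fun {A C} hA hC => ?_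
  rw [Measure.map_apply (hY.prodMk ht) (hA.prod hC),
    Measure.map_apply (hY'.prodMk ht') (hA.prod hC), mk_preimage_prod, mk_preimage_prod,
    measure_inter_preimage_eq_tsum P hY ht hn C hA,
    measure_inter_preimage_eq_tsum P' hY' ht' hn' C hA]
  refine tsum_congr fun k => ?_
  congr 1
  funext _
  rw [measure_inter_eq_ofReal_setIntegral hS hs hA (ht (measurableSet_singleton _)) (hg k) (h k),
    measure_inter_eq_ofReal_setIntegral hS' hs hA (ht' (measurableSet_singleton _)) (hg k) (h' k),
    hlaw]

lemma IsMarkovOn.measure_inter_eq (hM : IsMarkovOn P (Ici 0) Y)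
    (hY : ∀ t, 0 ≤ t → Measurable (Y t)) {s t u : ℝ} (hs : 0 ≤ s) (hst : s ≤ t) (htu : t ≤ u)
    {A B C : Set ℝ} {g : ℝ → ℝ} (hA : MeasurableSet A) (hB : MeasurableSet B)
    (hC : MeasurableSet C) (hg : Measurable g)
    (hgP : P⟦Y u ⁻¹' C | sigmaOn Y {t}⟧ =ᵐ[P] fun ω => g (Y t ω)) :
    P (Y s ⁻¹' A ∩ (Y t ⁻¹' B ∩ Y u ⁻¹' C)) =
      ENNReal.ofReal (∫ x in A ×ˢ B, g x.2 ∂(P.map (fun ω => (Y s ω, Y t ω)))) := by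
  have ht : 0 ≤ t := hs.trans hst
  have hu : 0 ≤ u := ht.trans htu
  have h := (hM t ht u hu htu C hC).trans hgP
  have hle : sigmaOn Y (Ici 0 ∩ Iic t) ≤ mΩ := sigmaOn_Ici_inter_le hY inter_subset_left
  have hms : MeasurableSet[sigmaOn Y (Ici 0 ∩ Iic t)] (Y s ⁻¹' A ∩ Y t ⁻¹' B) :=
    MeasurableSet.inter (measurable_sigmaOn (show s ∈ Ici 0 ∩ Iic t from ⟨hs, hst⟩) hA)
      (measurable_sigmaOn (show t ∈ Ici 0 ∩ Iic t from ⟨ht, mem_Iic.2 le_rfl⟩) hB)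
  have hgm : Measurable fun x : ℝ × ℝ => g x.2 := hg.comp measurable_snd
  rw [setIntegral_map (hA.prod hB) hgm.aestronglyMeasurable
    ((hY s hs).prodMk (hY t ht)).aemeasurable, mk_preimage_prod,
    ← setIntegral_congr_ae (hle _ hms) (h.mono fun ω hω _ => hω),
    setIntegral_condExp hle ((integrable_const 1).indicator (hY u hu hC)) hms,
    setIntegral_indicator (hY u hu hC), inter_assoc]
  simp

/-- For Markov processes, the two-dimensional laws at times `(s, t)` and `(t, u)` determine the
three-dimensional law at times `(s, t, u)`. -/
lemma IsMarkovOn.map_triple_eq (hM : IsMarkovOn P (Ici 0) Y) (hM' : IsMarkovOn P' (Ici 0) Y')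
    (hY : ∀ t, 0 ≤ t → Measurable (Y t)) (hY' : ∀ t, 0 ≤ t → Measurable (Y' t)) {s t u : ℝ}
    (hs : 0 ≤ s) (hst : s ≤ t) (htu : t ≤ u)
    (h₁ : P.map (fun ω => (Y s ω, Y t ω)) = P'.map (fun ω => (Y' s ω, Y' t ω)))
    (h₂ : P.map (fun ω => (Y t ω, Y u ω)) = P'.map (fun ω => (Y' t ω, Y' u ω))) :
    P.map (fun ω => (Y s ω, Y t ω, Y u ω)) = P'.map (fun ω => (Y' s ω, Y' t ω, Y' u ω)) := by
  have ht : 0 ≤ t := hs.trans hst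
  have hu : 0 ≤ u := ht.trans htu
  have hYs := hY s hs
  have hYt := hY t ht
  have hYu := hY u hu
  have hYs' := hY' s hs
  have hYt' := hY' t ht
  have hYu' := hY' u hu
  have hlaw := map_fst_eq_of_map_pair hYt hYu hYt' hYu' h₂
  -- a common version of the conditional probabilities given the middle time
  have hcommon : ∀ C : Set ℝ, MeasurableSet C → ∃ g : ℝ → ℝ, Measurable g ∧ (∀ x, |g x| ≤ 1) ∧
      (P⟦Y u ⁻¹' C | sigmaOn Y {t}⟧ =ᵐ[P] fun ω => g (Y t ω)) ∧
      (P'⟦Y' u ⁻¹' C | sigmaOn Y' {t}⟧ =ᵐ[P'] fun ω => g (Y' t ω)) := by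
    intro C hC
    obtain ⟨g, hg, hg1, hgP⟩ := exists_condExp_eq_comp (P := P) (Y := Y) t (hYu hC)
    refine ⟨g, hg, hg1, hgP, ?_⟩
    have hle : sigmaOn Y {t} ≤ mΩ := sigmaOn_le fun v hv => by rw [mem_singleton_iff.1 hv]; exact hYt
    have hle' : sigmaOn Y' {t} ≤ mΩ' :=
      sigmaOn_le fun v hv => by rw [mem_singleton_iff.1 hv]; exact hYt'
    have hYtm : Measurable[sigmaOn Y' {t}] (Y' t) := measurable_sigmaOn (mem_singleton t)
    have hgi : Integrable (fun ω => g (Y' t ω)) P' :=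
      Integrable.of_bound (hg.comp hYt').aestronglyMeasurable 1 (Eventually.of_forall fun ω => hg1 _)
    refine (ae_eq_condExp_of_forall_setIntegral_eq hle' ((integrable_const 1).indicator (hYu' hC))
      (fun _ _ _ => hgi.integrableOn) (fun S hS _ => ?_)
      (hg.comp hYtm).aestronglyMeasurable).symm
    rw [sigmaOn_singleton] at hS
    obtain ⟨B, hB, rfl⟩ := hS
    have e1 : ∫ ω in Y' t ⁻¹' B, g (Y' t ω) ∂P' = ∫ x in B, g x ∂(P.map (Y t)) := by
      rw [hlaw, setIntegral_map hB hg.aestronglyMeasurable hYt'.aemeasurable]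
    have e2 : ∫ x in B, g x ∂(P.map (Y t)) = P.real (Y t ⁻¹' B ∩ Y u ⁻¹' C) := by
      rw [setIntegral_map hB hg.aestronglyMeasurable hYt.aemeasurable,
        ← setIntegral_congr_ae (hYt hB) (hgP.mono fun ω hω _ => hω),
        setIntegral_condExp hle ((integrable_const 1).indicator (hYu hC))
          ((measurable_sigmaOn (mem_singleton t)) hB), setIntegral_indicator (hYu hC)]
      simp
    have e3 : P (Y t ⁻¹' B ∩ Y u ⁻¹' C) = P' (Y' t ⁻¹' B ∩ Y' u ⁻¹' C) := by
      have := congrArg (fun μ => μ (B ×ˢ C)) h₂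
      rwa [Measure.map_apply (hYt.prodMk hYu) (hB.prod hC),
        Measure.map_apply (hYt'.prodMk hYu') (hB.prod hC), mk_preimage_prod,
        mk_preimage_prod] at this
    rw [e1, e2, setIntegral_indicator (hYu' hC), Measure.real, e3]
    simp [Measure.real]
  have : IsProbabilityMeasure (P.map fun ω => (Y s ω, Y t ω, Y u ω)) :=
    Measure.isProbabilityMeasure_map (hYs.prodMk (hYt.prodMk hYu)).aemeasurable
  refine Measure.ext_prod₃ fun {A B C} hA hB hC => ?_
  obtain ⟨g, hg, _, hgP, hgP'⟩ := hcommon C hC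
  rw [Measure.map_apply (hYs.prodMk (hYt.prodMk hYu)) (hA.prod (hB.prod hC)),
    Measure.map_apply (hYs'.prodMk (hYt'.prodMk hYu')) (hA.prod (hB.prod hC)),
    mk_preimage_prod, mk_preimage_prod, mk_preimage_prod, mk_preimage_prod,
    hM.measure_inter_eq hY hs hst htu hA hB hC hg hgP,
    hM'.measure_inter_eq hY' hs hst htu hA hB hC hg hgP', h₁]

section Joined

variable {θ : ℝ} {Z : ℝ → Ω → ℝ} {Z' : ℝ → Ω' → ℝ}

lemma IsJoinedProcess.map_pair_eq_birth (hZ : IsJoinedProcess P θ Z)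
    (hZ' : IsJoinedProcess P' θ Z') {s t : ℝ} (hs : 0 ≤ s) (hst : s ≤ t) (ht : t < 1)
    (hlaw : P.map (Z s) = P'.map (Z' s)) :
    P.map (fun ω => (Z s ω, Z t ω)) = P'.map (fun ω => (Z' s ω, Z' t ω)) := by
  obtain ⟨p, hp, hpn, hpt⟩ := hZ.birth
  obtain ⟨p', hp', hpn', hpt'⟩ := hZ'.birth
  have hsI : s ∈ Ico (0 : ℝ) 1 := ⟨hs, hst.trans_lt ht⟩
  have htI : t ∈ Ico (0 : ℝ) 1 := ⟨hs.trans hst, ht⟩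
  have hrate : ∀ n : ℕ, ContinuousOn (fun t : ℝ => (n + 1 / θ ^ 2) / (1 - t)) (Ico 0 1) :=
    fun n => continuousOn_const.div (by fun_prop) fun t ht => (sub_pos.2 ht.2).ne'
  have hsub : Ico (0 : ℝ) 1 ∩ Iic s ⊆ Ici 0 := fun v hv => hv.1.1
  have hsing : s ∈ Ico (0 : ℝ) 1 ∩ Iic s := ⟨hsI, mem_Iic.2 le_rfl⟩
  refine map_pair_eq_of_condExp (sigmaOn_Ici_inter_le hZ.measurable hsub)
    (sigmaOn_Ici_inter_le hZ'.measurable hsub) hsing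
    (hZ.measurable t htI.1) (hZ'.measurable t htI.1) (hpn t htI) (hpn' t htI) hlaw
    (fun k x => p s t ⌊x⌋₊ k) (fun k => (measurable_from_nat (f := fun n => p s t n k)).comp
      Nat.measurable_floor) (hpt s hsI t htI hst) fun k => ?_
  simp only [hp.unique hrate hp' hsI htI hst]
  exact hpt' s hsI t htI hst k

lemma IsJoinedProcess.map_pair_eq_death (hZ : IsJoinedProcess P θ Z)
    (hZ' : IsJoinedProcess P' θ Z') {s t : ℝ} (hs : 1 < s) (hst : s ≤ t)
    (hlaw : P.map (Z s) = P'.map (Z' s)) :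
    P.map (fun ω => (Z s ω, Z t ω)) = P'.map (fun ω => (Z' s ω, Z' t ω)) := by
  obtain ⟨p, hp, hpn, hpt⟩ := hZ.death
  obtain ⟨p', hp', hpn', hpt'⟩ := hZ'.death
  have hsI : s ∈ Ioi (1 : ℝ) := hs
  have htI : t ∈ Ioi (1 : ℝ) := hs.trans_le hst
  have ht0 : 0 ≤ t := zero_le_one.trans (mem_Ioi.1 htI).le
  have hrate : ∀ n : ℕ, ContinuousOn (fun t : ℝ => (n : ℝ) / (t - 1)) (Ioi 1) :=
    fun n => continuousOn_const.div (by fun_prop) fun t ht => (sub_pos.2 (mem_Ioi.1 ht)).ne'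
  have hsub : Ioi (1 : ℝ) ∩ Iic s ⊆ Ici 0 := fun v hv => zero_le_one.trans (mem_Ioi.1 hv.1).le
  have hsing : s ∈ Ioi (1 : ℝ) ∩ Iic s := ⟨hsI, mem_Iic.2 le_rfl⟩
  refine map_pair_eq_of_condExp (sigmaOn_Ici_inter_le hZ.measurable hsub)
    (sigmaOn_Ici_inter_le hZ'.measurable hsub) hsing
    (hZ.measurable t ht0) (hZ'.measurable t ht0) (hpn t htI) (hpn' t htI) hlaw
    (fun k x => p s t ⌊x⌋₊ k) (fun k => (measurable_from_nat (f := fun n => p s t n k)).comp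
      Nat.measurable_floor) (hpt s hsI t htI hst) fun k => ?_
  simp only [hp.unique hrate hp' hsI htI hst]
  exact hpt' s hsI t htI hst k

lemma IsJoinedProcess.map_eq_of_lt_one (hZ : IsJoinedProcess P θ Z)
    (hZ' : IsJoinedProcess P' θ Z') {t : ℝ} (ht0 : 0 ≤ t) (ht : t < 1) :
    P.map (Z t) = P'.map (Z' t) := by
  refine map_snd_eq_of_map_pair (hZ.measurable 0 le_rfl) (hZ.measurable t ht0)
    (hZ'.measurable 0 le_rfl) (hZ'.measurable t ht0)
    (hZ.map_pair_eq_birth hZ' le_rfl ht0 ht ?_)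
  rw [Measure.map_congr hZ.start, Measure.map_congr hZ'.start, Measure.map_const,
    Measure.map_const, measure_univ, measure_univ]

lemma IsJoinedProcess.tendsto_integral_limit (hZ : IsJoinedProcess P θ Z) {s : ℝ} (hs0 : 0 ≤ s)
    (f : BoundedContinuousFunction (ℝ × ℝ) ℝ) :
    Tendsto (fun t => ∫ ω, f (Z s ω, (1 - t) * Z t ω) ∂P) (𝓝[<] 1)
      (𝓝 (∫ ω, f (Z s ω, Z 1 ω) ∂P)) := by
  refine tendsto_integral_filter_of_dominated_convergence (fun _ => ‖f‖) ?_ ?_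
    (integrable_const _) ?_
  · filter_upwards [Ioo_mem_nhdsLT (zero_lt_one (α := ℝ))] with t ht
    exact (f.continuous.measurable.comp ((hZ.measurable s hs0).prodMk
      ((hZ.measurable t ht.1.le).const_mul _))).aestronglyMeasurable
  · exact Eventually.of_forall fun t => Eventually.of_forall fun ω => f.norm_coe_le_norm _
  · filter_upwards [hZ.limit] with ω hω
    exact (f.continuous.tendsto _).comp (tendsto_const_nhds.prodMk_nhds hω)

/-- The joint law with the value at time `1` is the weak limit of joint laws before time `1`. -/
lemma IsJoinedProcess.map_pair_eq_limit (hZ : IsJoinedProcess P θ Z)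
    (hZ' : IsJoinedProcess P' θ Z') {s : ℝ} (hs0 : 0 ≤ s) (hs : s < 1) :
    P.map (fun ω => (Z s ω, Z 1 ω)) = P'.map (fun ω => (Z' s ω, Z' 1 ω)) := by
  have hm := (hZ.measurable s hs0).prodMk (hZ.measurable 1 zero_le_one)
  have hm' := (hZ'.measurable s hs0).prodMk (hZ'.measurable 1 zero_le_one)
  have := Measure.isProbabilityMeasure_map (μ := P) hm.aemeasurable
  have := Measure.isProbabilityMeasure_map (μ := P') hm'.aemeasurable
  refine ext_of_forall_integral_eq_of_IsFiniteMeasure fun f => ?_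
  rw [integral_map hm.aemeasurable f.continuous.aestronglyMeasurable,
    integral_map hm'.aemeasurable f.continuous.aestronglyMeasurable]
  refine tendsto_nhds_unique ((hZ.tendsto_integral_limit hs0 f).congr' ?_)
    (hZ'.tendsto_integral_limit hs0 f)
  filter_upwards [Ioo_mem_nhdsLT hs] with t ht
  have ht0 : 0 ≤ t := hs0.trans ht.1.le
  have h := hZ.map_pair_eq_birth hZ' hs0 ht.1.le ht.2 (hZ.map_eq_of_lt_one hZ' hs0 hs)
  have hc : Continuous fun x : ℝ × ℝ => f (x.1, (1 - t) * x.2) :=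
    f.continuous.comp (by fun_prop)
  have := congrArg (fun μ : Measure (ℝ × ℝ) => ∫ x, f (x.1, (1 - t) * x.2) ∂μ) h
  rwa [integral_map ((hZ.measurable s hs0).prodMk (hZ.measurable t ht0)).aemeasurable
    hc.aestronglyMeasurable, integral_map ((hZ'.measurable s hs0).prodMk
      (hZ'.measurable t ht0)).aemeasurable hc.aestronglyMeasurable] at this

/-- The two-dimensional laws of a joined process are unique. -/
lemma IsJoinedProcess.map_pair_eq (hZ : IsJoinedProcess P θ Z)
    (hZ' : IsJoinedProcess P' θ Z') {s t : ℝ} (hs : 0 ≤ s) (hst : s ≤ t) :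
    P.map (fun ω => (Z s ω, Z t ω)) = P'.map (fun ω => (Z' s ω, Z' t ω)) := by
  have hm := hZ.measurable
  have hm' := hZ'.measurable
  have h1 : (0 : ℝ) ≤ 1 := zero_le_one
  have hone : P.map (Z 1) = P'.map (Z' 1) :=
    map_snd_eq_of_map_pair (hm 0 le_rfl) (hm 1 h1) (hm' 0 le_rfl) (hm' 1 h1)
      (hZ.map_pair_eq_limit hZ' le_rfl one_pos)
  have hto : ∀ s, 0 ≤ s → s ≤ 1 →
      P.map (fun ω => (Z s ω, Z 1 ω)) = P'.map (fun ω => (Z' s ω, Z' 1 ω)) := by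
    intro s hs hs1
    rcases hs1.lt_or_eq with h | rfl
    · exact hZ.map_pair_eq_limit hZ' hs h
    · exact map_pair_self (hm 1 h1) (hm' 1 h1) hone
  have hfrom : ∀ t, 1 < t → P.map (fun ω => (Z 1 ω, Z t ω)) = P'.map (fun ω => (Z' 1 ω, Z' t ω)) := by
    intro t ht
    have ht0 := h1.trans ht.le
    obtain ⟨_, _, hn, _⟩ := hZ.death
    obtain ⟨_, _, hn', _⟩ := hZ'.death
    have hsing : ({1} : Set ℝ) ⊆ Ici 0 := by simp
    exact map_pair_eq_of_condExp (sigmaOn_Ici_inter_le hm hsing) (sigmaOn_Ici_inter_le hm' hsing)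
      (mem_singleton 1) (hm t ht0) (hm' t ht0) (hn t ht) (hn' t ht) hone
      (fun k x => Real.exp (-(x / (t - 1))) * (x / (t - 1)) ^ k / (k.factorial : ℝ))
      (fun k => by fun_prop) (hZ.entrance t ht) (hZ'.entrance t ht)
  rcases le_or_gt t 1 with ht | ht
  · rcases ht.lt_or_eq with ht | rfl
    · exact hZ.map_pair_eq_birth hZ' hs hst ht (hZ.map_eq_of_lt_one hZ' hs (hst.trans_lt ht))
    · exact hto s hs hst
  · rcases le_or_gt s 1 with hs1 | hs1
    · have ht0 := h1.trans ht.le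
      exact map_outer_eq_of_map_triple (hm s hs) (hm 1 h1) (hm t ht0) (hm' s hs) (hm' 1 h1)
        (hm' t ht0) (hZ.markov.map_triple_eq hZ'.markov hm hm' hs hs1 ht.le (hto s hs hs1)
          (hfrom t ht))
    · exact hZ.map_pair_eq_death hZ' hs1 hst (map_snd_eq_of_map_pair (hm 1 h1) (hm s hs)
        (hm' 1 h1) (hm' s hs) (hfrom s hs1))

/-- The three-dimensional laws of a joined process are unique. -/
theorem IsJoinedProcess.map_triple_eq (hZ : IsJoinedProcess P θ Z)
    (hZ' : IsJoinedProcess P' θ Z') {s t u : ℝ} (hs : 0 ≤ s) (hst : s ≤ t) (htu : t ≤ u) :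
    P.map (fun ω => (Z s ω, Z t ω, Z u ω)) = P'.map (fun ω => (Z' s ω, Z' t ω, Z' u ω)) :=
  hZ.markov.map_triple_eq hZ'.markov hZ.measurable hZ'.measurable hs hst htu
    (hZ.map_pair_eq hZ' hs hst) (hZ.map_pair_eq hZ' (hs.trans hst) htu)

end Joined

end Uniqueness

/-! ### Poisson counts mixed by a gamma variable -/

section Mixed

lemma lintegral_natCast_mul_poissonMeasure (c : NNReal) (f : ℕ → ENNReal) :
    ∫⁻ n : ℕ, (n : ENNReal) * f n ∂(poissonMeasure c) =
      c * ∫⁻ n, f (n + 1) ∂(poissonMeasure c) := by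
  have h := congrArg (fun μ : Measure ℕ => ∫⁻ n, f n ∂μ) (withDensity_poissonMeasure c)
  rw [lintegral_withDensity_eq_lintegral_mul _ measurable_from_nat measurable_from_nat,
    lintegral_smul_measure, lintegral_map measurable_from_nat measurable_from_nat] at h
  simpa using h

/-- `Λ` has the gamma distribution with shape `r` and rate `1`; given `Λ = x`, the variables
`A`, `B`, `C` are independent Poisson variables with parameters `x α`, `x β`, `x γ`. -/
structure IsMixedPoisson {E : Type*} [MeasurableSpace E] (Q : Measure E) (Λ : E → ℝ)
    (A B C : E → ℕ) (r α β γ : ℝ) : Prop where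
  measurable_fst : Measurable Λ
  measurable_A : Measurable A
  measurable_B : Measurable B
  measurable_C : Measurable C
  pos : ∀ᵐ ω ∂Q, 0 < Λ ω
  lintegral_eq : ∀ F : ℝ → ℕ → ℕ → ℕ → ENNReal, (∀ a b c, Measurable fun x => F x a b c) →
    ∫⁻ ω, F (Λ ω) (A ω) (B ω) (C ω) ∂Q = ∫⁻ x, ∫⁻ a, ∫⁻ b, ∫⁻ c, F x a b c
      ∂(poissonMeasure (x * γ).toNNReal) ∂(poissonMeasure (x * β).toNNReal)
      ∂(poissonMeasure (x * α).toNNReal) ∂(gammaMeasure r 1)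

variable {E : Type*} [MeasurableSpace E] {Q : Measure E} {Λ : E → ℝ} {A B C : E → ℕ}
  {r α β γ : ℝ}

lemma IsMixedPoisson.measurable_comp (h : IsMixedPoisson Q Λ A B C r α β γ) {M : Type*}
    [MeasurableSpace M] {F : ℝ → ℕ → ℕ → ℕ → M} (hF : ∀ a b c, Measurable fun x => F x a b c) :
    Measurable fun ω => F (Λ ω) (A ω) (B ω) (C ω) := by
  have hFm : Measurable fun y : (ℕ × ℕ × ℕ) × ℝ => F y.2 y.1.1 y.1.2.1 y.1.2.2 :=
    measurable_from_prod_countable_right fun y => hF y.1 y.2.1 y.2.2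
  exact hFm.comp ((h.measurable_A.prodMk (h.measurable_B.prodMk h.measurable_C)).prodMk
    h.measurable_fst)

/-- The Poisson shift in the first count. -/
lemma IsMixedPoisson.lintegral_A (h : IsMixedPoisson Q Λ A B C r α β γ)
    {F : ℝ → ℕ → ℕ → ℕ → ENNReal} (hF : ∀ a b c, Measurable fun x => F x a b c) :
    ∫⁻ ω, A ω * F (Λ ω) (A ω) (B ω) (C ω) ∂Q =
      ∫⁻ ω, ENNReal.ofReal (Λ ω * α) * F (Λ ω) (A ω + 1) (B ω) (C ω) ∂Q := by
  rw [h.lintegral_eq (fun x a b c => a * F x a b c) (fun a b c => (hF a b c).const_mul _),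
    h.lintegral_eq (fun x a b c => ENNReal.ofReal (x * α) * F x (a + 1) b c)
      (fun a b c => (by fun_prop : Measurable fun x : ℝ => ENNReal.ofReal (x * α)).mul
        (hF (a + 1) b c))]
  refine lintegral_congr fun x => ?_
  simp only [lintegral_const_mul _ (measurable_from_nat (α := ENNReal))]
  rw [lintegral_natCast_mul_poissonMeasure]
  rfl

/-- The Poisson shift in the second count. -/
lemma IsMixedPoisson.lintegral_B (h : IsMixedPoisson Q Λ A B C r α β γ)
    {F : ℝ → ℕ → ℕ → ℕ → ENNReal} (hF : ∀ a b c, Measurable fun x => F x a b c) :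
    ∫⁻ ω, B ω * F (Λ ω) (A ω) (B ω) (C ω) ∂Q =
      ∫⁻ ω, ENNReal.ofReal (Λ ω * β) * F (Λ ω) (A ω) (B ω + 1) (C ω) ∂Q := by
  rw [h.lintegral_eq (fun x a b c => b * F x a b c) (fun a b c => (hF a b c).const_mul _),
    h.lintegral_eq (fun x a b c => ENNReal.ofReal (x * β) * F x a (b + 1) c)
      (fun a b c => (by fun_prop : Measurable fun x : ℝ => ENNReal.ofReal (x * β)).mul
        (hF a (b + 1) c))]
  refine lintegral_congr fun x => lintegral_congr fun a => ?_
  simp only [lintegral_const_mul _ (measurable_from_nat (α := ENNReal))]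
  rw [lintegral_natCast_mul_poissonMeasure]
  rfl

/-- The Poisson shift in the third count. -/
lemma IsMixedPoisson.lintegral_C (h : IsMixedPoisson Q Λ A B C r α β γ)
    {F : ℝ → ℕ → ℕ → ℕ → ENNReal} (hF : ∀ a b c, Measurable fun x => F x a b c) :
    ∫⁻ ω, C ω * F (Λ ω) (A ω) (B ω) (C ω) ∂Q =
      ∫⁻ ω, ENNReal.ofReal (Λ ω * γ) * F (Λ ω) (A ω) (B ω) (C ω + 1) ∂Q := by
  rw [h.lintegral_eq (fun x a b c => c * F x a b c) (fun a b c => (hF a b c).const_mul _),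
    h.lintegral_eq (fun x a b c => ENNReal.ofReal (x * γ) * F x a b (c + 1))
      (fun a b c => (by fun_prop : Measurable fun x : ℝ => ENNReal.ofReal (x * γ)).mul
        (hF a b (c + 1)))]
  refine lintegral_congr fun x => lintegral_congr fun a => lintegral_congr fun b => ?_
  simp only [lintegral_const_mul _ (measurable_from_nat (α := ENNReal))]
  rw [lintegral_natCast_mul_poissonMeasure]
  rfl

/-- Equality of the integrals of nonnegative functions in `[0, ∞]` gives equality of the Bochner
integrals, and transfers integrability. -/
lemma integral_eq_and_integrable_of_lintegral_eq {f g : E → ℝ} (hf : Measurable f)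
    (hg : Measurable g) (hf0 : ∀ᵐ ω ∂Q, 0 ≤ f ω) (hg0 : ∀ᵐ ω ∂Q, 0 ≤ g ω)
    (h : ∫⁻ ω, ENNReal.ofReal (f ω) ∂Q = ∫⁻ ω, ENNReal.ofReal (g ω) ∂Q) :
    ∫ ω, f ω ∂Q = ∫ ω, g ω ∂Q ∧ (Integrable g Q → Integrable f Q) := by
  refine ⟨?_, fun hgi => ⟨hf.aestronglyMeasurable, ?_⟩⟩
  · rw [integral_eq_lintegral_of_nonneg_ae hf0 hf.aestronglyMeasurable,
      integral_eq_lintegral_of_nonneg_ae hg0 hg.aestronglyMeasurable, h]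
  · rw [hasFiniteIntegral_iff_ofReal hf0, h]
    exact (hasFiniteIntegral_iff_ofReal hg0).1 hgi.2

/-- The Poisson shift identity `E[n f(n)] = c E[f(n + 1)]` for the first count, under the mixture. -/
lemma IsMixedPoisson.shift_A (h : IsMixedPoisson Q Λ A B C r α β γ) (hα : 0 ≤ α)
    {φ : ℝ → ℕ → ℕ → ℕ → ℝ} (hφ : ∀ a b c, Measurable fun x => φ x a b c)
    (hφ0 : ∀ x, 0 < x → ∀ a b c, 0 ≤ φ x a b c) :
    ∫ ω, A ω * φ (Λ ω) (A ω) (B ω) (C ω) ∂Q =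
        ∫ ω, Λ ω * α * φ (Λ ω) (A ω + 1) (B ω) (C ω) ∂Q ∧
      (Integrable (fun ω => Λ ω * α * φ (Λ ω) (A ω + 1) (B ω) (C ω)) Q →
        Integrable (fun ω => A ω * φ (Λ ω) (A ω) (B ω) (C ω)) Q) := by
  refine integral_eq_and_integrable_of_lintegral_eq
    (h.measurable_comp (F := fun x a b c => (a : ℝ) * φ x a b c) fun a b c => (hφ a b c).const_mul _)
    (h.measurable_comp (F := fun x a b c => x * α * φ x (a + 1) b c) fun a b c =>
      (measurable_id.mul_const _).mul (hφ (a + 1) b c)) ?_ ?_ ?_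
  · filter_upwards [h.pos] with ω hω using mul_nonneg (Nat.cast_nonneg _) (hφ0 _ hω _ _ _)
  · filter_upwards [h.pos] with ω hω using
      mul_nonneg (mul_nonneg hω.le hα) (hφ0 _ hω _ _ _)
  · have := h.lintegral_A (F := fun x a b c => ENNReal.ofReal (φ x a b c))
      fun a b c => (hφ a b c).ennreal_ofReal
    simp only [← ENNReal.ofReal_natCast, ← ENNReal.ofReal_mul (Nat.cast_nonneg _)] at this
    rw [this]
    refine lintegral_congr_ae ?_
    filter_upwards [h.pos] with ω hω
    rw [ENNReal.ofReal_mul (mul_nonneg hω.le hα)]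

lemma IsMixedPoisson.shift_B (h : IsMixedPoisson Q Λ A B C r α β γ) (hβ : 0 ≤ β)
    {φ : ℝ → ℕ → ℕ → ℕ → ℝ} (hφ : ∀ a b c, Measurable fun x => φ x a b c)
    (hφ0 : ∀ x, 0 < x → ∀ a b c, 0 ≤ φ x a b c) :
    ∫ ω, B ω * φ (Λ ω) (A ω) (B ω) (C ω) ∂Q =
        ∫ ω, Λ ω * β * φ (Λ ω) (A ω) (B ω + 1) (C ω) ∂Q ∧
      (Integrable (fun ω => Λ ω * β * φ (Λ ω) (A ω) (B ω + 1) (C ω)) Q →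
        Integrable (fun ω => B ω * φ (Λ ω) (A ω) (B ω) (C ω)) Q) := by
  refine integral_eq_and_integrable_of_lintegral_eq
    (h.measurable_comp (F := fun x a b c => (b : ℝ) * φ x a b c) fun a b c => (hφ a b c).const_mul _)
    (h.measurable_comp (F := fun x a b c => x * β * φ x a (b + 1) c) fun a b c =>
      (measurable_id.mul_const _).mul (hφ a (b + 1) c)) ?_ ?_ ?_
  · filter_upwards [h.pos] with ω hω using mul_nonneg (Nat.cast_nonneg _) (hφ0 _ hω _ _ _)
  · filter_upwards [h.pos] with ω hω using
      mul_nonneg (mul_nonneg hω.le hβ) (hφ0 _ hω _ _ _)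
  · have := h.lintegral_B (F := fun x a b c => ENNReal.ofReal (φ x a b c))
      fun a b c => (hφ a b c).ennreal_ofReal
    simp only [← ENNReal.ofReal_natCast, ← ENNReal.ofReal_mul (Nat.cast_nonneg _)] at this
    rw [this]
    refine lintegral_congr_ae ?_
    filter_upwards [h.pos] with ω hω
    rw [ENNReal.ofReal_mul (mul_nonneg hω.le hβ)]

lemma IsMixedPoisson.shift_C (h : IsMixedPoisson Q Λ A B C r α β γ) (hγ : 0 ≤ γ)
    {φ : ℝ → ℕ → ℕ → ℕ → ℝ} (hφ : ∀ a b c, Measurable fun x => φ x a b c)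
    (hφ0 : ∀ x, 0 < x → ∀ a b c, 0 ≤ φ x a b c) :
    ∫ ω, C ω * φ (Λ ω) (A ω) (B ω) (C ω) ∂Q =
        ∫ ω, Λ ω * γ * φ (Λ ω) (A ω) (B ω) (C ω + 1) ∂Q ∧
      (Integrable (fun ω => Λ ω * γ * φ (Λ ω) (A ω) (B ω) (C ω + 1)) Q →
        Integrable (fun ω => C ω * φ (Λ ω) (A ω) (B ω) (C ω)) Q) := by
  refine integral_eq_and_integrable_of_lintegral_eq
    (h.measurable_comp (F := fun x a b c => (c : ℝ) * φ x a b c) fun a b c => (hφ a b c).const_mul _)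
    (h.measurable_comp (F := fun x a b c => x * γ * φ x a b (c + 1)) fun a b c =>
      (measurable_id.mul_const _).mul (hφ a b (c + 1))) ?_ ?_ ?_
  · filter_upwards [h.pos] with ω hω using mul_nonneg (Nat.cast_nonneg _) (hφ0 _ hω _ _ _)
  · filter_upwards [h.pos] with ω hω using
      mul_nonneg (mul_nonneg hω.le hγ) (hφ0 _ hω _ _ _)
  · have := h.lintegral_C (F := fun x a b c => ENNReal.ofReal (φ x a b c))
      fun a b c => (hφ a b c).ennreal_ofReal
    simp only [← ENNReal.ofReal_natCast, ← ENNReal.ofReal_mul (Nat.cast_nonneg _)] at this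
    rw [this]
    refine lintegral_congr_ae ?_
    filter_upwards [h.pos] with ω hω
    rw [ENNReal.ofReal_mul (mul_nonneg hω.le hγ)]

/-- The moments of the mixing variable on the event that the two counts `A` and `C` are given. -/
lemma IsMixedPoisson.lintegral_pow_mul (h : IsMixedPoisson Q Λ A B C r α β γ) (hr : 0 < r)
    (hα : 0 ≤ α) (hγ : 0 ≤ γ) (i : ℕ) (ψ : ℕ → ℕ → ENNReal) :
    ∫⁻ ω, ENNReal.ofReal (Λ ω ^ i) * ψ (A ω) (C ω) ∂Q =
      ∑' a : ℕ, ∑' c : ℕ, ENNReal.ofReal (α ^ a * γ ^ c / (a.factorial * c.factorial) *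
        (Real.Gamma (r + (a + c + i : ℕ)) / (Real.Gamma r *
          (1 + (α + γ)) ^ (r + (a + c + i : ℕ))))) * ψ a c := by
  rw [h.lintegral_eq (fun x a b c => ENNReal.ofReal (x ^ i) * ψ a c) (fun a b c => by fun_prop)]
  have h1 : ∀ᵐ x ∂(gammaMeasure r 1), ∫⁻ a, ∫⁻ _b, ∫⁻ c, ENNReal.ofReal (x ^ i) * ψ a c
      ∂(poissonMeasure (x * γ).toNNReal) ∂(poissonMeasure (x * β).toNNReal)
      ∂(poissonMeasure (x * α).toNNReal) =
      ∑' a : ℕ, ∑' c : ℕ, ENNReal.ofReal (α ^ a * γ ^ c / (a.factorial * c.factorial)) * ψ a c *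
        ENNReal.ofReal (x ^ (a + c + i) * Real.exp (-(x * (α + γ)))) := by
    filter_upwards [ae_pos_gammaMeasure r 1] with x hx
    simp only [lintegral_const, measure_univ, mul_one]
    rw [lintegral_countable']
    refine tsum_congr fun a => ?_
    rw [lintegral_countable', ← ENNReal.tsum_mul_right]
    refine tsum_congr fun c => ?_
    rw [poissonMeasure_toNNReal_singleton (mul_nonneg hx.le hγ),
      poissonMeasure_toNNReal_singleton (mul_nonneg hx.le hα)]
    have e : ENNReal.ofReal (x ^ i) * ENNReal.ofReal (Real.exp (-(x * γ)) * (x * γ) ^ c /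
        c.factorial) * ENNReal.ofReal (Real.exp (-(x * α)) * (x * α) ^ a / a.factorial) =
        ENNReal.ofReal (α ^ a * γ ^ c / (a.factorial * c.factorial)) *
          ENNReal.ofReal (x ^ (a + c + i) * Real.exp (-(x * (α + γ)))) := by
      rw [← ENNReal.ofReal_mul (by positivity), ← ENNReal.ofReal_mul (by positivity),
        ← ENNReal.ofReal_mul (by positivity)]
      congr 1
      rw [mul_add, neg_add, Real.exp_add, pow_add, pow_add, mul_pow, mul_pow]
      field_simp
    rw [mul_right_comm _ (ψ a c), mul_right_comm _ (ψ a c), e, mul_right_comm]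
  rw [lintegral_congr_ae h1, lintegral_tsum fun a => by fun_prop]
  refine tsum_congr fun a => ?_
  rw [lintegral_tsum fun c => by fun_prop]
  refine tsum_congr fun c => ?_
  rw [lintegral_const_mul _ (by fun_prop), lintegral_pow_mul_exp_gammaMeasure hr (by positivity),
    mul_right_comm, ← ENNReal.ofReal_mul (by positivity)]

/-- The posterior mean of the mixing variable given the counts `A` and `C`. -/
lemma IsMixedPoisson.posterior_one (h : IsMixedPoisson Q Λ A B C r α β γ) (hr : 0 < r)
    (hα : 0 ≤ α) (hγ : 0 ≤ γ) {ψ : ℕ → ℕ → ℝ} (hψ : ∀ a c, 0 ≤ ψ a c) :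
    ∫ ω, Λ ω * ψ (A ω) (C ω) ∂Q =
      ∫ ω, 1 / (1 + (α + γ)) * (A ω + C ω + r) * ψ (A ω) (C ω) ∂Q := by
  refine (integral_eq_and_integrable_of_lintegral_eq
    (h.measurable_comp (F := fun x a b c => x * ψ a c) fun a b c => by fun_prop)
    (h.measurable_comp (F := fun x a b c => 1 / (1 + (α + γ)) * (a + c + r) * ψ a c)
      fun a b c => by fun_prop) ?_ ?_ ?_).1
  · filter_upwards [h.pos] with ω hω using mul_nonneg hω.le (hψ _ _)
  · exact Eventually.of_forall fun ω => mul_nonneg (by positivity) (hψ _ _)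
  · have h1 := h.lintegral_pow_mul hr hα hγ 1 fun a c => ENNReal.ofReal (ψ a c)
    have h0 := h.lintegral_pow_mul hr hα hγ 0 fun a c =>
      ENNReal.ofReal (1 / (1 + (α + γ)) * (a + c + r) * ψ a c)
    simp only [pow_one, pow_zero, ENNReal.ofReal_one, one_mul] at h1 h0
    simp only [ENNReal.ofReal_mul' (hψ _ _)] at h0 ⊢
    rw [h1, h0]
    refine tsum_congr fun a => tsum_congr fun c => ?_
    have hG := Real.Gamma_pos_of_pos hr
    have e : r + ((a + c + 1 : ℕ) : ℝ) = (r + ((a + c + 0 : ℕ) : ℝ)) + 1 := by push_cast; ring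
    have hpos : 0 < r + ((a + c + 0 : ℕ) : ℝ) := by positivity
    have hG0 := Real.Gamma_pos_of_pos hpos
    have e2 : (a + c + r : ℝ) = r + ((a + c + 0 : ℕ) : ℝ) := by push_cast; ring
    have hs : 0 < 1 + (α + γ) := by positivity
    rw [e, e2, Real.Gamma_add_one hpos.ne', Real.rpow_add_one hs.ne', ← mul_assoc (ENNReal.ofReal _)]
    congr 1
    rw [← ENNReal.ofReal_mul (by positivity)]
    congr 1
    field_simp

/-- The posterior second moment of the mixing variable given the counts `A` and `C`. -/
lemma IsMixedPoisson.posterior_two (h : IsMixedPoisson Q Λ A B C r α β γ) (hr : 0 < r)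
    (hα : 0 ≤ α) (hγ : 0 ≤ γ) {ψ : ℕ → ℕ → ℝ} (hψ : ∀ a c, 0 ≤ ψ a c) :
    ∫ ω, Λ ω ^ 2 * ψ (A ω) (C ω) ∂Q = ∫ ω, (1 / (1 + (α + γ))) ^ 2 *
      ((A ω + C ω + r) * (A ω + C ω + r + 1)) * ψ (A ω) (C ω) ∂Q := by
  refine (integral_eq_and_integrable_of_lintegral_eq
    (h.measurable_comp (F := fun x a b c => x ^ 2 * ψ a c) fun a b c => by fun_prop)
    (h.measurable_comp (F := fun x a b c => (1 / (1 + (α + γ))) ^ 2 *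
      ((a + c + r) * (a + c + r + 1)) * ψ a c) fun a b c => by fun_prop) ?_ ?_ ?_).1
  · exact Eventually.of_forall fun ω => mul_nonneg (by positivity) (hψ _ _)
  · exact Eventually.of_forall fun ω => mul_nonneg (by positivity) (hψ _ _)
  · have h1 := h.lintegral_pow_mul hr hα hγ 2 fun a c => ENNReal.ofReal (ψ a c)
    have h0 := h.lintegral_pow_mul hr hα hγ 0 fun a c =>
      ENNReal.ofReal ((1 / (1 + (α + γ))) ^ 2 * ((a + c + r) * (a + c + r + 1)) * ψ a c)
    simp only [pow_zero, ENNReal.ofReal_one, one_mul] at h1 h0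
    simp only [ENNReal.ofReal_mul' (hψ _ _)] at h0 ⊢
    rw [h1, h0]
    refine tsum_congr fun a => tsum_congr fun c => ?_
    have hG := Real.Gamma_pos_of_pos hr
    have e : r + ((a + c + 2 : ℕ) : ℝ) = (r + ((a + c + 0 : ℕ) : ℝ)) + 1 + 1 := by push_cast; ring
    have hpos : 0 < r + ((a + c + 0 : ℕ) : ℝ) := by positivity
    have hG0 := Real.Gamma_pos_of_pos hpos
    have e2 : (a + c + r : ℝ) = r + ((a + c + 0 : ℕ) : ℝ) := by push_cast; ring
    have hs : 0 < 1 + (α + γ) := by positivity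
    rw [e, e2, Real.Gamma_add_one (by positivity), Real.Gamma_add_one hpos.ne',
      Real.rpow_add_one hs.ne', Real.rpow_add_one hs.ne', ← mul_assoc (ENNReal.ofReal _)]
    congr 1
    rw [← ENNReal.ofReal_mul (by positivity)]
    congr 1
    field_simp

end Mixed

/-! ### Conditional moments of mixed Poisson counts -/

section MixedMoments

lemma integral_linear_two {E : Type*} [MeasurableSpace E] {Q : Measure E} {f₁ f₂ : E → ℝ}
    (h₁ : Integrable f₁ Q) (h₂ : Integrable f₂ Q) (c₁ c₂ : ℝ) :
    ∫ ω, (c₁ * f₁ ω + c₂ * f₂ ω) ∂Q = c₁ * ∫ ω, f₁ ω ∂Q + c₂ * ∫ ω, f₂ ω ∂Q := by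
  rw [integral_add (h₁.const_mul _) (h₂.const_mul _), integral_const_mul, integral_const_mul]

lemma integral_linear_five {E : Type*} [MeasurableSpace E] {Q : Measure E}
    {f₁ f₂ f₃ f₄ f₅ : E → ℝ} (h₁ : Integrable f₁ Q) (h₂ : Integrable f₂ Q) (h₃ : Integrable f₃ Q)
    (h₄ : Integrable f₄ Q) (h₅ : Integrable f₅ Q) (c₁ c₂ c₃ c₄ c₅ : ℝ) :
    ∫ ω, (c₁ * f₁ ω + c₂ * f₂ ω + (c₃ * f₃ ω + c₄ * f₄ ω) + c₅ * f₅ ω) ∂Q =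
      c₁ * ∫ ω, f₁ ω ∂Q + c₂ * ∫ ω, f₂ ω ∂Q + (c₃ * ∫ ω, f₃ ω ∂Q + c₄ * ∫ ω, f₄ ω ∂Q) +
        c₅ * ∫ ω, f₅ ω ∂Q := by
  have h12 : Integrable (fun ω => c₁ * f₁ ω + c₂ * f₂ ω) Q :=
    (h₁.const_mul c₁).add (h₂.const_mul c₂)
  have h34 : Integrable (fun ω => c₃ * f₃ ω + c₄ * f₄ ω) Q :=
    (h₃.const_mul c₃).add (h₄.const_mul c₄)
  have h1234 : Integrable (fun ω => c₁ * f₁ ω + c₂ * f₂ ω + (c₃ * f₃ ω + c₄ * f₄ ω)) Q :=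
    h12.add h34
  rw [integral_add h1234 (h₅.const_mul _), integral_const_mul, integral_add h12 h34,
    integral_linear_two h₁ h₂, integral_linear_two h₃ h₄]

variable {E : Type*} [MeasurableSpace E] {Q : Measure E} {Λ : E → ℝ}
  {A B C : E → ℕ} {r α β γ : ℝ}

lemma integrable_mul_mul_bdd {U V f : E → ℝ} (hU : MemLp U 2 Q) (hV : MemLp V 2 Q)
    (hf : Measurable f) {K : ℝ} (hK : ∀ ω, |f ω| ≤ K) :
    Integrable (fun ω => U ω * (V ω * f ω)) Q := by
  have := (hU.integrable_mul hV).mul_bdd (c := K) hf.aestronglyMeasurable (Eventually.of_forall hK)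
  refine this.congr (Eventually.of_forall fun ω => ?_)
  simp only [Pi.mul_apply]
  ring

lemma IsMixedPoisson.lintegral_pow (h : IsMixedPoisson Q Λ A B C r α β γ) (hr : 0 < r) (i : ℕ) :
    ∫⁻ ω, ENNReal.ofReal (Λ ω ^ i) ∂Q = ENNReal.ofReal (Real.Gamma (r + i) / Real.Gamma r) := by
  rw [h.lintegral_eq (fun x _ _ _ => ENNReal.ofReal (x ^ i)) (fun _ _ _ => by fun_prop)]
  simpa using lintegral_pow_mul_exp_gammaMeasure hr le_rfl i

lemma IsMixedPoisson.memLp_fst (h : IsMixedPoisson Q Λ A B C r α β γ) (hr : 0 < r) :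
    MemLp Λ 2 Q := by
  rw [memLp_two_iff_integrable_sq h.measurable_fst.aestronglyMeasurable]
  refine ⟨(h.measurable_fst.pow_const 2).aestronglyMeasurable, ?_⟩
  rw [hasFiniteIntegral_iff_ofReal (Eventually.of_forall fun ω => sq_nonneg _),
    h.lintegral_pow hr]
  exact ENNReal.ofReal_lt_top

lemma IsMixedPoisson.integral_fst (h : IsMixedPoisson Q Λ A B C r α β γ) (hr : 0 < r) :
    ∫ ω, Λ ω ∂Q = r := by
  have h1 := h.lintegral_pow hr 1
  simp only [pow_one, Nat.cast_one] at h1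
  have hG := (Real.Gamma_pos_of_pos hr).ne'
  rw [integral_eq_lintegral_of_nonneg_ae (h.pos.mono fun _ => le_of_lt)
    h.measurable_fst.aestronglyMeasurable, h1, Real.Gamma_add_one hr.ne',
    mul_div_cancel_right₀ _ hG, ENNReal.toReal_ofReal hr.le]

lemma IsMixedPoisson.integral_fst_sq (h : IsMixedPoisson Q Λ A B C r α β γ) (hr : 0 < r) :
    ∫ ω, Λ ω ^ 2 ∂Q = r * (r + 1) := by
  have h2 := h.lintegral_pow hr 2
  have hG := (Real.Gamma_pos_of_pos hr).ne'
  have e : r + ((2 : ℕ) : ℝ) = r + 1 + 1 := by push_cast; ring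
  rw [integral_eq_lintegral_of_nonneg_ae (Eventually.of_forall fun ω => sq_nonneg _)
    (h.measurable_fst.pow_const 2).aestronglyMeasurable, h2, e,
    Real.Gamma_add_one (by positivity), Real.Gamma_add_one hr.ne', ← mul_assoc,
    mul_div_cancel_right₀ _ hG, ENNReal.toReal_ofReal (by positivity), mul_comm]

variable [IsProbabilityMeasure Q]

lemma integrable_mul_bdd {U f : E → ℝ} (hU : MemLp U 2 Q) (hf : Measurable f) {K : ℝ}
    (hK : ∀ ω, |f ω| ≤ K) : Integrable (fun ω => U ω * f ω) Q :=
  (hU.integrable one_le_two).mul_bdd (c := K) hf.aestronglyMeasurable (Eventually.of_forall hK)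

lemma measurable_natCast_comp {D : E → ℕ} (hD : Measurable D) : Measurable fun ω => (D ω : ℝ) :=
  measurable_from_nat.comp hD

lemma IsMixedPoisson.memLp_A (h : IsMixedPoisson Q Λ A B C r α β γ) (hr : 0 < r) (hα : 0 ≤ α) :
    MemLp (fun ω => (A ω : ℝ)) 2 Q := by
  have hΛ := h.memLp_fst hr
  have hΛ2 : Integrable (fun ω => Λ ω * α * Λ ω) Q :=
    ((hΛ.integrable_mul hΛ).const_mul α).congr (Eventually.of_forall fun ω => by
      simp only [Pi.mul_apply]; ring)
  have h1 := (h.shift_A hα (φ := fun x _ _ _ => x) (fun _ _ _ => measurable_id)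
    (fun x hx _ _ _ => hx.le)).2 hΛ2
  have h2 := (h.shift_A hα (φ := fun _ a _ _ => (a : ℝ)) (fun _ _ _ => measurable_const)
    (fun x hx _ _ _ => by positivity)).2 (((h1.const_mul α).add
      ((hΛ.integrable one_le_two).const_mul α)).congr (Eventually.of_forall fun ω => by
        simp only [Pi.add_apply]; push_cast; ring))
  rw [memLp_two_iff_integrable_sq (measurable_natCast_comp h.measurable_A).aestronglyMeasurable]
  exact h2.congr (Eventually.of_forall fun ω => by simp only [sq])

lemma IsMixedPoisson.memLp_B (h : IsMixedPoisson Q Λ A B C r α β γ) (hr : 0 < r) (hβ : 0 ≤ β) :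
    MemLp (fun ω => (B ω : ℝ)) 2 Q := by
  have hΛ := h.memLp_fst hr
  have hΛ2 : Integrable (fun ω => Λ ω * β * Λ ω) Q :=
    ((hΛ.integrable_mul hΛ).const_mul β).congr (Eventually.of_forall fun ω => by
      simp only [Pi.mul_apply]; ring)
  have h1 := (h.shift_B hβ (φ := fun x _ _ _ => x) (fun _ _ _ => measurable_id)
    (fun x hx _ _ _ => hx.le)).2 hΛ2
  have h2 := (h.shift_B hβ (φ := fun _ _ b _ => (b : ℝ)) (fun _ _ _ => measurable_const)
    (fun x hx _ _ _ => by positivity)).2 (((h1.const_mul β).add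
      ((hΛ.integrable one_le_two).const_mul β)).congr (Eventually.of_forall fun ω => by
        simp only [Pi.add_apply]; push_cast; ring))
  rw [memLp_two_iff_integrable_sq (measurable_natCast_comp h.measurable_B).aestronglyMeasurable]
  exact h2.congr (Eventually.of_forall fun ω => by simp only [sq])

lemma IsMixedPoisson.memLp_C (h : IsMixedPoisson Q Λ A B C r α β γ) (hr : 0 < r) (hγ : 0 ≤ γ) :
    MemLp (fun ω => (C ω : ℝ)) 2 Q := by
  have hΛ := h.memLp_fst hr
  have hΛ2 : Integrable (fun ω => Λ ω * γ * Λ ω) Q :=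
    ((hΛ.integrable_mul hΛ).const_mul γ).congr (Eventually.of_forall fun ω => by
      simp only [Pi.mul_apply]; ring)
  have h1 := (h.shift_C hγ (φ := fun x _ _ _ => x) (fun _ _ _ => measurable_id)
    (fun x hx _ _ _ => hx.le)).2 hΛ2
  have h2 := (h.shift_C hγ (φ := fun _ _ _ c => (c : ℝ)) (fun _ _ _ => measurable_const)
    (fun x hx _ _ _ => by positivity)).2 (((h1.const_mul γ).add
      ((hΛ.integrable one_le_two).const_mul γ)).congr (Eventually.of_forall fun ω => by
        simp only [Pi.add_apply]; push_cast; ring))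
  rw [memLp_two_iff_integrable_sq (measurable_natCast_comp h.measurable_C).aestronglyMeasurable]
  exact h2.congr (Eventually.of_forall fun ω => by simp only [sq])

/-- Given `A` and `B + C`, the count `B` is binomial; its conditional mean and variance. -/
lemma IsMixedPoisson.moments_thinning (h : IsMixedPoisson Q Λ A B C r α β γ) (hr : 0 < r)
    (hβ : 0 ≤ β) (hγ : 0 ≤ γ) {p q : ℝ} (hpq : p * β = q * γ) {f : ℕ → ℕ → ℝ} {K : ℝ}
    (hf0 : ∀ a n, 0 ≤ f a n) (hfK : ∀ a n, f a n ≤ K) :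
    ∫ ω, (p * B ω - q * C ω) * f (A ω) (B ω + C ω) ∂Q = 0 ∧
      ∫ ω, ((p * B ω - q * C ω) ^ 2 - p * q * (B ω + C ω)) * f (A ω) (B ω + C ω) ∂Q = 0 := by
  have hΛ := h.memLp_fst hr
  have hB := h.memLp_B hr hβ
  have hC := h.memLp_C hr hγ
  have hK : ∀ a n, |f a n| ≤ K := fun a n => by rw [abs_of_nonneg (hf0 a n)]; exact hfK a n
  have hm : ∀ i : ℕ, Measurable fun ω => f (A ω) (B ω + C ω + i) := fun i =>
    h.measurable_comp (F := fun _ a b c => f a (b + c + i)) fun _ _ _ => measurable_const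
  have hm0 : Measurable fun ω => f (A ω) (B ω + C ω) := hm 0
  -- every moment reduces to the two integrals `G₁` and `G₂` of shifted functions
  set G₁ := ∫ ω, Λ ω * f (A ω) (B ω + C ω + 1) ∂Q with hG₁
  set G₂ := ∫ ω, Λ ω * (Λ ω * f (A ω) (B ω + C ω + 2)) ∂Q with hG₂
  have e1 : ∫ ω, B ω * f (A ω) (B ω + C ω) ∂Q = β * G₁ := by
    rw [(h.shift_B hβ (φ := fun _ a b c => f a (b + c)) (fun _ _ _ => measurable_const)
      fun _ _ _ _ _ => hf0 _ _).1, hG₁, ← integral_const_mul]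
    refine integral_congr_ae (Eventually.of_forall fun ω => ?_)
    simp only [add_right_comm (B ω) 1]
    ring
  have e2 : ∫ ω, C ω * f (A ω) (B ω + C ω) ∂Q = γ * G₁ := by
    rw [(h.shift_C hγ (φ := fun _ a b c => f a (b + c)) (fun _ _ _ => measurable_const)
      fun _ _ _ _ _ => hf0 _ _).1, hG₁, ← integral_const_mul]
    refine integral_congr_ae (Eventually.of_forall fun ω => ?_)
    simp only [← add_assoc]
    ring
  have e3 : ∫ ω, B ω * (Λ ω * f (A ω) (B ω + C ω + 1)) ∂Q = β * G₂ := by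
    rw [(h.shift_B hβ (φ := fun x a b c => x * f a (b + c + 1))
      (fun _ _ _ => measurable_id.mul_const _) fun x hx _ _ _ => mul_nonneg hx.le (hf0 _ _)).1,
      hG₂, ← integral_const_mul]
    refine integral_congr_ae (Eventually.of_forall fun ω => ?_)
    have e : B ω + 1 + C ω + 1 = B ω + C ω + 2 := by ring
    simp only [e]
    ring
  have e4 : ∫ ω, C ω * (Λ ω * f (A ω) (B ω + C ω + 1)) ∂Q = γ * G₂ := by
    rw [(h.shift_C hγ (φ := fun x a b c => x * f a (b + c + 1))
      (fun _ _ _ => measurable_id.mul_const _) fun x hx _ _ _ => mul_nonneg hx.le (hf0 _ _)).1,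
      hG₂, ← integral_const_mul]
    refine integral_congr_ae (Eventually.of_forall fun ω => ?_)
    simp only [← add_assoc]
    ring
  have i1 := integrable_mul_bdd hΛ (hm 1) (K := K) fun ω => hK _ _
  have i2 := integrable_mul_mul_bdd hB hΛ (hm 1) (K := K) fun ω => hK _ _
  have i3 := integrable_mul_mul_bdd hC hΛ (hm 1) (K := K) fun ω => hK _ _
  have e5 : ∫ ω, B ω * (B ω * f (A ω) (B ω + C ω)) ∂Q = β * (β * G₂) + β * G₁ := by
    rw [(h.shift_B hβ (φ := fun _ a b c => b * f a (b + c)) (fun _ _ _ => measurable_const)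
      fun _ _ _ _ _ => mul_nonneg (Nat.cast_nonneg _) (hf0 _ _)).1, ← e3, hG₁,
      ← integral_linear_two i2 i1]
    refine integral_congr_ae (Eventually.of_forall fun ω => ?_)
    simp only [add_right_comm (B ω) 1]
    push_cast
    ring
  have e6 : ∫ ω, B ω * (C ω * f (A ω) (B ω + C ω)) ∂Q = β * (γ * G₂) := by
    rw [(h.shift_B hβ (φ := fun _ a b c => c * f a (b + c)) (fun _ _ _ => measurable_const)
      fun _ _ _ _ _ => mul_nonneg (Nat.cast_nonneg _) (hf0 _ _)).1, ← e4, ← integral_const_mul]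
    refine integral_congr_ae (Eventually.of_forall fun ω => ?_)
    simp only [add_right_comm (B ω) 1]
    ring
  have e7 : ∫ ω, C ω * (C ω * f (A ω) (B ω + C ω)) ∂Q = γ * (γ * G₂) + γ * G₁ := by
    rw [(h.shift_C hγ (φ := fun _ a b c => c * f a (b + c)) (fun _ _ _ => measurable_const)
      fun _ _ _ _ _ => mul_nonneg (Nat.cast_nonneg _) (hf0 _ _)).1, ← e4, hG₁,
      ← integral_linear_two i3 i1]
    refine integral_congr_ae (Eventually.of_forall fun ω => ?_)
    simp only [← add_assoc]
    push_cast
    ring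
  have j1 := integrable_mul_bdd hB hm0 (K := K) fun ω => hK _ _
  have j2 := integrable_mul_bdd hC hm0 (K := K) fun ω => hK _ _
  have j3 := integrable_mul_mul_bdd hB hB hm0 (K := K) fun ω => hK _ _
  have j4 := integrable_mul_mul_bdd hB hC hm0 (K := K) fun ω => hK _ _
  have j5 := integrable_mul_mul_bdd hC hC hm0 (K := K) fun ω => hK _ _
  constructor
  · have := integral_linear_two j1 j2 p (-q)
    rw [e1, e2] at this
    calc _ = _ := integral_congr_ae (Eventually.of_forall fun ω => by ring)
      _ = _ := this
      _ = 0 := by linear_combination G₁ * hpq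
  · have := integral_linear_five j3 j4 j5 j1 j2 (p ^ 2) (-2 * p * q) (q ^ 2) (-(p * q)) (-(p * q))
    rw [e1, e2, e5, e6, e7] at this
    calc _ = _ := integral_congr_ae (Eventually.of_forall fun ω => by ring)
      _ = _ := this
      _ = 0 := by linear_combination ((p * β - q * γ) * G₂ + (p - q) * G₁) * hpq

/-- Given `A` and `Λ`, the count `B` is Poisson; its conditional mean and variance. -/
lemma IsMixedPoisson.moments_poisson (h : IsMixedPoisson Q Λ A B C r α β γ) (hr : 0 < r)
    (hβ : 0 ≤ β) {f : ℕ → ℝ → ℝ} {K : ℝ} (hf : ∀ a, Measurable (f a))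
    (hf0 : ∀ a x, 0 ≤ f a x) (hfK : ∀ a x, f a x ≤ K) :
    ∫ ω, (B ω - β * Λ ω) * f (A ω) (Λ ω) ∂Q = 0 ∧
      ∫ ω, ((B ω - β * Λ ω) ^ 2 - β * Λ ω) * f (A ω) (Λ ω) ∂Q = 0 := by
  have hΛ := h.memLp_fst hr
  have hB := h.memLp_B hr hβ
  have hK : ∀ a n, |f a n| ≤ K := fun a n => by rw [abs_of_nonneg (hf0 a n)]; exact hfK a n
  have hm : Measurable fun ω => f (A ω) (Λ ω) :=
    h.measurable_comp (F := fun x a _ _ => f a x) fun a _ _ => hf a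
  have i1 := integrable_mul_bdd hΛ hm (K := K) fun ω => hK _ _
  have i2 := integrable_mul_mul_bdd hB hΛ hm (K := K) fun ω => hK _ _
  have i3 := integrable_mul_mul_bdd hΛ hΛ hm (K := K) fun ω => hK _ _
  have i4 := integrable_mul_bdd hB hm (K := K) fun ω => hK _ _
  have i5 := integrable_mul_mul_bdd hB hB hm (K := K) fun ω => hK _ _
  have e1 : ∫ ω, B ω * f (A ω) (Λ ω) ∂Q = β * ∫ ω, Λ ω * f (A ω) (Λ ω) ∂Q := by
    rw [(h.shift_B hβ (φ := fun x a _ _ => f a x) (fun a _ _ => hf a)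
      fun _ _ _ _ _ => hf0 _ _).1, ← integral_const_mul]
    exact integral_congr_ae (Eventually.of_forall fun ω => by ring)
  have e2 : ∫ ω, B ω * (Λ ω * f (A ω) (Λ ω)) ∂Q =
      β * ∫ ω, Λ ω * (Λ ω * f (A ω) (Λ ω)) ∂Q := by
    rw [(h.shift_B hβ (φ := fun x a _ _ => x * f a x) (fun a _ _ => measurable_id.mul (hf a))
      fun x hx _ _ _ => mul_nonneg hx.le (hf0 _ _)).1, ← integral_const_mul]
    exact integral_congr_ae (Eventually.of_forall fun ω => by ring)
  have e3 : ∫ ω, B ω * (B ω * f (A ω) (Λ ω)) ∂Q =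
      β * ∫ ω, B ω * (Λ ω * f (A ω) (Λ ω)) ∂Q + β * ∫ ω, Λ ω * f (A ω) (Λ ω) ∂Q := by
    rw [(h.shift_B hβ (φ := fun x a b _ => b * f a x) (fun a _ _ => (hf a).const_mul _)
      fun x hx _ _ _ => mul_nonneg (Nat.cast_nonneg _) (hf0 _ _)).1, ← integral_linear_two i2 i1]
    exact integral_congr_ae (Eventually.of_forall fun ω => by push_cast; ring)
  constructor
  · have := integral_linear_two i4 i1 1 (-β)
    rw [e1] at this
    calc _ = _ := integral_congr_ae (Eventually.of_forall fun ω => by ring)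
      _ = _ := this
      _ = 0 := by ring
  · have := integral_linear_five i5 i2 i3 i1 i4 1 (-2 * β) (β ^ 2) (-β) 0
    rw [e3, e2] at this
    calc _ = _ := integral_congr_ae (Eventually.of_forall fun ω => by ring)
      _ = _ := this
      _ = 0 := by ring

/-- Given the counts `A` and `C`, the mixing variable `Λ` has a gamma distribution; its conditional
mean and variance. -/
lemma IsMixedPoisson.moments_gamma (h : IsMixedPoisson Q Λ A B C r α β γ) (hr : 0 < r)
    (hα : 0 ≤ α) (hγ : 0 ≤ γ) {d : ℝ} (hd : d = 1 / (1 + (α + γ))) {f : ℕ → ℕ → ℝ} {K : ℝ}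
    (hf0 : ∀ a n, 0 ≤ f a n) (hfK : ∀ a n, f a n ≤ K) :
    ∫ ω, (Λ ω - d * (A ω + C ω + r)) * f (A ω) (C ω) ∂Q = 0 ∧
      ∫ ω, ((Λ ω - d * (A ω + C ω + r)) ^ 2 - d ^ 2 * (A ω + C ω + r)) * f (A ω) (C ω) ∂Q = 0 := by
  have hΛ := h.memLp_fst hr
  have hN : MemLp (fun ω => (A ω : ℝ) + C ω + r) 2 Q :=
    ((h.memLp_A hr hα).add (h.memLp_C hr hγ)).add (memLp_const r)
  have hK : ∀ a n, |f a n| ≤ K := fun a n => by rw [abs_of_nonneg (hf0 a n)]; exact hfK a n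
  have hm : Measurable fun ω => f (A ω) (C ω) :=
    h.measurable_comp (F := fun _ a _ c => f a c) fun _ _ _ => measurable_const
  have i1 := integrable_mul_bdd hΛ hm (K := K) fun ω => hK _ _
  have i2 := integrable_mul_bdd hN hm (K := K) fun ω => hK _ _
  have i3 := integrable_mul_mul_bdd hΛ hΛ hm (K := K) fun ω => hK _ _
  have i4 := integrable_mul_mul_bdd hΛ hN hm (K := K) fun ω => hK _ _
  have i5 := integrable_mul_mul_bdd hN hN hm (K := K) fun ω => hK _ _
  have e1 : ∫ ω, Λ ω * f (A ω) (C ω) ∂Q = d * ∫ ω, (A ω + C ω + r) * f (A ω) (C ω) ∂Q := by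
    rw [h.posterior_one hr hα hγ hf0, ← hd, ← integral_const_mul]
    exact integral_congr_ae (Eventually.of_forall fun ω => by ring)
  have e2 : ∫ ω, Λ ω * ((A ω + C ω + r) * f (A ω) (C ω)) ∂Q =
      d * ∫ ω, (A ω + C ω + r) * ((A ω + C ω + r) * f (A ω) (C ω)) ∂Q := by
    rw [h.posterior_one hr hα hγ (ψ := fun a c => (a + c + r) * f a c)
      (fun a c => mul_nonneg (by positivity) (hf0 _ _)), ← hd, ← integral_const_mul]
    exact integral_congr_ae (Eventually.of_forall fun ω => by ring)
  have e3 : ∫ ω, Λ ω * (Λ ω * f (A ω) (C ω)) ∂Q =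
      d ^ 2 * ∫ ω, (A ω + C ω + r) * ((A ω + C ω + r) * f (A ω) (C ω)) ∂Q +
        d ^ 2 * ∫ ω, (A ω + C ω + r) * f (A ω) (C ω) ∂Q := by
    have := h.posterior_two hr hα hγ hf0
    rw [← hd] at this
    rw [← integral_linear_two i5 i2]
    calc _ = _ := integral_congr_ae (Eventually.of_forall fun ω => by ring)
      _ = _ := this
      _ = _ := integral_congr_ae (Eventually.of_forall fun ω => by ring)
  constructor
  · have := integral_linear_two i1 i2 1 (-d)
    rw [e1] at this
    calc _ = _ := integral_congr_ae (Eventually.of_forall fun ω => by ring)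
      _ = _ := this
      _ = 0 := by ring
  · have := integral_linear_five i3 i4 i5 i2 i1 1 (-2 * d) (d ^ 2) (-d ^ 2) 0
    rw [e3, e2] at this
    calc _ = _ := integral_congr_ae (Eventually.of_forall fun ω => by ring)
      _ = _ := this
      _ = 0 := by ring

/-- Given the counts `A` and `C`, the count `B` is negative binomial; its conditional mean and
variance. -/
lemma IsMixedPoisson.moments_negBinomial (h : IsMixedPoisson Q Λ A B C r α β γ) (hr : 0 < r)
    (hα : 0 ≤ α) (hβ : 0 ≤ β) (hγ : 0 ≤ γ) {d : ℝ} (hd : d = 1 / (1 + (α + γ)))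
    {f : ℕ → ℕ → ℝ} {K : ℝ} (hf0 : ∀ a n, 0 ≤ f a n) (hfK : ∀ a n, f a n ≤ K) :
    ∫ ω, (B ω - β * d * (A ω + C ω + r)) * f (A ω) (C ω) ∂Q = 0 ∧
      ∫ ω, ((B ω - β * d * (A ω + C ω + r)) ^ 2 - β * d * (1 + β * d) * (A ω + C ω + r)) *
        f (A ω) (C ω) ∂Q = 0 := by
  have hΛ := h.memLp_fst hr
  have hB := h.memLp_B hr hβ
  have hN : MemLp (fun ω => (A ω : ℝ) + C ω + r) 2 Q :=
    ((h.memLp_A hr hα).add (h.memLp_C hr hγ)).add (memLp_const r)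
  have hK : ∀ a n, |f a n| ≤ K := fun a n => by rw [abs_of_nonneg (hf0 a n)]; exact hfK a n
  have hm : Measurable fun ω => f (A ω) (C ω) :=
    h.measurable_comp (F := fun _ a _ c => f a c) fun _ _ _ => measurable_const
  have i1 := integrable_mul_bdd hΛ hm (K := K) fun ω => hK _ _
  have i2 := integrable_mul_bdd hN hm (K := K) fun ω => hK _ _
  have i3 := integrable_mul_mul_bdd hΛ hΛ hm (K := K) fun ω => hK _ _
  have i5 := integrable_mul_mul_bdd hN hN hm (K := K) fun ω => hK _ _
  have i6 := integrable_mul_bdd hB hm (K := K) fun ω => hK _ _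
  have i7 := integrable_mul_mul_bdd hB hB hm (K := K) fun ω => hK _ _
  have i8 := integrable_mul_mul_bdd hB hN hm (K := K) fun ω => hK _ _
  have i9 := integrable_mul_mul_bdd hB hΛ hm (K := K) fun ω => hK _ _
  have e1 : ∫ ω, Λ ω * f (A ω) (C ω) ∂Q = d * ∫ ω, (A ω + C ω + r) * f (A ω) (C ω) ∂Q := by
    rw [h.posterior_one hr hα hγ hf0, ← hd, ← integral_const_mul]
    exact integral_congr_ae (Eventually.of_forall fun ω => by ring)
  have e2 : ∫ ω, Λ ω * ((A ω + C ω + r) * f (A ω) (C ω)) ∂Q =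
      d * ∫ ω, (A ω + C ω + r) * ((A ω + C ω + r) * f (A ω) (C ω)) ∂Q := by
    rw [h.posterior_one hr hα hγ (ψ := fun a c => (a + c + r) * f a c)
      (fun a c => mul_nonneg (by positivity) (hf0 _ _)), ← hd, ← integral_const_mul]
    exact integral_congr_ae (Eventually.of_forall fun ω => by ring)
  have e3 : ∫ ω, Λ ω * (Λ ω * f (A ω) (C ω)) ∂Q =
      d ^ 2 * ∫ ω, (A ω + C ω + r) * ((A ω + C ω + r) * f (A ω) (C ω)) ∂Q +
        d ^ 2 * ∫ ω, (A ω + C ω + r) * f (A ω) (C ω) ∂Q := by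
    have := h.posterior_two hr hα hγ hf0
    rw [← hd] at this
    rw [← integral_linear_two i5 i2]
    calc _ = _ := integral_congr_ae (Eventually.of_forall fun ω => by ring)
      _ = _ := this
      _ = _ := integral_congr_ae (Eventually.of_forall fun ω => by ring)
  have e4 : ∫ ω, B ω * f (A ω) (C ω) ∂Q = β * ∫ ω, Λ ω * f (A ω) (C ω) ∂Q := by
    rw [(h.shift_B hβ (φ := fun _ a _ c => f a c) (fun _ _ _ => measurable_const)
      fun _ _ _ _ _ => hf0 _ _).1, ← integral_const_mul]
    exact integral_congr_ae (Eventually.of_forall fun ω => by ring)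
  have e5 : ∫ ω, B ω * (Λ ω * f (A ω) (C ω)) ∂Q =
      β * ∫ ω, Λ ω * (Λ ω * f (A ω) (C ω)) ∂Q := by
    rw [(h.shift_B hβ (φ := fun x a _ c => x * f a c) (fun _ _ _ => measurable_id.mul_const _)
      fun x hx _ _ _ => mul_nonneg hx.le (hf0 _ _)).1, ← integral_const_mul]
    exact integral_congr_ae (Eventually.of_forall fun ω => by ring)
  have e6 : ∫ ω, B ω * (B ω * f (A ω) (C ω)) ∂Q =
      β * ∫ ω, B ω * (Λ ω * f (A ω) (C ω)) ∂Q + β * ∫ ω, Λ ω * f (A ω) (C ω) ∂Q := by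
    rw [(h.shift_B hβ (φ := fun _ a b c => b * f a c) (fun _ _ _ => measurable_const)
      fun x hx _ _ _ => mul_nonneg (Nat.cast_nonneg _) (hf0 _ _)).1, ← integral_linear_two i9 i1]
    exact integral_congr_ae (Eventually.of_forall fun ω => by push_cast; ring)
  have e7 : ∫ ω, B ω * ((A ω + C ω + r) * f (A ω) (C ω)) ∂Q =
      β * ∫ ω, Λ ω * ((A ω + C ω + r) * f (A ω) (C ω)) ∂Q := by
    rw [(h.shift_B hβ (φ := fun _ a _ c => (a + c + r) * f a c) (fun _ _ _ => measurable_const)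
      fun x hx _ _ _ => mul_nonneg (by positivity) (hf0 _ _)).1, ← integral_const_mul]
    exact integral_congr_ae (Eventually.of_forall fun ω => by ring)
  constructor
  · have := integral_linear_two i6 i2 1 (-(β * d))
    rw [e4, e1] at this
    calc _ = _ := integral_congr_ae (Eventually.of_forall fun ω => by ring)
      _ = _ := this
      _ = 0 := by ring
  · have := integral_linear_five i7 i8 i5 i2 i6 1 (-2 * (β * d)) ((β * d) ^ 2)
      (-(β * d * (1 + β * d))) 0
    rw [e6, e5, e7, e3, e2, e1] at this
    calc _ = _ := integral_congr_ae (Eventually.of_forall fun ω => by ring)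
      _ = _ := this
      _ = 0 := by ring

/-- The first two moments of a mixed Poisson count. -/
lemma IsMixedPoisson.integral_A (h : IsMixedPoisson Q Λ A B C r α β γ) (hr : 0 < r)
    (hα : 0 ≤ α) : ∫ ω, (A ω : ℝ) ∂Q = α * r ∧
      ∫ ω, (A ω : ℝ) ^ 2 ∂Q = α ^ 2 * (r * (r + 1)) + α * r := by
  have hΛ := h.memLp_fst hr
  have hA := h.memLp_A hr hα
  have e1 : ∫ ω, (A ω : ℝ) ∂Q = α * r := by
    have := (h.shift_A hα (φ := fun _ _ _ _ => 1) (fun _ _ _ => measurable_const)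
      fun _ _ _ _ _ => zero_le_one).1
    simp only [mul_one] at this
    rw [this, integral_mul_const, h.integral_fst hr, mul_comm]
  have e2 : ∫ ω, A ω * Λ ω ∂Q = α * (r * (r + 1)) := by
    rw [(h.shift_A hα (φ := fun x _ _ _ => x) (fun _ _ _ => measurable_id)
      fun _ hx _ _ _ => hx.le).1, ← h.integral_fst_sq hr, ← integral_const_mul]
    exact integral_congr_ae (Eventually.of_forall fun ω => by ring)
  refine ⟨e1, ?_⟩
  have e3 := (h.shift_A hα (φ := fun _ a _ _ => (a : ℝ)) (fun _ _ _ => measurable_const)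
    fun _ _ _ _ _ => Nat.cast_nonneg _).1
  calc ∫ ω, (A ω : ℝ) ^ 2 ∂Q = _ := integral_congr_ae (Eventually.of_forall fun ω => sq _)
    _ = _ := e3
    _ = ∫ ω, (α * (A ω * Λ ω) + α * Λ ω) ∂Q :=
      integral_congr_ae (Eventually.of_forall fun ω => by push_cast; ring)
    _ = α * ∫ ω, A ω * Λ ω ∂Q + α * ∫ ω, Λ ω ∂Q :=
      integral_linear_two (hA.integrable_mul hΛ) (hΛ.integrable one_le_two) α α
    _ = _ := by rw [e2, h.integral_fst hr]; ring

end MixedMoments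

/-! ### Mixed Poisson counts in the model -/

section ModelCounts

variable {Ω : Type*} [MeasurableSpace Ω] {P : Measure Ω} {N : ℝ → Ω → ℕ}

lemma IsPoissonProcess.map_increments (hN : IsPoissonProcess P N) {a b c : ℝ} (ha : 0 ≤ a)
    (hab : a ≤ b) (hbc : b ≤ c) :
    P.map (fun ω => (N a ω, N b ω - N a ω, N c ω - N b ω)) =
      (poissonMeasure a.toNNReal).prod ((poissonMeasure (b - a).toNNReal).prod
        (poissonMeasure (c - b).toNNReal)) := by
  classical
  have hm : Measurable fun ω => (N a ω, N b ω - N a ω, N c ω - N b ω) :=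
    (hN.measurable a).prodMk ((hN.measurable_increment a b).prodMk (hN.measurable_increment b c))
  refine Measure.ext_of_singleton fun ⟨i, j, k⟩ => ?_
  rw [← singleton_prod_singleton, ← singleton_prod_singleton, Measure.prod_prod,
    Measure.prod_prod, Measure.map_apply hm (MeasurableSet.of_discrete)]
  have h2 := hN.measure_inter_increment (ha.trans hab) hbc Finset.univ
    (fun x : Bool => if x then a else b) (fun x _ => by cases x <;> simp [hab])
    (fun x => if x then {i} else {i + j}) {k}
  have h1 := hN.measure_inter_increment ha hab Finset.univ (fun _ : Unit => a)
    (fun _ _ => le_rfl) (fun _ => {i}) {j}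
  have h0 := hN.measure_eq ha {i}
  have e1 : (fun ω => (N a ω, N b ω - N a ω, N c ω - N b ω)) ⁻¹' ({i} ×ˢ ({j} ×ˢ {k})) =
      (⋂ x ∈ (Finset.univ : Finset Bool), N (if x then a else b) ⁻¹'
        (if x then {i} else {i + j})) ∩ {ω | N c ω - N b ω ∈ ({k} : Set ℕ)} := by
    ext ω
    have := hN.mono ω hab
    simp only [mem_preimage, mem_prod, mem_singleton_iff, Finset.mem_univ, mem_inter_iff,
      mem_iInter, mem_ofPred_eq, Bool.forall_bool, forall_const, Bool.false_eq_true, if_false,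
      reduceIte]
    simp only at this
    omega
  have e2 : (⋂ x ∈ (Finset.univ : Finset Bool), N (if x then a else b) ⁻¹'
        (if x then {i} else {i + j})) = (⋂ _x ∈ (Finset.univ : Finset Unit), N a ⁻¹' {i}) ∩
          {ω | N b ω - N a ω ∈ ({j} : Set ℕ)} := by
    ext ω
    have := hN.mono ω hab
    simp only [mem_preimage, mem_singleton_iff, Finset.mem_univ, mem_inter_iff,
      mem_iInter, mem_ofPred_eq, Bool.forall_bool, forall_const, Bool.false_eq_true, if_false,
      reduceIte]
    simp only at this
    omega
  rw [e1, h2, e2, h1, ← mul_assoc, ← h0]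
  simp [iInter_const]

/-- It suffices to identify the joint law of the three counts for each fixed value of the gamma
variable. -/
lemma isMixedPoisson_of_fibre [IsProbabilityMeasure P] (r : ℝ) {α β γ : ℝ}
    {G : ℝ → Ω × Ω → ℕ × ℕ × ℕ} (hG : Measurable fun p : ℝ × Ω × Ω => G p.1 p.2)
    (h : ∀ x, 0 < x → (P.prod P).map (G x) = (poissonMeasure (x * α).toNNReal).prod
      ((poissonMeasure (x * β).toNNReal).prod (poissonMeasure (x * γ).toNNReal)))
    (hr : 0 < r) :
    IsMixedPoisson (modelMeasure r P) Prod.fst (fun p => (G p.1 p.2).1)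
      (fun p => (G p.1 p.2).2.1) (fun p => (G p.1 p.2).2.2) r α β γ where
  measurable_fst := measurable_fst
  measurable_A := hG.fst
  measurable_B := hG.snd.fst
  measurable_C := hG.snd.snd
  pos := modelMeasure_ae_pos hr
  lintegral_eq F hF := by
    have hFm : Measurable fun y : (ℕ × ℕ × ℕ) × ℝ => F y.2 y.1.1 y.1.2.1 y.1.2.2 :=
      measurable_from_prod_countable_right fun y => hF y.1 y.2.1 y.2.2
    have hFG : Measurable fun p : ℝ × Ω × Ω =>
        F p.1 (G p.1 p.2).1 (G p.1 p.2).2.1 (G p.1 p.2).2.2 := hFm.comp (hG.prodMk measurable_fst)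
    rw [modelMeasure, lintegral_prod _ hFG.aemeasurable]
    refine lintegral_congr_ae ?_
    filter_upwards [ae_pos_gammaMeasure r 1] with x hx
    have hGx : Measurable (G x) := hG.comp measurable_prodMk_left
    have hd : ∀ f : ℕ × ℕ × ℕ → ENNReal, Measurable f := fun f => Measurable.of_discrete
    rw [← lintegral_map (μ := P.prod P) (f := fun y : ℕ × ℕ × ℕ => F x y.1 y.2.1 y.2.2)
      (hd _) hGx, h x hx, lintegral_prod _ (hd _).aemeasurable]
    refine lintegral_congr fun a => ?_
    rw [lintegral_prod _ (Measurable.of_discrete).aemeasurable]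

lemma IsPoissonProcess.natCast_eq_add (hN : IsPoissonProcess P N) {a b : ℝ} (hab : a ≤ b) (ω : Ω) :
    (N b ω : ℝ) = N a ω + (N b ω - N a ω : ℕ) := by
  rw [← Nat.cast_add, Nat.add_sub_cancel' (hN.mono ω hab)]

/-- Three values of one Poisson process in the time scale `x ↦ x a`. -/
lemma isMixedPoisson_increments [IsProbabilityMeasure P] (hN : IsPoissonProcess P N) {r : ℝ}
    (hr : 0 < r) {π : Ω × Ω → Ω × Ω} (hπ : MeasurePreserving π (P.prod P) (P.prod P)) {a b c : ℝ}
    (ha : 0 ≤ a) (hab : a ≤ b) (hbc : b ≤ c) :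
    IsMixedPoisson (modelMeasure r P) Prod.fst (fun p => N (p.1 * a) (π p.2).1)
      (fun p => N (p.1 * b) (π p.2).1 - N (p.1 * a) (π p.2).1)
      (fun p => N (p.1 * c) (π p.2).1 - N (p.1 * b) (π p.2).1) r a (b - a) (c - b) := by
  have hm : ∀ a : ℝ, Measurable fun p : ℝ × Ω × Ω => N (p.1 * a) (π p.2).1 := fun a =>
    hN.measurable_comp (measurable_fst.mul_const a) (hπ.measurable.comp measurable_snd).fst
  refine isMixedPoisson_of_fibre r (G := fun x w => (N (x * a) (π w).1,
    N (x * b) (π w).1 - N (x * a) (π w).1, N (x * c) (π w).1 - N (x * b) (π w).1))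
    ((hm a).prodMk (((hm b).sub (hm a)).prodMk ((hm c).sub (hm b)))) (fun x hx => ?_) hr
  have hi : Measurable fun ω => (N (x * a) ω, N (x * b) ω - N (x * a) ω, N (x * c) ω - N (x * b) ω) :=
    (hN.measurable _).prodMk ((hN.measurable_increment _ _).prodMk (hN.measurable_increment _ _))
  rw [mul_sub, mul_sub, ← hN.map_increments (by positivity)
    (mul_le_mul_of_nonneg_left hab hx.le) (mul_le_mul_of_nonneg_left hbc hx.le)]
  calc _ = (((P.prod P).map π).map Prod.fst).map _ := by
        rw [Measure.map_map measurable_fst hπ.measurable, Measure.map_map hi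
          (measurable_fst.comp hπ.measurable)]
        rfl
    _ = _ := by rw [hπ.map_eq, Measure.map_fst_prod, measure_univ, one_smul]

/-- Two values of one Poisson process and one value of an independent one. -/
lemma isMixedPoisson_independent [IsProbabilityMeasure P] (hN : IsPoissonProcess P N) {r : ℝ}
    (hr : 0 < r) {π : Ω × Ω → Ω × Ω} (hπ : MeasurePreserving π (P.prod P) (P.prod P)) {a b c : ℝ}
    (ha : 0 ≤ a) (hab : a ≤ b) (hc : 0 ≤ c) :
    IsMixedPoisson (modelMeasure r P) Prod.fst (fun p => N (p.1 * a) (π p.2).1)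
      (fun p => N (p.1 * b) (π p.2).1 - N (p.1 * a) (π p.2).1)
      (fun p => N (p.1 * c) (π p.2).2) r a (b - a) c := by
  have hm : ∀ a : ℝ, Measurable fun p : ℝ × Ω × Ω => N (p.1 * a) (π p.2).1 := fun a =>
    hN.measurable_comp (measurable_fst.mul_const a) (hπ.measurable.comp measurable_snd).fst
  have hm' : ∀ a : ℝ, Measurable fun p : ℝ × Ω × Ω => N (p.1 * a) (π p.2).2 := fun a =>
    hN.measurable_comp (measurable_fst.mul_const a) (hπ.measurable.comp measurable_snd).snd
  refine isMixedPoisson_of_fibre r (G := fun x w => (N (x * a) (π w).1,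
    N (x * b) (π w).1 - N (x * a) (π w).1, N (x * c) (π w).2))
    ((hm a).prodMk (((hm b).sub (hm a)).prodMk (hm' c))) (fun x hx => ?_) hr
  have hi : Measurable fun ω => (N (x * a) ω, N (x * b) ω - N (x * a) ω) :=
    (hN.measurable _).prodMk (hN.measurable_increment _ _)
  -- the joint law of the first two counts
  have h2 : P.map (fun ω => (N (x * a) ω, N (x * b) ω - N (x * a) ω)) =
      (poissonMeasure (x * a).toNNReal).prod (poissonMeasure (x * b - x * a).toNNReal) := by
    have h3 := congrArg (Measure.map fun y : ℕ × ℕ × ℕ => (y.1, y.2.1))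
      (hN.map_increments (a := x * a) (b := x * b) (c := x * b) (by positivity)
        (mul_le_mul_of_nonneg_left hab hx.le) le_rfl)
    rw [Measure.map_map (Measurable.of_discrete) ((hN.measurable _).prodMk
      ((hN.measurable_increment _ _).prodMk (hN.measurable_increment _ _)))] at h3
    refine Eq.trans ?_ (h3.trans ?_)
    · rfl
    · have e : (fun y : ℕ × ℕ × ℕ => (y.1, y.2.1)) = Prod.map id Prod.fst := rfl
      rw [e, ← Measure.map_prod_map _ _ measurable_id measurable_fst, Measure.map_id,
        Measure.map_fst_prod, measure_univ, one_smul]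
  have hcx : 0 ≤ x * c := mul_nonneg hx.le hc
  have h1 : P.map (N (x * c)) = poissonMeasure (x * c).toNNReal := by
    refine Measure.ext fun D hD => ?_
    rw [Measure.map_apply (hN.measurable _) hD, hN.measure_eq hcx]
  rw [mul_sub]
  calc _ = ((P.prod P).map π).map ((fun y : (ℕ × ℕ) × ℕ => (y.1.1, y.1.2, y.2)) ∘
          Prod.map (fun ω => (N (x * a) ω, N (x * b) ω - N (x * a) ω)) (N (x * c))) := by
        rw [Measure.map_map _ hπ.measurable]
        · rfl
        · exact (Measurable.of_discrete).comp (hi.prodMap (hN.measurable _))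
    _ = (((poissonMeasure (x * a).toNNReal).prod (poissonMeasure (x * b - x * a).toNNReal)).prod
          (poissonMeasure (x * c).toNNReal)).map fun y : (ℕ × ℕ) × ℕ => (y.1.1, y.1.2, y.2) := by
        rw [hπ.map_eq, ← Measure.map_map (Measurable.of_discrete)
          (hi.prodMap (hN.measurable _)), ← Measure.map_prod_map _ _ hi (hN.measurable _), h1, h2]
    _ = _ := by
        refine Measure.ext_of_singleton fun ⟨i, j, k⟩ => ?_
        have e : (fun y : (ℕ × ℕ) × ℕ => (y.1.1, y.1.2, y.2)) ⁻¹' {(i, j, k)} =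
            ({i} ×ˢ {j}) ×ˢ {k} := by
          ext y
          simp [Prod.ext_iff, and_assoc]
        rw [Measure.map_apply (Measurable.of_discrete) (measurableSet_singleton _), e,
          ← singleton_prod_singleton, ← singleton_prod_singleton, Measure.prod_prod,
          Measure.prod_prod, Measure.prod_prod, Measure.prod_prod, mul_assoc]

lemma one_div_sub_one_nonneg {t : ℝ} (ht : 1 < t) : 0 ≤ 1 / (t - 1) :=
  one_div_nonneg.2 (sub_pos.2 ht).le

lemma one_div_sub_one_le {s t : ℝ} (hs : 1 < s) (hst : s ≤ t) : 1 / (t - 1) ≤ 1 / (s - 1) :=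
  one_div_le_one_div_of_le (sub_pos.2 hs) (by linarith)

variable [IsProbabilityMeasure P] {r s t u : ℝ}

/-- The values of the model at three times before `1` are partial sums of mixed Poisson counts. -/
lemma exists_isMixedPoisson_lt (hN : IsPoissonProcess P N) (hr : 0 < r) (hs : 0 ≤ s)
    (hst : s ≤ t) (htu : t ≤ u) (hu : u < 1) : ∃ A B C : ℝ × Ω × Ω → ℕ,
      IsMixedPoisson (modelMeasure r P) Prod.fst A B C r (s / (1 - s))
        (t / (1 - t) - s / (1 - s)) (u / (1 - u) - t / (1 - t)) ∧
      ∀ᵐ p ∂(modelMeasure r P), modelZ N s p = A p ∧ modelZ N t p = A p + B p ∧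
        modelZ N u p = A p + (B p + C p) := by
  have ht1 := htu.trans_lt hu
  have hs1 := hst.trans_lt ht1
  have h1 := div_one_sub_le hst ht1
  have h2 := div_one_sub_le htu hu
  refine ⟨_, _, _, isMixedPoisson_increments hN hr (MeasurePreserving.id _)
    (div_one_sub_nonneg hs hs1) h1 h2, ?_⟩
  filter_upwards [modelMeasure_ae_pos (P := P) hr] with p hp
  have e1 := hN.natCast_eq_add (mul_le_mul_of_nonneg_left h1 hp.le) p.2.1
  have e2 := hN.natCast_eq_add (mul_le_mul_of_nonneg_left h2 hp.le) p.2.1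
  refine ⟨modelZ_of_lt hs1 p, (modelZ_of_lt ht1 p).trans e1, (modelZ_of_lt hu p).trans ?_⟩
  rw [e2, ← add_assoc]
  exact congrArg (· + _) e1

/-- The values of the model at three times after `1` are partial sums of mixed Poisson counts, taken
in the reversed order of time. -/
lemma exists_isMixedPoisson_gt (hN : IsPoissonProcess P N) (hr : 0 < r) (hs : 1 < s)
    (hst : s ≤ t) (htu : t ≤ u) : ∃ A B C : ℝ × Ω × Ω → ℕ,
      IsMixedPoisson (modelMeasure r P) Prod.fst A B C r (1 / (u - 1))
        (1 / (t - 1) - 1 / (u - 1)) (1 / (s - 1) - 1 / (t - 1)) ∧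
      ∀ᵐ p ∂(modelMeasure r P), modelZ N u p = A p ∧ modelZ N t p = A p + B p ∧
        modelZ N s p = A p + (B p + C p) := by
  have ht1 := hs.trans_le hst
  have hu1 := ht1.trans_le htu
  have h1 := one_div_sub_one_le ht1 htu
  have h2 := one_div_sub_one_le hs hst
  refine ⟨_, _, _, isMixedPoisson_increments hN hr Measure.measurePreserving_swap
    (one_div_sub_one_nonneg hu1) h1 h2, ?_⟩
  filter_upwards [modelMeasure_ae_pos (P := P) hr] with p hp
  have e1 := hN.natCast_eq_add (mul_le_mul_of_nonneg_left h1 hp.le) p.2.2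
  have e2 := hN.natCast_eq_add (mul_le_mul_of_nonneg_left h2 hp.le) p.2.2
  refine ⟨modelZ_of_gt hu1 p, (modelZ_of_gt ht1 p).trans e1, (modelZ_of_gt hs p).trans ?_⟩
  rw [e2, ← add_assoc]
  exact congrArg (· + _) e1

/-- Two times before `1` and one after `1`: the count after time `1` is independent of the other two
given the gamma variable. -/
lemma exists_isMixedPoisson_lt_gt (hN : IsPoissonProcess P N) (hr : 0 < r) (hs : 0 ≤ s)
    (hst : s ≤ t) (ht : t < 1) (hu : 1 < u) : ∃ A B C : ℝ × Ω × Ω → ℕ,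
      IsMixedPoisson (modelMeasure r P) Prod.fst A B C r (s / (1 - s))
        (t / (1 - t) - s / (1 - s)) (1 / (u - 1)) ∧
      ∀ᵐ p ∂(modelMeasure r P), modelZ N s p = A p ∧ modelZ N t p = A p + B p ∧
        modelZ N u p = C p := by
  have hs1 := hst.trans_lt ht
  have h1 := div_one_sub_le hst ht
  refine ⟨_, _, _, isMixedPoisson_independent hN hr (MeasurePreserving.id _)
    (div_one_sub_nonneg hs hs1) h1 (one_div_sub_one_nonneg hu), ?_⟩
  filter_upwards [modelMeasure_ae_pos (P := P) hr] with p hp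
  exact ⟨modelZ_of_lt hs1 p, (modelZ_of_lt ht p).trans
    (hN.natCast_eq_add (mul_le_mul_of_nonneg_left h1 hp.le) p.2.1), modelZ_of_gt hu p⟩

/-- One time before `1` and two after `1`: the count before time `1` is independent of the other two
given the gamma variable. -/
lemma exists_isMixedPoisson_gt_lt (hN : IsPoissonProcess P N) (hr : 0 < r) (hs : 0 ≤ s)
    (hs1 : s < 1) (ht : 1 < t) (htu : t ≤ u) : ∃ A B C : ℝ × Ω × Ω → ℕ,
      IsMixedPoisson (modelMeasure r P) Prod.fst A B C r (1 / (u - 1))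
        (1 / (t - 1) - 1 / (u - 1)) (s / (1 - s)) ∧
      ∀ᵐ p ∂(modelMeasure r P), modelZ N u p = A p ∧ modelZ N t p = A p + B p ∧
        modelZ N s p = C p := by
  have hu1 := ht.trans_le htu
  have h1 := one_div_sub_one_le ht htu
  refine ⟨_, _, _, isMixedPoisson_independent hN hr Measure.measurePreserving_swap
    (one_div_sub_one_nonneg hu1) h1 (div_one_sub_nonneg hs hs1), ?_⟩
  filter_upwards [modelMeasure_ae_pos (P := P) hr] with p hp
  exact ⟨modelZ_of_gt hu1 p, (modelZ_of_gt ht p).trans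
    (hN.natCast_eq_add (mul_le_mul_of_nonneg_left h1 hp.le) p.2.2), modelZ_of_lt hs1 p⟩

end ModelCounts

/-! ### The quadratic harness identities in the model -/

section Harness

/-- The affine map that takes the value of the joined process at time `t` to that of the
bi-Poisson process. -/
noncomputable def affineMap (θ t x : ℝ) : ℝ :=
  if t < 1 then θ * (1 - t) * x - t / θ
  else if t = 1 then θ * x - 1 / θ else θ * (t - 1) * x - 1 / θ

lemma affineMap_of_lt {θ t : ℝ} (ht : t < 1) (x : ℝ) :
    affineMap θ t x = θ * (1 - t) * x - t / θ := by simp [affineMap, ht]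

lemma affineMap_one (θ x : ℝ) : affineMap θ 1 x = θ * x - 1 / θ := by simp [affineMap]

lemma affineMap_of_gt {θ t : ℝ} (ht : 1 < t) (x : ℝ) :
    affineMap θ t x = θ * (t - 1) * x - 1 / θ := by simp [affineMap, ht.not_gt, ht.ne']

/-- The deviation of the value at time `t` from the linear interpolation between the values at
times `s` and `u`. -/
noncomputable def harnessDev (θ s t u x y z : ℝ) : ℝ :=
  affineMap θ t y - ((u - t) / (u - s) * affineMap θ s x + (t - s) / (u - s) * affineMap θ u z)

/-- The conditional variance of the value at time `t` given the values at times `s` and `u`. -/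
noncomputable def harnessVar (θ s t u x z : ℝ) : ℝ :=
  (u - t) * (t - s) / (u - s) *
    (1 + θ * ((u * affineMap θ s x - s * affineMap θ u z) / (u - s)) +
      θ * ((affineMap θ u z - affineMap θ s x) / (u - s)))

/-- Rescaling a pair of identities for a conditional mean and a conditional variance. -/
lemma integral_harness_congr {E : Type*} [MeasurableSpace E] {Q : Measure E} {D V G D₀ V₀ G₀ : E → ℝ}
    (κ : ℝ) (h : ∫ ω, D₀ ω * G₀ ω ∂Q = 0 ∧ ∫ ω, (D₀ ω ^ 2 - V₀ ω) * G₀ ω ∂Q = 0)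
    (hD : ∀ᵐ ω ∂Q, D ω = κ * D₀ ω ∧ V ω = κ ^ 2 * V₀ ω ∧ G ω = G₀ ω) :
    ∫ ω, D ω * G ω ∂Q = 0 ∧ ∫ ω, (D ω ^ 2 - V ω) * G ω ∂Q = 0 := by
  constructor
  · calc ∫ ω, D ω * G ω ∂Q = ∫ ω, κ * (D₀ ω * G₀ ω) ∂Q := by
          refine integral_congr_ae (hD.mono fun ω hω => ?_)
          simp only [hω.1, hω.2.2]
          ring
      _ = 0 := by rw [integral_const_mul, h.1, mul_zero]
  · calc ∫ ω, (D ω ^ 2 - V ω) * G ω ∂Q = ∫ ω, κ ^ 2 * ((D₀ ω ^ 2 - V₀ ω) * G₀ ω) ∂Q := by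
          refine integral_congr_ae (hD.mono fun ω hω => ?_)
          simp only [hω.1, hω.2.1, hω.2.2]
          ring
      _ = 0 := by rw [integral_const_mul, h.2, mul_zero]

variable {Ω : Type*} [MeasurableSpace Ω] {P : Measure Ω} [IsProbabilityMeasure P]
  {N : ℝ → Ω → ℕ} {θ s t u : ℝ}

/-- The identities characterizing the conditional mean and the conditional variance of the model at
time `t` given its values at times `s` and `u`, tested against nonnegative functions. -/
theorem model_harness (hN : IsPoissonProcess P N) (hθ : 0 < θ) (hs : 0 ≤ s) (hst : s < t)
    (htu : t < u) {G : ℝ → ℝ → ℝ} (hG : Measurable fun x : ℝ × ℝ => G x.1 x.2) {K : ℝ}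
    (hG0 : ∀ x z, 0 ≤ G x z) (hGK : ∀ x z, G x z ≤ K) :
    ∫ p, harnessDev θ s t u (modelZ N s p) (modelZ N t p) (modelZ N u p) *
        G (modelZ N s p) (modelZ N u p) ∂(modelMeasure (1 / θ ^ 2) P) = 0 ∧
      ∫ p, (harnessDev θ s t u (modelZ N s p) (modelZ N t p) (modelZ N u p) ^ 2 -
        harnessVar θ s t u (modelZ N s p) (modelZ N u p)) *
        G (modelZ N s p) (modelZ N u p) ∂(modelMeasure (1 / θ ^ 2) P) = 0 := by
  have hr : 0 < 1 / θ ^ 2 := by positivity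
  have hprob := isProbabilityMeasure_modelMeasure (P := P) hr
  have hθ' := hθ.ne'
  have hus : u - s ≠ 0 := (sub_pos.2 (hst.trans htu)).ne'
  have hGl : ∀ x, Measurable (G x) := fun x => hG.comp measurable_prodMk_left
  have hGr : ∀ z, Measurable fun x => G x z := fun z => hG.comp measurable_prodMk_right
  rcases lt_trichotomy u 1 with hu | rfl | hu
  · -- all three times precede time `1`: the middle count is a binomial thinning
    have ht1 := htu.trans hu
    have hs1 := hst.trans ht1
    have ht' : 1 - t ≠ 0 := (sub_pos.2 ht1).ne'
    have hs' : 1 - s ≠ 0 := (sub_pos.2 hs1).ne'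
    have hu' : 1 - u ≠ 0 := (sub_pos.2 hu).ne'
    obtain ⟨A, B, C, h, hABC⟩ := exists_isMixedPoisson_lt hN hr hs hst.le htu.le hu
    refine integral_harness_congr θ (h.moments_thinning hr
      (sub_nonneg.2 (div_one_sub_le hst.le ht1)) (sub_nonneg.2 (div_one_sub_le htu.le hu))
      (p := (u - t) * (1 - s) / (u - s)) (q := (t - s) * (1 - u) / (u - s)) ?_
      (f := fun a n => G a (a + n)) (fun _ _ => hG0 _ _) (fun _ _ => hGK _ _)) ?_
    · field_simp
      ring
    · filter_upwards [hABC] with p hp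
      obtain ⟨e1, e2, e3⟩ := hp
      rw [e1, e2, e3]
      refine ⟨?_, ?_, by push_cast; rfl⟩
      · rw [harnessDev, affineMap_of_lt hs1, affineMap_of_lt ht1, affineMap_of_lt hu]
        field_simp
        ring
      · rw [harnessVar, affineMap_of_lt hs1, affineMap_of_lt hu]
        field_simp
        ring
  · -- the last time is `1`: the middle count has a Poisson increment given the gamma variable
    have hs1 := hst.trans htu
    have ht' : 1 - t ≠ 0 := (sub_pos.2 htu).ne'
    have hs' : 1 - s ≠ 0 := (sub_pos.2 hs1).ne'
    obtain ⟨A, B, C, h, hABC⟩ := exists_isMixedPoisson_lt hN hr hs hst.le le_rfl htu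
    refine integral_harness_congr (θ * (1 - t)) (h.moments_poisson hr
      (sub_nonneg.2 (div_one_sub_le hst.le htu)) (f := fun a x => G a x) (fun _ => hGl _)
      (fun _ _ => hG0 _ _) (fun _ _ => hGK _ _)) ?_
    filter_upwards [hABC] with p hp
    obtain ⟨e1, e2, -⟩ := hp
    rw [e1, e2, modelZ_one]
    refine ⟨?_, ?_, rfl⟩
    · rw [harnessDev, affineMap_of_lt hs1, affineMap_of_lt htu, affineMap_one]
      field_simp
      ring
    · rw [harnessVar, affineMap_of_lt hs1, affineMap_one]
      field_simp
      ring
  · have hu' : u - 1 ≠ 0 := (sub_pos.2 hu).ne'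
    rcases lt_trichotomy t 1 with ht | rfl | ht
    · -- time `1` lies between `t` and `u`: the increment after `s` is negative binomial
      have hs1 := hst.trans ht
      have ht' : 1 - t ≠ 0 := (sub_pos.2 ht).ne'
      have hs' : 1 - s ≠ 0 := (sub_pos.2 hs1).ne'
      obtain ⟨A, B, C, h, hABC⟩ := exists_isMixedPoisson_lt_gt hN hr hs hst.le ht hu
      refine integral_harness_congr (θ * (1 - t)) (h.moments_negBinomial hr
        (div_one_sub_nonneg hs hs1) (sub_nonneg.2 (div_one_sub_le hst.le ht))
        (one_div_sub_one_nonneg hu) (d := (1 - s) * (u - 1) / (u - s)) ?_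
        (f := fun a c => G a c) (fun _ _ => hG0 _ _) (fun _ _ => hGK _ _)) ?_
      · have hne : 1 + (s / (1 - s) + 1 / (u - 1)) = (u - s) / ((1 - s) * (u - 1)) := by
          field_simp
          ring
        rw [hne, one_div_div]
      · filter_upwards [hABC] with p hp
        obtain ⟨e1, e2, e3⟩ := hp
        rw [e1, e2, e3]
        refine ⟨?_, ?_, rfl⟩
        · rw [harnessDev, affineMap_of_lt hs1, affineMap_of_lt ht, affineMap_of_gt hu]
          field_simp
          ring
        · rw [harnessVar, affineMap_of_lt hs1, affineMap_of_gt hu]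
          field_simp
          ring
    · -- the middle time is `1`: the gamma posterior given two counts
      have hs' : 1 - s ≠ 0 := (sub_pos.2 hst).ne'
      obtain ⟨A, B, C, h, hABC⟩ := exists_isMixedPoisson_lt_gt hN hr hs le_rfl hst hu
      refine integral_harness_congr θ (h.moments_gamma hr
        (div_one_sub_nonneg hs hst) (one_div_sub_one_nonneg hu)
        (d := (1 - s) * (u - 1) / (u - s)) ?_
        (f := fun a c => G a c) (fun _ _ => hG0 _ _) (fun _ _ => hGK _ _)) ?_
      · have hne : 1 + (s / (1 - s) + 1 / (u - 1)) = (u - s) / ((1 - s) * (u - 1)) := by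
          field_simp
          ring
        rw [hne, one_div_div]
      · filter_upwards [hABC] with p hp
        obtain ⟨e1, -, e3⟩ := hp
        rw [e1, modelZ_one, e3]
        refine ⟨?_, ?_, rfl⟩
        · rw [harnessDev, affineMap_of_lt hst, affineMap_one, affineMap_of_gt hu]
          field_simp
          ring
        · rw [harnessVar, affineMap_of_lt hst, affineMap_of_gt hu]
          field_simp
          ring
    · have ht' : t - 1 ≠ 0 := (sub_pos.2 ht).ne'
      rcases lt_trichotomy s 1 with hs1 | rfl | hs1
      · -- time `1` lies between `s` and `t`: the case of `t < 1 < u` with time reversed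
        have hs' : 1 - s ≠ 0 := (sub_pos.2 hs1).ne'
        obtain ⟨A, B, C, h, hABC⟩ := exists_isMixedPoisson_gt_lt hN hr hs hs1 ht htu.le
        refine integral_harness_congr (θ * (t - 1)) (h.moments_negBinomial hr
          (one_div_sub_one_nonneg hu) (sub_nonneg.2 (one_div_sub_one_le ht htu.le))
          (div_one_sub_nonneg hs hs1) (d := (1 - s) * (u - 1) / (u - s)) ?_
          (f := fun a c => G c a) (fun _ _ => hG0 _ _) (fun _ _ => hGK _ _)) ?_
        · have hne : 1 + (1 / (u - 1) + s / (1 - s)) = (u - s) / ((1 - s) * (u - 1)) := by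
            field_simp
            ring
          rw [hne, one_div_div]
        · filter_upwards [hABC] with p hp
          obtain ⟨e1, e2, e3⟩ := hp
          rw [e1, e2, e3]
          refine ⟨?_, ?_, rfl⟩
          · rw [harnessDev, affineMap_of_lt hs1, affineMap_of_gt ht, affineMap_of_gt hu]
            field_simp
            ring
          · rw [harnessVar, affineMap_of_lt hs1, affineMap_of_gt hu]
            field_simp
            ring
      · -- the first time is `1`: the case `u = 1` with time reversed
        obtain ⟨A, B, C, h, hABC⟩ := exists_isMixedPoisson_gt hN hr ht le_rfl htu.le
        refine integral_harness_congr (θ * (t - 1)) (h.moments_poisson hr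
          (sub_nonneg.2 (one_div_sub_one_le ht htu.le)) (f := fun a x => G x a) (fun _ => hGr _)
          (fun _ _ => hG0 _ _) (fun _ _ => hGK _ _)) ?_
        filter_upwards [hABC] with p hp
        obtain ⟨e1, e2, -⟩ := hp
        rw [e1, e2, modelZ_one]
        refine ⟨?_, ?_, rfl⟩
        · rw [harnessDev, affineMap_one, affineMap_of_gt ht, affineMap_of_gt hu]
          field_simp
          ring
        · rw [harnessVar, affineMap_one, affineMap_of_gt hu]
          field_simp
          ring
      · -- all three times follow time `1`: binomial thinning again
        have hs' : s - 1 ≠ 0 := (sub_pos.2 hs1).ne'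
        obtain ⟨A, B, C, h, hABC⟩ := exists_isMixedPoisson_gt hN hr hs1 hst.le htu.le
        refine integral_harness_congr θ (h.moments_thinning hr
          (sub_nonneg.2 (one_div_sub_one_le ht htu.le))
          (sub_nonneg.2 (one_div_sub_one_le hs1 hst.le))
          (p := (t - s) * (u - 1) / (u - s)) (q := (u - t) * (s - 1) / (u - s)) ?_
          (f := fun a n => G (a + n) a) (fun _ _ => hG0 _ _) (fun _ _ => hGK _ _)) ?_
        · field_simp
          ring
        · filter_upwards [hABC] with p hp
          obtain ⟨e1, e2, e3⟩ := hp
          rw [e1, e2, e3]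
          refine ⟨?_, ?_, by push_cast; rfl⟩
          · rw [harnessDev, affineMap_of_gt hs1, affineMap_of_gt ht, affineMap_of_gt hu]
            field_simp
            ring
          · rw [harnessVar, affineMap_of_gt hs1, affineMap_of_gt hu]
            field_simp
            ring

/-- The first two moments of the model after the affine transformation. -/
theorem model_moments (hN : IsPoissonProcess P N) (hθ : 0 < θ) (ht : 0 ≤ t) :
    MemLp (fun p => affineMap θ t (modelZ N t p)) 2 (modelMeasure (1 / θ ^ 2) P) ∧
      ∫ p, affineMap θ t (modelZ N t p) ∂(modelMeasure (1 / θ ^ 2) P) = 0 ∧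
      ∫ p, affineMap θ t (modelZ N t p) ^ 2 ∂(modelMeasure (1 / θ ^ 2) P) = t := by
  have hr : 0 < 1 / θ ^ 2 := by positivity
  have hprob := isProbabilityMeasure_modelMeasure (P := P) hr
  have hθ' := hθ.ne'
  -- the moments of an affine function of a variable with known first two moments
  have key : ∀ (W : ℝ × Ω × Ω → ℝ) (m₁ m₂ a b : ℝ), MemLp W 2 (modelMeasure (1 / θ ^ 2) P) →
      ∫ p, W p ∂(modelMeasure (1 / θ ^ 2) P) = m₁ →
      ∫ p, W p ^ 2 ∂(modelMeasure (1 / θ ^ 2) P) = m₂ →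
      (∀ᵐ p ∂(modelMeasure (1 / θ ^ 2) P), affineMap θ t (modelZ N t p) = a * W p - b) →
      a * m₁ = b → a ^ 2 * m₂ - b ^ 2 = t →
      MemLp (fun p => affineMap θ t (modelZ N t p)) 2 (modelMeasure (1 / θ ^ 2) P) ∧
        ∫ p, affineMap θ t (modelZ N t p) ∂(modelMeasure (1 / θ ^ 2) P) = 0 ∧
        ∫ p, affineMap θ t (modelZ N t p) ^ 2 ∂(modelMeasure (1 / θ ^ 2) P) = t := by
    intro W m₁ m₂ a b hW h1 h2 hae hm hv
    have hWi := hW.integrable one_le_two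
    refine ⟨((hW.const_mul a).sub (memLp_const b)).ae_eq (hae.mono fun p hp => hp.symm), ?_, ?_⟩
    · rw [integral_congr_ae hae, integral_sub (hWi.const_mul a) (integrable_const b),
        integral_const_mul, h1, hm, integral_const, probReal_univ, one_smul, sub_self]
    · have := integral_linear_five hW.integrable_sq hWi (integrable_const (1 : ℝ))
        (integrable_const (0 : ℝ)) (integrable_const (0 : ℝ)) (a ^ 2) (-2 * a * b) (b ^ 2) 0 0
      simp only [h1, h2, integral_const, probReal_univ, one_smul] at this
      calc _ = _ := integral_congr_ae (hae.mono fun p hp => by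
              simp only [hp]
              ring)
        _ = _ := this
        _ = a ^ 2 * m₂ - 2 * b * (a * m₁) + b ^ 2 := by ring
        _ = t := by rw [hm, ← hv]; ring
  rcases lt_trichotomy t 1 with h1 | rfl | h1
  · have ht' : 1 - t ≠ 0 := (sub_pos.2 h1).ne'
    obtain ⟨A, B, C, h, hABC⟩ := exists_isMixedPoisson_lt hN hr ht le_rfl le_rfl h1
    have hα := div_one_sub_nonneg ht h1
    obtain ⟨m1, m2⟩ := h.integral_A hr hα
    refine key _ _ _ (θ * (1 - t)) (t / θ) (h.memLp_A hr hα) m1 m2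
      (hABC.mono fun p hp => by rw [hp.1, affineMap_of_lt h1]) ?_ ?_
    · field_simp
    · field_simp
      ring
  · obtain ⟨A, B, C, h, -⟩ := exists_isMixedPoisson_lt hN hr le_rfl le_rfl le_rfl zero_lt_one
    refine key _ _ _ θ (1 / θ) (h.memLp_fst hr) (h.integral_fst hr) (h.integral_fst_sq hr)
      (Eventually.of_forall fun p => by rw [modelZ_one, affineMap_one]) ?_ ?_
    · field_simp
    · field_simp
      ring
  · have ht' : t - 1 ≠ 0 := (sub_pos.2 h1).ne'
    obtain ⟨A, B, C, h, hABC⟩ := exists_isMixedPoisson_gt hN hr h1 le_rfl le_rfl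
    have hα := one_div_sub_one_nonneg h1
    obtain ⟨m1, m2⟩ := h.integral_A hr hα
    refine key _ _ _ (θ * (t - 1)) (1 / θ) (h.memLp_A hr hα) m1 m2
      (hABC.mono fun p hp => by rw [hp.1, affineMap_of_gt h1]) ?_ ?_
    · field_simp
    · field_simp
      ring

end Harness

/-! ### From the model to every joined process -/

section Transfer

lemma affineTransform_apply {Ω : Type*} (θ : ℝ) (Z : ℝ → Ω → ℝ) (t : ℝ) (ω : Ω) :
    affineTransform θ Z t ω = affineMap θ t (Z t ω) := by
  simp only [affineTransform, affineMap]
  split_ifs with h₁ h₂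
  · rfl
  · rw [h₂]
  · rfl

lemma measurable_affineMap (θ t : ℝ) : Measurable (affineMap θ t) := by
  unfold affineMap
  split_ifs <;> fun_prop

lemma exists_affineMap_eq {θ : ℝ} (hθ : θ ≠ 0) (t : ℝ) :
    ∃ a b : ℝ, a ≠ 0 ∧ ∀ x, affineMap θ t x = a * x - b := by
  rcases lt_trichotomy t 1 with ht | rfl | ht
  · exact ⟨θ * (1 - t), t / θ, mul_ne_zero hθ (sub_ne_zero.2 ht.ne'), affineMap_of_lt ht⟩
  · exact ⟨θ, 1 / θ, hθ, affineMap_one θ⟩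
  · exact ⟨θ * (t - 1), 1 / θ, mul_ne_zero hθ (sub_ne_zero.2 ht.ne'), affineMap_of_gt ht⟩

lemma measurable_harnessDev (θ s t u : ℝ) :
    Measurable fun x : ℝ × ℝ × ℝ => harnessDev θ s t u x.1 x.2.1 x.2.2 := by
  have h := measurable_affineMap θ
  unfold harnessDev
  exact ((h t).comp (by fun_prop)).sub ((((h s).comp measurable_fst).const_mul _).add
    (((h u).comp (by fun_prop)).const_mul _))

lemma measurable_harnessVar (θ s t u : ℝ) :
    Measurable fun x : ℝ × ℝ × ℝ => harnessVar θ s t u x.1 x.2.2 := by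
  have hs : Measurable fun x : ℝ × ℝ × ℝ => affineMap θ s x.1 :=
    (measurable_affineMap θ s).comp measurable_fst
  have hu : Measurable fun x : ℝ × ℝ × ℝ => affineMap θ u x.2.2 :=
    (measurable_affineMap θ u).comp (by fun_prop)
  unfold harnessVar
  fun_prop

variable {Ω : Type*} {θ : ℝ} {Z : ℝ → Ω → ℝ}

/-- The affine change of scale and its inverse generate the same σ-algebras. -/
lemma sigmaOn_affineTransform (hθ : θ ≠ 0) (S : Set ℝ) :
    sigmaOn (affineTransform θ Z) S = sigmaOn Z S := by
  refine iSup_congr fun r => iSup_congr fun _ => ?_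
  have hX : affineTransform θ Z r = affineMap θ r ∘ Z r :=
    funext fun ω => affineTransform_apply θ Z r ω
  obtain ⟨a, b, ha, hab⟩ := exists_affineMap_eq hθ r
  apply le_antisymm
  · rw [hX]
    exact ((measurable_affineMap θ r).comp (comap_measurable (Z r))).comap_le
  · have hZ : Z r = (fun x => a⁻¹ * (x + b)) ∘ affineTransform θ Z r := by
      funext ω
      simp only [Function.comp_apply, affineTransform_apply, hab]
      field_simp
      ring
    have : Measurable[MeasurableSpace.comap (affineTransform θ Z r) inferInstance] (Z r) := by
      rw [hZ]
      exact (by fun_prop : Measurable fun x : ℝ => a⁻¹ * (x + b)).comp (comap_measurable _)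
    exact this.comap_le

variable [MeasurableSpace Ω] {P : Measure Ω}

lemma IsMarkovOn.affineTransform (hθ : θ ≠ 0) {I : Set ℝ} (hM : IsMarkovOn P I Z) :
    IsMarkovOn P I (affineTransform θ Z) := by
  intro s hs t ht hst A hA
  rw [sigmaOn_affineTransform hθ, sigmaOn_affineTransform hθ]
  have : BiPoisson.affineTransform θ Z t ⁻¹' A = Z t ⁻¹' (affineMap θ t ⁻¹' A) := by
    ext ω
    simp only [mem_preimage, affineTransform_apply]
  rw [this]
  exact hM s hs t ht hst _ (measurable_affineMap θ t hA)

variable [IsProbabilityMeasure P]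

lemma IsJoinedProcess.moments (hZ : IsJoinedProcess P θ Z) (hθ : 0 < θ) {t : ℝ} (ht : 0 ≤ t) :
    MemLp (fun ω => affineMap θ t (Z t ω)) 2 P ∧ ∫ ω, affineMap θ t (Z t ω) ∂P = 0 ∧
      ∫ ω, affineMap θ t (Z t ω) ^ 2 ∂P = t := by
  have hN := isPoissonProcess_countPoints
  have hprob := isProbabilityMeasure_modelMeasure (P := pointMeasure) (r := 1 / θ ^ 2)
    (by positivity)
  have hQ := isJoinedProcess_modelZ hN hθ
  have hmap := map_fst_eq_of_map_pair (hZ.measurable t ht) (hZ.measurable t ht)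
    (hQ.measurable t ht) (hQ.measurable t ht) (hZ.map_pair_eq hQ ht le_rfl)
  have ha := measurable_affineMap θ t
  obtain ⟨h₁, h₂, h₃⟩ := model_moments hN hθ ht
  have hint : ∀ {φ : ℝ → ℝ}, Measurable φ → ∫ ω, φ (Z t ω) ∂P =
      ∫ p, φ (modelZ countPoints t p) ∂(modelMeasure (1 / θ ^ 2) pointMeasure) := fun hφ => by
    rw [← integral_map (hZ.measurable t ht).aemeasurable hφ.aestronglyMeasurable, hmap,
      integral_map (hQ.measurable t ht).aemeasurable hφ.aestronglyMeasurable]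
  refine ⟨?_, (hint ha).trans h₂, (hint (ha.pow_const 2)).trans h₃⟩
  refine (memLp_map_measure_iff (g := affineMap θ t) ha.aestronglyMeasurable
    (hZ.measurable t ht).aemeasurable).1 ?_
  rw [hmap]
  exact (memLp_map_measure_iff ha.aestronglyMeasurable (hQ.measurable t ht).aemeasurable).2 h₁

lemma IsJoinedProcess.memLp_harnessDev (hZ : IsJoinedProcess P θ Z) (hθ : 0 < θ) {s t u : ℝ}
    (hs : 0 ≤ s) (ht : 0 ≤ t) (hu : 0 ≤ u) :
    MemLp (fun ω => harnessDev θ s t u (Z s ω) (Z t ω) (Z u ω)) 2 P :=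
  (hZ.moments hθ ht).1.sub
    (((hZ.moments hθ hs).1.const_mul _).add ((hZ.moments hθ hu).1.const_mul _))

lemma IsJoinedProcess.memLp_harnessVar (hZ : IsJoinedProcess P θ Z) (hθ : 0 < θ) {s t u : ℝ}
    (hs : 0 ≤ s) (hu : 0 ≤ u) :
    MemLp (fun ω => harnessVar θ s t u (Z s ω) (Z u ω)) 2 P := by
  have key : ∀ a b c : ℝ, MemLp (fun ω => c + (a * affineMap θ s (Z s ω) +
      b * affineMap θ u (Z u ω))) 2 P := fun a b c =>
    (memLp_const c).add (((hZ.moments hθ hs).1.const_mul a).add ((hZ.moments hθ hu).1.const_mul b))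
  have hκ : ∀ ω, harnessVar θ s t u (Z s ω) (Z u ω) =
      (u - t) * (t - s) / (u - s) + ((u - t) * (t - s) / (u - s) * (θ * (u - 1) / (u - s)) *
        affineMap θ s (Z s ω) + (u - t) * (t - s) / (u - s) * (θ * (1 - s) / (u - s)) *
        affineMap θ u (Z u ω)) := fun ω => by
    unfold harnessVar
    ring
  simp only [hκ]
  exact key _ _ _

/-- The harness identities hold for every joined process, tested against bounded functions of the
values at the two outer times. -/
lemma IsJoinedProcess.integral_harness (hZ : IsJoinedProcess P θ Z) (hθ : 0 < θ) {s t u : ℝ}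
    (hs : 0 ≤ s) (hst : s < t) (htu : t < u) {g k : ℝ → ℝ} (hg : Measurable g)
    (hk : Measurable k) (hg1 : ∀ x, |g x| ≤ 1) (hk1 : ∀ x, |k x| ≤ 1) :
    ∫ ω, harnessDev θ s t u (Z s ω) (Z t ω) (Z u ω) * (g (Z s ω) * k (Z u ω)) ∂P = 0 ∧
      ∫ ω, (harnessDev θ s t u (Z s ω) (Z t ω) (Z u ω) ^ 2 -
        harnessVar θ s t u (Z s ω) (Z u ω)) * (g (Z s ω) * k (Z u ω)) ∂P = 0 := by
  have hN := isPoissonProcess_countPoints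
  have ht : 0 ≤ t := hs.trans hst.le
  have hu : 0 ≤ u := ht.trans htu.le
  have hprob := isProbabilityMeasure_modelMeasure (P := pointMeasure) (r := 1 / θ ^ 2)
    (by positivity)
  have hQ := isJoinedProcess_modelZ hN hθ
  have hmap := hZ.map_triple_eq hQ hs hst.le htu.le
  have hint : ∀ {φ : ℝ × ℝ × ℝ → ℝ}, Measurable φ → ∫ ω, φ (Z s ω, Z t ω, Z u ω) ∂P =
      ∫ p, φ (modelZ countPoints s p, modelZ countPoints t p, modelZ countPoints u p)
        ∂(modelMeasure (1 / θ ^ 2) pointMeasure) := fun hφ => by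
    rw [← integral_map (φ := fun ω => (Z s ω, Z t ω, Z u ω)) ((hZ.measurable s hs).prodMk
      ((hZ.measurable t ht).prodMk (hZ.measurable u hu))).aemeasurable hφ.aestronglyMeasurable,
      hmap, integral_map ((hQ.measurable s hs).prodMk
      ((hQ.measurable t ht).prodMk (hQ.measurable u hu))).aemeasurable hφ.aestronglyMeasurable]
  have hD := measurable_harnessDev θ s t u
  have hV := measurable_harnessVar θ s t u
  have hpos : ∀ {G : ℝ → ℝ → ℝ}, (Measurable fun x : ℝ × ℝ => G x.1 x.2) → ∀ K : ℝ,
      (∀ x z, 0 ≤ G x z) → (∀ x z, G x z ≤ K) →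
      ∫ ω, harnessDev θ s t u (Z s ω) (Z t ω) (Z u ω) * G (Z s ω) (Z u ω) ∂P = 0 ∧
      ∫ ω, (harnessDev θ s t u (Z s ω) (Z t ω) (Z u ω) ^ 2 -
        harnessVar θ s t u (Z s ω) (Z u ω)) * G (Z s ω) (Z u ω) ∂P = 0 := by
    intro G hG K hG0 hGK
    have hG' : Measurable fun x : ℝ × ℝ × ℝ => G x.1 x.2.2 :=
      hG.comp (measurable_fst.prodMk (measurable_snd.comp measurable_snd))
    have h := model_harness hN hθ hs hst htu hG hG0 hGK
    exact ⟨(hint (hD.mul hG')).trans h.1, (hint (((hD.pow_const 2).sub hV).mul hG')).trans h.2⟩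
  -- a test function with values in `[-1, 1]` is the difference of two nonnegative ones
  have habs : ∀ x z, |g x * k z| ≤ 1 := fun x z => by
    rw [abs_mul]
    exact mul_le_one₀ (hg1 x) (abs_nonneg _) (hk1 z)
  have h₁ := hpos (G := fun x z => g x * k z + 1)
    (((hg.comp measurable_fst).mul (hk.comp measurable_snd)).add_const 1) 2
    (fun x z => by linarith [(abs_le.1 (habs x z)).1])
    (fun x z => by linarith [(abs_le.1 (habs x z)).2])
  have h₂ := hpos (G := fun _ _ => 1) measurable_const 1 (fun _ _ => zero_le_one) fun _ _ => le_rfl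
  have hsplit : ∀ W : Ω → ℝ, Integrable W P →
      ∫ ω, W ω * (g (Z s ω) * k (Z u ω) + 1) ∂P = 0 → ∫ ω, W ω * 1 ∂P = 0 →
      ∫ ω, W ω * (g (Z s ω) * k (Z u ω)) ∂P = 0 := by
    intro W hW h h'
    have hm : Measurable fun ω => g (Z s ω) * k (Z u ω) :=
      (hg.comp (hZ.measurable s hs)).mul (hk.comp (hZ.measurable u hu))
    have hi : Integrable (fun ω => W ω * (g (Z s ω) * k (Z u ω))) P :=
      hW.mul_bdd (c := 1) hm.aestronglyMeasurable (Eventually.of_forall fun ω => habs _ _)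
    simp only [mul_add, mul_one] at h h'
    rwa [integral_add hi hW, h', add_zero] at h
  have hDm := hZ.memLp_harnessDev hθ hs ht hu
  exact ⟨hsplit _ (hDm.integrable one_le_two) h₁.1 h₂.1, hsplit _
    (hDm.integrable_sq.sub ((hZ.memLp_harnessVar hθ hs hu).integrable one_le_two)) h₁.2 h₂.2⟩

/-- The deviation from the interpolation, and its square minus the claimed variance, have conditional
expectation zero given the past up to `s` and the future from `u` on. -/
lemma IsJoinedProcess.condExp_harness (hZ : IsJoinedProcess P θ Z) (hθ : 0 < θ) {s t u : ℝ}
    (hs : 0 ≤ s) (hst : s < t) (htu : t < u) :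
    P[fun ω => harnessDev θ s t u (Z s ω) (Z t ω) (Z u ω) | sigmaOn Z (Icc 0 s ∪ Ici u)]
        =ᵐ[P] 0 ∧
      P[fun ω => harnessDev θ s t u (Z s ω) (Z t ω) (Z u ω) ^ 2 -
        harnessVar θ s t u (Z s ω) (Z u ω) | sigmaOn Z (Icc 0 s ∪ Ici u)] =ᵐ[P] 0 := by
  have ht : 0 ≤ t := hs.trans hst.le
  have hu : 0 ≤ u := ht.trans htu.le
  have hD := measurable_harnessDev θ s t u
  have hDm := hZ.memLp_harnessDev hθ hs ht hu
  constructor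
  · exact hZ.markov.condExp_two_sided_eq_zero hZ.measurable hs hst.le htu.le hD
      (hDm.integrable one_le_two)
      fun g k hg hk hg1 hk1 => (hZ.integral_harness hθ hs hst htu hg hk hg1 hk1).1
  · exact hZ.markov.condExp_two_sided_eq_zero hZ.measurable hs hst.le htu.le
      (ψ := fun x y z => harnessDev θ s t u x y z ^ 2 - harnessVar θ s t u x z)
      ((hD.pow_const 2).sub (measurable_harnessVar θ s t u))
      (hDm.integrable_sq.sub ((hZ.memLp_harnessVar hθ hs hu).integrable one_le_two))
      fun g k hg hk hg1 hk1 => (hZ.integral_harness hθ hs hst htu hg hk hg1 hk1).2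

end Transfer

/-! ### The bi-Poisson property -/

section Conclusion

/-- A process with orthogonal increments of variance `r - u` is right-continuous in `L²`; hence its
value at `u` is determined, up to a null set, by its values at times after `u`. -/
lemma aestronglyMeasurable_sigmaOn_Ioi {Ω : Type*} [mΩ : MeasurableSpace Ω] {P : Measure Ω}
    {X : ℝ → Ω → ℝ} {u : ℝ} (hX : ∀ r, u ≤ r → Measurable (X r)) (hX2 : ∀ r, u ≤ r → MemLp (X r) 2 P)
    (hincr : ∀ r, u ≤ r → ∫ ω, (X r ω - X u ω) ^ 2 ∂P = r - u) :
    AEStronglyMeasurable[sigmaOn X (Ioi u)] (X u) P := by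
  obtain ⟨r, -, hr, hlim⟩ := exists_seq_strictAnti_tendsto u
  have hL2 : Tendsto (fun n => eLpNorm (X (r n) - X u) 2 P) atTop (𝓝 0) := by
    have h : ∀ n, eLpNorm (X (r n) - X u) 2 P = ENNReal.ofReal ((r n - u) ^ (2 : ℝ)⁻¹) := fun n => by
      rw [((hX2 _ (hr n).le).sub (hX2 u le_rfl)).eLpNorm_eq_integral_rpow_norm two_ne_zero
        ENNReal.ofNat_ne_top, ← hincr _ (hr n).le]
      simp
    simp only [h]
    have h0 : Tendsto (fun n => (r n - u) ^ (2 : ℝ)⁻¹) atTop (𝓝 ((u - u) ^ (2 : ℝ)⁻¹)) :=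
      (hlim.sub_const u).rpow_const (Or.inr (by norm_num))
    rw [sub_self, Real.zero_rpow (by norm_num)] at h0
    simpa using ENNReal.tendsto_ofReal h0
  -- a subsequence converges almost surely; its pointwise limit uses times after `u` only
  obtain ⟨ns, -, hns⟩ := (tendstoInMeasure_of_tendsto_eLpNorm two_ne_zero
    (fun n => (hX _ (hr n).le).aestronglyMeasurable) (hX u le_rfl).aestronglyMeasurable
    hL2).exists_seq_tendsto_ae
  refine ⟨fun ω => limUnder atTop fun n => X (r (ns n)) ω, ?_, ?_⟩
  · exact @StronglyMeasurable.limUnder _ _ _ (sigmaOn X (Ioi u)) _ _ _ _ _ _ _ fun n =>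
       (measurable_sigmaOn (hr (ns n))).stronglyMeasurable
  · exact hns.mono fun ω hω => hω.limUnder_eq.symm

variable {Ω : Type*} [mΩ : MeasurableSpace Ω] {P : Measure Ω} [IsProbabilityMeasure P] {θ : ℝ}
  {Z : ℝ → Ω → ℝ}

/-- The covariance follows from the vanishing at time `0`, the second moments and the conditional
mean given the values at times `0` and `t`. -/
lemma IsJoinedProcess.integral_affineMap_mul (hZ : IsJoinedProcess P θ Z) (hθ : 0 < θ) {s t : ℝ}
    (hs : 0 ≤ s) (hst : s ≤ t) :
    ∫ ω, affineMap θ s (Z s ω) * affineMap θ t (Z t ω) ∂P = s := by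
  rcases hst.eq_or_lt with rfl | hst
  · simpa only [sq] using (hZ.moments hθ hs).2.2
  have ht : 0 ≤ t := hs.trans hst.le
  have h0 : ∀ᵐ ω ∂P, affineMap θ 0 (Z 0 ω) = 0 := hZ.start.mono fun ω hω => by
    rw [affineMap_of_lt zero_lt_one, hω]
    simp
  rcases hs.eq_or_lt with rfl | hs'
  · rw [integral_congr_ae (g := fun _ => (0 : ℝ)) (h0.mono fun ω hω => by simp [hω]),
      integral_zero]
  have hXt := (hZ.moments hθ ht).1
  have hDm := hZ.memLp_harnessDev hθ le_rfl hs ht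
  have hm : sigmaOn Z (Icc 0 0 ∪ Ici t) ≤ mΩ := sigmaOn_le fun r hr =>
    hZ.measurable r (hr.elim (fun h => h.1) fun h => ht.trans h)
  have hXm : AEStronglyMeasurable[sigmaOn Z (Icc 0 0 ∪ Ici t)]
      (fun ω => affineMap θ t (Z t ω)) P :=
    ((measurable_affineMap θ t).comp
      (measurable_sigmaOn (Or.inr self_mem_Ici))).stronglyMeasurable.aestronglyMeasurable
  have hpull := condExp_mul_of_aestronglyMeasurable_right hXm (hDm.integrable_mul hXt)
    (hDm.integrable one_le_two)
  have hD0 : ∫ ω, harnessDev θ 0 s t (Z 0 ω) (Z s ω) (Z t ω) * affineMap θ t (Z t ω) ∂P = 0 := by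
    have h := integral_congr_ae (hpull.trans (((hZ.condExp_harness hθ le_rfl hs' hst).1).mul
      (EventuallyEq.refl _ _)))
    rw [integral_condExp hm] at h
    simpa using h
  have heq : ∀ᵐ ω ∂P, affineMap θ s (Z s ω) * affineMap θ t (Z t ω) =
      harnessDev θ 0 s t (Z 0 ω) (Z s ω) (Z t ω) * affineMap θ t (Z t ω) +
        s / t * affineMap θ t (Z t ω) ^ 2 := h0.mono fun ω hω => by
    simp only [harnessDev, hω, sub_zero]
    ring
  have hi : Integrable (fun ω => harnessDev θ 0 s t (Z 0 ω) (Z s ω) (Z t ω) *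
      affineMap θ t (Z t ω)) P := hDm.integrable_mul hXt
  rw [integral_congr_ae heq, integral_add hi (hXt.integrable_sq.const_mul _), hD0,
    integral_const_mul, (hZ.moments hθ ht).2.2]
  have : t ≠ 0 := (hs'.trans hst).ne'
  field_simp
  simp

lemma IsJoinedProcess.integral_incr_sq (hZ : IsJoinedProcess P θ Z) (hθ : 0 < θ) {u r : ℝ}
    (hu : 0 ≤ u) (hur : u ≤ r) :
    ∫ ω, (affineMap θ r (Z r ω) - affineMap θ u (Z u ω)) ^ 2 ∂P = r - u := by
  obtain ⟨hr₁, -, hr₂⟩ := hZ.moments hθ (hu.trans hur)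
  obtain ⟨hu₁, -, hu₂⟩ := hZ.moments hθ hu
  have h : ∀ ω, (affineMap θ r (Z r ω) - affineMap θ u (Z u ω)) ^ 2 =
      affineMap θ r (Z r ω) ^ 2 + affineMap θ u (Z u ω) ^ 2 -
        2 * (affineMap θ u (Z u ω) * affineMap θ r (Z r ω)) := fun ω => by ring
  have hi : Integrable (fun ω => affineMap θ u (Z u ω) * affineMap θ r (Z r ω)) P :=
    hu₁.integrable_mul hr₁
  have hi' : Integrable (fun ω => affineMap θ r (Z r ω) ^ 2 + affineMap θ u (Z u ω) ^ 2) P :=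
    hr₁.integrable_sq.add hu₁.integrable_sq
  simp only [h]
  rw [integral_sub hi' (hi.const_mul 2),
    integral_add hr₁.integrable_sq hu₁.integrable_sq, integral_const_mul, hr₂, hu₂,
    hZ.integral_affineMap_mul hθ hu hur]
  ring

/-- Conditional mean and variance given the past up to `s` and the future strictly after `u`. -/
lemma IsJoinedProcess.condExp_condVar (hZ : IsJoinedProcess P θ Z) (hθ : 0 < θ) {s t u : ℝ}
    (hs : 0 ≤ s) (hst : s < t) (htu : t < u) :
    (P[fun ω => affineMap θ t (Z t ω) | sigmaOn Z (Icc 0 s ∪ Ioi u)] =ᵐ[P] fun ω =>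
      (u - t) / (u - s) * affineMap θ s (Z s ω) + (t - s) / (u - s) * affineMap θ u (Z u ω)) ∧
    Var[fun ω => affineMap θ t (Z t ω); P | sigmaOn Z (Icc 0 s ∪ Ioi u)] =ᵐ[P] fun ω =>
      harnessVar θ s t u (Z s ω) (Z u ω) := by
  have ht : 0 ≤ t := hs.trans hst.le
  have hu : 0 ≤ u := ht.trans htu.le
  have h₁₂ : sigmaOn Z (Icc 0 s ∪ Ioi u) ≤ sigmaOn Z (Icc 0 s ∪ Ici u) :=
    sigmaOn_mono (union_subset_union_right _ Ioi_subset_Ici_self)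
  have h₂ : sigmaOn Z (Icc 0 s ∪ Ici u) ≤ mΩ := sigmaOn_le fun r hr =>
    hZ.measurable r (hr.elim (fun h => h.1) fun h => hu.trans h)
  have hX : ∀ r, 0 ≤ r → MemLp (fun ω => affineMap θ r (Z r ω)) 2 P := fun r hr =>
    (hZ.moments hθ hr).1
  have hDm := hZ.memLp_harnessDev hθ hs ht hu
  have hVm := hZ.memLp_harnessVar (t := t) hθ hs hu
  obtain ⟨hc₁, hc₂⟩ := hZ.condExp_harness hθ hs hst htu
  set D : Ω → ℝ := fun ω => harnessDev θ s t u (Z s ω) (Z t ω) (Z u ω) with hD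
  set V : Ω → ℝ := fun ω => harnessVar θ s t u (Z s ω) (Z u ω) with hV
  set L : Ω → ℝ := fun ω => (u - t) / (u - s) * affineMap θ s (Z s ω) +
    (t - s) / (u - s) * affineMap θ u (Z u ω) with hL
  have hD0 : P[D | sigmaOn Z (Icc 0 s ∪ Ioi u)] =ᵐ[P] 0 :=
    condExp_eq_of_condExp_eq h₁₂ h₂ stronglyMeasurable_zero.aestronglyMeasurable hc₁
  have hDV0 : P[fun ω => D ω ^ 2 - V ω | sigmaOn Z (Icc 0 s ∪ Ioi u)] =ᵐ[P] 0 :=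
    condExp_eq_of_condExp_eq h₁₂ h₂ stronglyMeasurable_zero.aestronglyMeasurable hc₂
  -- the outer values are measurable with respect to the conditioning σ-algebra
  have hs_meas : AEStronglyMeasurable[sigmaOn Z (Icc 0 s ∪ Ioi u)] (fun ω => affineMap θ s (Z s ω)) P :=
    ((measurable_affineMap θ s).comp
      (measurable_sigmaOn (Or.inl ⟨hs, le_rfl⟩))).stronglyMeasurable.aestronglyMeasurable
  have hu_meas : AEStronglyMeasurable[sigmaOn Z (Icc 0 s ∪ Ioi u)] (fun ω => affineMap θ u (Z u ω)) P := by
    have h := aestronglyMeasurable_sigmaOn_Ioi (P := P) (X := affineTransform θ Z) (u := u)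
      (fun r hr => by
        rw [funext (affineTransform_apply θ Z r)]
        exact (measurable_affineMap θ r).comp (hZ.measurable r (hu.trans hr)))
      (fun r hr => by
        simpa only [funext (affineTransform_apply θ Z r)] using hX r (hu.trans hr))
      (fun r hr => by
        simpa only [affineTransform_apply] using hZ.integral_incr_sq hθ hu hr)
    rw [sigmaOn_affineTransform hθ.ne', funext (affineTransform_apply θ Z u)] at h
    exact h.mono (sigmaOn_mono subset_union_right)
  have hL_meas : AEStronglyMeasurable[sigmaOn Z (Icc 0 s ∪ Ioi u)] L P := (hs_meas.const_mul _).add (hu_meas.const_mul _)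
  have hL_int : Integrable L P :=
    (((hX s hs).const_mul _).add ((hX u hu).const_mul _)).integrable one_le_two
  have hV_meas : AEStronglyMeasurable[sigmaOn Z (Icc 0 s ∪ Ioi u)] V P := by
    have h : V = fun ω => (u - t) * (t - s) / (u - s) *
        (1 + θ / (u - s) * ((u - 1) * affineMap θ s (Z s ω) + (1 - s) * affineMap θ u (Z u ω))) := by
      funext ω
      simp only [hV, harnessVar]
      ring
    rw [h]
    exact (((((hs_meas.const_mul _).add (hu_meas.const_mul _)).const_mul _).const_add 1).const_mul _)
  have hmean : P[fun ω => affineMap θ t (Z t ω) | sigmaOn Z (Icc 0 s ∪ Ioi u)] =ᵐ[P] L := by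
    have h : (fun ω => affineMap θ t (Z t ω)) = D + L := by
      funext ω
      simp only [hD, hL, harnessDev, Pi.add_apply]
      ring
    rw [h]
    refine (condExp_add (hDm.integrable one_le_two) hL_int _).trans ?_
    filter_upwards [hD0, condExp_of_aestronglyMeasurable' (h₁₂.trans h₂) hL_meas hL_int] with ω h₁ h₂
    simp [h₁, h₂]
  refine ⟨hmean, ?_⟩
  have hsq : ((fun ω => affineMap θ t (Z t ω)) - P[fun ω => affineMap θ t (Z t ω) | sigmaOn Z (Icc 0 s ∪ Ioi u)]) ^ 2
      =ᵐ[P] (fun ω => D ω ^ 2 - V ω) + V := by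
    filter_upwards [hmean] with ω hω
    simp only [Pi.pow_apply, Pi.sub_apply, Pi.add_apply, hω]
    simp only [hD, hL, harnessDev, sub_add_cancel]
  refine (condExp_congr_ae hsq).trans ?_
  have hVi := hVm.integrable one_le_two
  have hDVi : Integrable (fun ω => D ω ^ 2 - V ω) P := hDm.integrable_sq.sub hVi
  refine (condExp_add hDVi hVi _).trans ?_
  filter_upwards [hDV0, condExp_of_aestronglyMeasurable' (h₁₂.trans h₂) hV_meas hVi] with ω h₁ h₂
  simp [h₁, h₂]

theorem IsJoinedProcess.isBiPoisson (hZ : IsJoinedProcess P θ Z) (hθ : 0 < θ) :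
    IsBiPoisson P θ θ 1 (affineTransform θ Z) := by
  have hX : ∀ r, affineTransform θ Z r = fun ω => affineMap θ r (Z r ω) := fun r =>
    funext (affineTransform_apply θ Z r)
  refine ⟨fun t ht => ?_, fun t ht => ?_, hZ.markov.affineTransform hθ.ne', fun t ht => ?_,
    fun s t hs ht => ?_, fun s t u hs hst htu => ?_, fun s t u hs hst htu => ?_⟩
  · rw [hX]
    exact (measurable_affineMap θ t).comp (hZ.measurable t ht)
  · rw [hX]
    exact (hZ.moments hθ ht).1
  · rw [hX]
    exact (hZ.moments hθ ht).2.1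
  · simp only [hX]
    rcases le_total s t with h | h
    · rw [min_eq_right h]
      simpa only [mul_comm] using hZ.integral_affineMap_mul hθ hs h
    · rw [min_eq_left h]
      exact hZ.integral_affineMap_mul hθ ht h
  · rw [sigmaOn_affineTransform hθ.ne', hX]
    simp only [hX]
    exact (hZ.condExp_condVar hθ hs hst htu).1
  · rw [sigmaOn_affineTransform hθ.ne', hX]
    refine (hZ.condExp_condVar hθ hs hst htu).2.trans (Eventually.of_forall fun ω => ?_)
    simp only [hX, harnessVar, one_mul, sub_self, zero_mul, sub_zero]

end Conclusion

end BiPoisson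

theorem mainTheorem1 (θ : ℝ) (hθ : 0 < θ) :
    (∃ (Ω : Type) (_ : MeasurableSpace Ω) (P : Measure Ω) (Z : ℝ → Ω → ℝ),
      IsProbabilityMeasure P ∧ BiPoisson.IsJoinedProcess P θ Z) ∧
    ∀ (Ω : Type*) [MeasurableSpace Ω] (P : Measure Ω) [IsProbabilityMeasure P]
      (Z : ℝ → Ω → ℝ), BiPoisson.IsJoinedProcess P θ Z →
        BiPoisson.IsBiPoisson P θ θ 1 (BiPoisson.affineTransform θ Z) := by
  refine ⟨⟨_, _, _, _, BiPoisson.isProbabilityMeasure_modelMeasure (by positivity),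
    BiPoisson.isJoinedProcess_modelZ BiPoisson.isPoissonProcess_countPoints hθ⟩, ?_⟩
  intro Ω _ P _ Z hZ
  exact hZ.isBiPoisson hθ
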